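/- All graphs are finite, simple, undirected and connected. For a graph $G$ and a set $S$ of nodes let $N[S]$ be the set of all nodes that lie in $S$ or have a neighbour in $S$. For a node $v_0$ let $\mathrm{Con}(G,v_0)$ be the family of all $S\subseteq V(G)$ with $v_0\in S$ that induce a connected subgraph, and let $$\mathrm{MRCE}(G,v_0)=\max_{S\in \mathrm{Con}(G,v_0)}\frac{|N[S]|}{|S|}.$$ A realization $I$ of $G$ assigns to every node $v$ a closed interval $I(v)=[l_v,r_v]$ of the real line with $l_v<r_v$ such that two distinct nodes are adjacent if and only if their intervals intersect; $G$ is an interval graph if it has a realization. Write $I(x)\sqsubset I(y)$ if $l_y<l_x$ and $r_x<r_y$; write $I(x)\cap_L I(y)$ if $l_x<l_y<r_x<r_y$, and $I(x)\cap_R I(y)$ if $l_y<l_x<r_y<r_x$. The algorithm $\mathrm{Interval}(G,v_0)$ works as follows. 1. Compute a realization $I$ of $G$ in which all $2|V(G)|$ interval ends are distinct, and the sets $L=\{v: r_v<l_{v_0}\}$, $C_L=\{v: I(v)\cap_L I(v_0)\}$, $C'=\{v: I(v)\sqsubset I(v_0)\}$, $C=\{v: I(v_0)\sqsubset I(v)\}$,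 $\{v_0\}$, $C_R=\{v: I(v)\cap_R I(v_0)\}$, $R=\{v: r_{v_0}<l_v\}$. Let $C^*$ be the set of those $v\in C$ for which there is no $v'\in C$ with $v'\neq v$ and $I(v)\sqsubset I(v')$. 2. For a side $D\in\{L,R\}$ and a node $v$, $\mathrm{Expand}(D,v)$ is the list of sets $\{v_1\},\{v_1,v_2\},\dots,\{v_1,\dots,v_k\}$, where $v_1=v$, where $v_{i+1}$ is, among the nodes $x$ with $I(x)\cap_D I(v_i)$, the one that reaches farthest to the side $D$ (smallest left end for $D=L$, greatest right end for $D=R$), and where $v_k$ is the first node for which there is no such $x$. 3. $\mathrm{Combine}(S,\mathcal L,\mathcal R)$ starts with the pair $(S,|N[S]|/|S|)$, runs through all $\ell\in\mathcal L$ and, for each of them, through all $r\in\mathcal R$, in the order of the lists, replaces the current pair by $T=S\cup \ell\cup r$ and its ratio $|N[T]|/|T|$ whenever this ratio is strictly greater than the current one, and returns the last pair. 4. The pool of candidates consists of $\mathrm{Combine}(\{v_0\},\mathrm{Expand}(L,v_0),\mathrm{Expand}(R,v_0))$ and of $\mathrm{Combine}(\{v_0,c\},\mathrm{Expand}(L,c),\mathrm{Expand}(R,c))$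 for all $c\in C^*$. Return a pair $(S,s)$ of maximum ratio $s$ in the pool (ties are broken arbitrarily). **Theorem.** (a) Let $G$ be a connected interval graph, $v_0$ a node of $G$, and $I$ any realization of $G$ with distinct ends. Then the seven sets of step 1 partition $V(G)$, step 4 has at least one possible result, and every pair $(S,s)$ that it may return is an optimal solution: $S\in \mathrm{Con}(G,v_0)$ and $s=|N[S]|/|S|=\mathrm{MRCE}(G,v_0)$. (b) The algorithm, including the computation of the realization, runs in $\mathcal O(n^3)$ time. That is, there are a word-RAM program and a constant $c$ such that, for every connected interval graph $G$ on $\{0,\dots,n-1\}$ (given by its adjacency matrix), every node $v_0$ and every word length $w\ge c(\lfloor\log_2 n\rfloor+1)$, the program halts after at most $c\,n^3$ steps and has then stored the interval ends of a realization $I$ of $G$ with distinct ends, the partition of step 1 for this $I$, and a pair $(S,s)$ ($s$ as a quotient of two natural numbers) that $\mathrm{Interval}(G,v_0)$ may return when it works with this $I$; in particular $(S,s)$ is an optimal solution. Here each arithmetic operation (addition, truncated subtraction, multiplication), comparison, memory access, assignment and branching on $w$-bit words costs one step. -/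

import Mathlib

noncomputable section

namespace MRCE

/-! ### Rooted connected expansion -/

section Graph

variable {V : Type*} [Fintype V]

open Classical in
/-- The closed neighbourhood `N[S]`: the nodes of `S` and all nodes with a neighbour in `S`. -/
def closedNbhd (G : SimpleGraph V) (S : Finset V) : Finset V :=
  Finset.univ.filter fun u => u ∈ S ∨ ∃ v ∈ S, G.Adj v u

/-- The expansion ratio `|N[S]| / |S|`. -/
def ratio (G : SimpleGraph V) (S : Finset V) : ℚ :=
  ((closedNbhd G S).card : ℚ) / (S.card : ℚ)

/-- `Con(G, v₀)`: the node sets that contain `v₀` and induce a connected subgraph. -/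
def Con (G : SimpleGraph V) (v₀ : V) : Set (Finset V) :=
  {S | v₀ ∈ S ∧ (G.induce (S : Set V)).Connected}

/-- The pair `p = (S, s)` is an optimal solution: `S ∈ Con(G, v₀)`, `s` is the ratio of `S`, and
`s` is the maximum of the ratios of the members of `Con(G, v₀)`, i.e. `s = MRCE(G, v₀)`. -/
def IsOptimal (G : SimpleGraph V) (v₀ : V) (p : Finset V × ℚ) : Prop :=
  p.1 ∈ Con G v₀ ∧ p.2 = ratio G p.1 ∧ IsGreatest (ratio G '' Con G v₀) p.2

end Graph

/-! ### Interval realizations -/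

/-- A realization of `G` by closed non-trivial intervals `I(v) = [l v, r v]` of the real line. -/
structure Realization {V : Type*} (G : SimpleGraph V) where
  l : V → ℝ
  r : V → ℝ
  lt : ∀ v, l v < r v
  adj_iff : ∀ u v, u ≠ v →
    (G.Adj u v ↔ (Set.Icc (l u) (r u) ∩ Set.Icc (l v) (r v)).Nonempty)

/-- A graph is an interval graph if it has a realization. -/
def IsIntervalGraph {V : Type*} (G : SimpleGraph V) : Prop := Nonempty (Realization G)

inductive Side
  | left
  | right

namespace Realization

variable {V : Type*} {G : SimpleGraph V} (I : Realization G)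

/-- All interval ends (left and right ones of all nodes) are distinct. -/
def DistinctEnds : Prop := Function.Injective (Sum.elim I.l I.r)

/-- `I(x) ⊏ I(y)`. -/
def Inside (x y : V) : Prop := I.l y < I.l x ∧ I.r x < I.r y

/-- `I(x) ∩_D I(y)`: the interval of `x` intersects that of `y` to the side `D`. -/
def Meets : Side → V → V → Prop
  | .left, x, y => I.l x < I.l y ∧ I.l y < I.r x ∧ I.r x < I.r y
  | .right, x, y => I.r y < I.r x ∧ I.l y < I.l x ∧ I.l x < I.r y

/-- How far the interval of `v` reaches to the side `D`: a smaller left end is farther to the left,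
a greater right end is farther to the right. -/
def reach : Side → V → ℝ
  | .left, v => - I.l v
  | .right, v => I.r v

theorem reach_lt {D : Side} {x y : V} (h : I.Meets D x y) : I.reach D y < I.reach D x := by
  cases D
  · exact neg_lt_neg h.1
  · exact h.1

variable [Fintype V]

open Classical in
/-- The set `C` of nodes whose intervals contain `I(v₀)`. -/
def containing (v₀ : V) : Finset V := Finset.univ.filter fun v => I.Inside v₀ v

open Classical in
/-- The position of the nodes relative to `I(v₀)`: the sets
`L, C_L, C', C, {v₀}, C_R, R`, in this order. -/
def region (v₀ : V) : Fin 7 → Finset V :=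
  ![Finset.univ.filter fun v => I.r v < I.l v₀,
    Finset.univ.filter fun v => I.Meets .left v v₀,
    Finset.univ.filter fun v => I.Inside v v₀,
    I.containing v₀,
    {v₀},
    Finset.univ.filter fun v => I.Meets .right v v₀,
    Finset.univ.filter fun v => I.r v₀ < I.l v]

open Classical in
/-- The core `C*`: the nodes of `C` whose interval is contained in that of no other node of `C`. -/
def core (v₀ : V) : Finset V :=
  (I.containing v₀).filter fun v => ¬ ∃ v' ∈ I.containing v₀, v ≠ v' ∧ I.Inside v v'

/-! ### The algorithm `Interval` -/

open Classical in
/-- The nodes `v'` with `I(v') ∩_D I(v)`. -/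
def candidates (D : Side) (v : V) : Finset V := Finset.univ.filter fun v' => I.Meets D v' v

/-- The candidate that reaches farthest to the side `D`, if there is a candidate. -/
def next (D : Side) (v : V) : Option V :=
  if h : (I.candidates D v).Nonempty then
    some (Classical.choose ((I.candidates D v).exists_max_image (I.reach D) h))
  else none

theorem meets_of_next {D : Side} {v v' : V} (h : I.next D v = some v') : I.Meets D v' v := by
  unfold next at h
  split_ifs at h with hne
  have hs := Classical.choose_spec ((I.candidates D v).exists_max_image (I.reach D) hne)
  rw [Option.some.inj h] at hs
  simpa [candidates] using hs.1

open Classical in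
/-- The number of nodes that reach farther than `v`; it decreases along an expansion. -/
def ahead (D : Side) (v : V) : ℕ := (Finset.univ.filter fun u => I.reach D v < I.reach D u).card

theorem ahead_lt {D : Side} {v v' : V} (h : I.next D v = some v') :
    I.ahead D v' < I.ahead D v := by
  have hr := I.reach_lt (I.meets_of_next h)
  unfold ahead
  refine Finset.card_lt_card (Finset.ssubset_iff_of_subset ?_ |>.2 ⟨v', ?_, ?_⟩)
  · intro u hu
    simp only [Finset.mem_filter, Finset.mem_univ, true_and] at hu ⊢
    exact hr.trans hu
  · simpa using hr
  · simp

open Classical in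
/-- The calls of `Expand` in which `v` is the current node and `S = Sols(count)`: the list of the
solutions `Sols(count), Sols(count + 1), …`. -/
def expandFrom (D : Side) (v : V) (S : Finset V) : List (Finset V) :=
  match h : I.next D v with
  | none => [S]
  | some v' => S :: expandFrom D v' (insert v' S)
termination_by I.ahead D v
decreasing_by exact I.ahead_lt h

/-- `Expand(D, v, I, P, 0)`. -/
def expand (D : Side) (v : V) : List (Finset V) := I.expandFrom D v {v}

end Realization

open Classical in
/-- `Combine(S, Left, Right, G)`. -/
def combine {V : Type*} [Fintype V] (G : SimpleGraph V) (S : Finset V)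
    (Left Right : List (Finset V)) : Finset V × ℚ :=
  Left.foldl (fun acc l => Right.foldl (fun acc r =>
    if acc.2 < ratio G (S ∪ l ∪ r) then (S ∪ l ∪ r, ratio G (S ∪ l ∪ r)) else acc) acc)
    (S, ratio G S)

open Classical in
/-- The pool `Sols` of the main routine. -/
def sols {V : Type*} [Fintype V] {G : SimpleGraph V} (I : Realization G) (v₀ : V) :
    Finset (Finset V × ℚ) :=
  {combine G {v₀} (I.expand .left v₀) (I.expand .right v₀)} ∪
    (I.core v₀).image fun c => combine G {v₀, c} (I.expand .left c) (I.expand .right c)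

/-- `p` is a pair that `Interval(G, v₀)` may return when it works with the realization `I`: a pair
of maximum ratio in the pool (`MaxRatio` may break ties in any way). -/
def IsIntervalOutput {V : Type*} [Fintype V] {G : SimpleGraph V} (I : Realization G) (v₀ : V)
    (p : Finset V × ℚ) : Prop :=
  p ∈ sols I v₀ ∧ ∀ q ∈ sols I v₀, q.2 ≤ p.2

/-! ### A word RAM with a step count

Programs are while-programs over scalar variables and arrays of `w`-bit words; every arithmetic
operation, comparison, memory access, assignment and branching costs one step. -/

inductive Expr
  | const (k : ℕ)
  | var (x : ℕ)
  | get (a : ℕ) (i : Expr)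
  | add (e f : Expr)
  | sub (e f : Expr)
  | mul (e f : Expr)
  | lt (e f : Expr)
  | eq (e f : Expr)

inductive Cmd
  | assign (x : ℕ) (e : Expr)
  | store (a : ℕ) (i e : Expr)
  | seq (c d : Cmd)
  | ite (e : Expr) (c d : Cmd)
  | while (e : Expr) (c : Cmd)

/-- The contents of the variables and of the arrays. -/
structure Store where
  var : ℕ → ℕ
  arr : ℕ → ℕ → ℕ

/-- The value of an expression: arithmetic is modulo `2 ^ w` (subtraction is cut off at `0`). -/
def Expr.eval (w : ℕ) (σ : Store) : Expr → ℕ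
  | .const k => k % 2 ^ w
  | .var x => σ.var x
  | .get a i => σ.arr a (i.eval w σ)
  | .add e f => (e.eval w σ + f.eval w σ) % 2 ^ w
  | .sub e f => e.eval w σ - f.eval w σ
  | .mul e f => (e.eval w σ * f.eval w σ) % 2 ^ w
  | .lt e f => (if e.eval w σ < f.eval w σ then 1 else 0) % 2 ^ w
  | .eq e f => (if e.eval w σ = f.eval w σ then 1 else 0) % 2 ^ w

/-- The number of steps for evaluating an expression. -/
def Expr.cost : Expr → ℕ
  | .const _ => 1
  | .var _ => 1
  | .get _ i => i.cost + 1
  | .add e f => e.cost + f.cost + 1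
  | .sub e f => e.cost + f.cost + 1
  | .mul e f => e.cost + f.cost + 1
  | .lt e f => e.cost + f.cost + 1
  | .eq e f => e.cost + f.cost + 1

def Store.setVar (σ : Store) (x k : ℕ) : Store :=
  { σ with var := Function.update σ.var x k }

def Store.setArr (σ : Store) (a i k : ℕ) : Store :=
  { σ with arr := Function.update σ.arr a (Function.update (σ.arr a) i k) }

/-- `Exec w c σ σ' t`: on a machine with `w`-bit words the program `c`, started in `σ`, halts in
`σ'` after exactly `t` steps. -/
inductive Exec (w : ℕ) : Cmd → Store → Store → ℕ → Prop
  | assign (x : ℕ) (e : Expr) (σ : Store) :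
      Exec w (.assign x e) σ (σ.setVar x (e.eval w σ)) (e.cost + 1)
  | store (a : ℕ) (i e : Expr) (σ : Store) :
      Exec w (.store a i e) σ (σ.setArr a (i.eval w σ) (e.eval w σ)) (i.cost + e.cost + 1)
  | seq {c d : Cmd} {σ σ' σ'' : Store} {s t : ℕ} :
      Exec w c σ σ' s → Exec w d σ' σ'' t → Exec w (.seq c d) σ σ'' (s + t)
  | ite_true {e : Expr} {c d : Cmd} {σ σ' : Store} {t : ℕ} :
      e.eval w σ ≠ 0 → Exec w c σ σ' t → Exec w (.ite e c d) σ σ' (e.cost + 1 + t)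
  | ite_false {e : Expr} {c d : Cmd} {σ σ' : Store} {t : ℕ} :
      e.eval w σ = 0 → Exec w d σ σ' t → Exec w (.ite e c d) σ σ' (e.cost + 1 + t)
  | while_true {e : Expr} {c : Cmd} {σ σ' σ'' : Store} {s t : ℕ} :
      e.eval w σ ≠ 0 → Exec w c σ σ' s → Exec w (.while e c) σ' σ'' t →
      Exec w (.while e c) σ σ'' (e.cost + 1 + s + t)
  | while_false {e : Expr} {c : Cmd} {σ : Store} :
      e.eval w σ = 0 → Exec w (.while e c) σ σ (e.cost + 1)

open Classical in
/-- The initial store for the input `(G, v₀)`: variable `0` holds the number `n` of nodes, variable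
`1` holds `v₀`, array `0` holds the adjacency matrix of `G` row by row, all else is `0`. -/
def inputStore {n : ℕ} (G : SimpleGraph (Fin n)) (v₀ : Fin n) : Store where
  var x := if x = 0 then n else if x = 1 then (v₀ : ℕ) else 0
  arr a k := if a = 0 ∧ ∃ u v : Fin n, k = u * n + v ∧ G.Adj u v then 1 else 0

open Classical in
/-- The final store `σ` holds the realization `I` (left ends in array `2`, right ends in array `3`),
the partition of the nodes by their position relative to `I(v₀)` (array `4`), and the returned
pair `p = (S, s)`: array `1` holds the indicator of `S`, and `s` is the quotient of the variables
`2` and `3`. -/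
structure Holds {n : ℕ} {G : SimpleGraph (Fin n)} (σ : Store) (I : Realization G) (v₀ : Fin n)
    (p : Finset (Fin n) × ℚ) : Prop where
  leftEnd : ∀ v : Fin n, I.l v = (σ.arr 2 v : ℝ)
  rightEnd : ∀ v : Fin n, I.r v = (σ.arr 3 v : ℝ)
  position : ∀ (v : Fin n) (k : Fin 7), v ∈ I.region v₀ k ↔ σ.arr 4 v = k
  members : ∀ v : Fin n, σ.arr 1 v = if v ∈ p.1 then 1 else 0
  denominator : σ.var 3 ≠ 0
  value : p.2 = (σ.var 2 : ℚ) / (σ.var 3 : ℚ)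

end MRCE

end

/-!
Optimality. Fix a realization with distinct ends. For a connected set `S` the closed neighbourhood
consists of the nodes whose intervals meet the hull of `S` (`Realization.mem_closedNbhd_iff`), so
it is enough to find a candidate with at most as many nodes whose hull covers that of `S`. If `S`
contains a node of `C`, let `c` be a maximal interval of `C` above it, and `c = v₀` otherwise; no
interval of `S` then contains that of `c`. Starting from `c`, the greedy expansion to a side `D`
reaches as far as `S` with at most as many new nodes as `S` has nodes that reach farther than `c`
to this side (`Realization.exists_chain_of_connected`): the intervals of `S` leave no gap
(`Realization.exists_cover`), so that each new node of the expansion passes a node of `S`. No node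
of `S` reaches farther than `c` to both sides, and neither `v₀` nor the node below `c` reaches
farther to any side, which gives the bound on the number of nodes
(`Realization.exists_candidate`). As `Combine` returns the best of its candidates
(`combine_spec`), every output is optimal.

Computing a realization. A transitive orientation `F` of the complement of an interval graph is an
interval order, because the graph has no induced cycle of length four (`IsTO.interval_order`).
Hence the sets of predecessors form a chain, and the numbers of predecessors yield a realization
(`rankRealization`). The orientation is found in Golumbic's manner: as long as there are edges,
orient the implication class `Cls` of an arc by breadth-first search and delete its edges. This
works since the span of the class is a module, so that a transitive orientation of the rest exists
(`exists_isTO_removeCls`), and since the class together with any transitive orientation of the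
rest is transitive (`IsTO.union_cls`). Each arc enters the queue at most once and costs `O(n)`
steps, which is `O(n³)` in total.

Searching. The number `|N[S]|` is `n` minus the numbers of intervals to the left of the leftmost
and to the right of the rightmost interval of a candidate `S`, and `|S|` is known from the lengths
of the two expansions (`Realization.Candidate.card_closedNbhd`, `Realization.Candidate.card_eq`).
With tables for these numbers and for the successors in the expansions, a candidate is tested in
constant time, and there are at most `n²` candidates for each of the at most `n` bases. Only the
two last nodes of the best candidate are stored; since its set is determined by them, a final walk
along the expansions marks its nodes (`Realization.Chain.eq_or_next`).

Programs are treated by rules in the style of a Hoare logic with a step count: `Runs w c σ Q` says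
that `c` halts and that the final store and the number of steps satisfy `Q`. Only an upper bound
on the number of steps is carried along, and every value is shown to stay below `2 ^ w`. What a
program leaves unchanged is read off its text (`Exec.same`).
-/

noncomputable section

namespace MRCE

/-! ### Transitive orientations and implication classes -/

section Orientation

variable {V : Type*}

/-- `F` is a transitive orientation of the symmetric relation `E`. -/
structure IsTO (E F : V → V → Prop) : Prop where
  sub : ∀ {u v}, F u v → E u v
  total : ∀ {u v}, E u v → F u v ∨ F v u
  asymm : ∀ {u v}, F u v → ¬ F v u
  trans : ∀ {u v z}, F u v → F v z → F u z

/-- The implication class of the arc `(x, y)` in the symmetric relation `E`: an orientation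
`a → b` forces `a → c` if `b`, `c` are unrelated, and `c → b` if `a`, `c` are unrelated. -/
inductive Cls (E : V → V → Prop) (x y : V) : V → V → Prop
  | base : Cls E x y x y
  | stepR {a b c : V} : Cls E x y a b → E a c → ¬ E b c → Cls E x y a c
  | stepL {a b c : V} : Cls E x y a b → E c b → ¬ E a c → Cls E x y c b

/-- What remains of `E` when the implication class of `(x, y)` is removed in both directions. -/
def removeCls (E : V → V → Prop) (x y : V) (u v : V) : Prop :=
  E u v ∧ ¬ Cls E x y u v ∧ ¬ Cls E x y v u

variable {E F : V → V → Prop} {x y : V}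

theorem removeCls_symm (hs : ∀ {u v}, E u v → E v u) {u v : V} (h : removeCls E x y u v) :
    removeCls E x y v u := ⟨hs h.1, h.2.2, h.2.1⟩

theorem IsTO.irrefl (h : IsTO E F) {u : V} : ¬ F u u := fun hu => h.asymm hu hu

theorem IsTO.edge_irrefl (h : IsTO E F) {u : V} : ¬ E u u := fun hu =>
  (h.total hu).elim h.irrefl h.irrefl

theorem IsTO.reverse (hs : ∀ {u v}, E u v → E v u) (h : IsTO E F) :
    IsTO E (fun u v => F v u) where
  sub hu := hs (h.sub hu)
  total hu := (h.total hu).symm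
  asymm hu := h.asymm hu
  trans hu hv := h.trans hv hu

theorem Cls.edge (hxy : E x y) {a b : V} (h : Cls E x y a b) : E a b := by
  induction h with
  | base => exact hxy
  | stepR _ h _ _ => exact h
  | stepL _ h _ _ => exact h

theorem Cls.trans {a b c d : V} (h : Cls E x y a b) (h' : Cls E a b c d) : Cls E x y c d := by
  induction h' with
  | base => exact h
  | stepR _ h1 h2 ih => exact .stepR ih h1 h2
  | stepL _ h1 h2 ih => exact .stepL ih h1 h2

theorem Cls.symm (hs : ∀ {u v}, E u v → E v u) (hxy : E x y) {a b : V} (h : Cls E x y a b) :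
    Cls E a b x y := by
  induction h with
  | base => exact .base
  | stepR h h1 h2 ih =>
    exact Cls.trans (.stepR .base (h.edge hxy) fun h => h2 (hs h)) ih
  | stepL h h1 h2 ih =>
    exact Cls.trans (.stepL .base (h.edge hxy) fun h => h2 (hs h)) ih

/-- A transitive orientation that contains one arc of an implication class contains all of it. -/
theorem Cls.sub_of_isTO (hs : ∀ {u v}, E u v → E v u) (hF : IsTO E F) (hxy : F x y) {a b : V}
    (h : Cls E x y a b) : F a b := by
  induction h with
  | base => exact hxy
  | stepR _ h1 h2 ih =>
    exact (hF.total h1).resolve_right fun h3 => h2 (hs (hF.sub (hF.trans h3 ih)))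
  | stepL _ h1 h2 ih =>
    exact (hF.total h1).resolve_right fun h3 => h2 (hF.sub (hF.trans ih h3))

/-- In a comparability graph an implication class contains no arc in both directions. -/
theorem Cls.asymm (hs : ∀ {u v}, E u v → E v u) (hF : IsTO E F) (hxy : E x y) {a b : V}
    (h : Cls E x y a b) : ¬ Cls E x y b a := by
  rcases hF.total hxy with hx | hx
  · exact fun h' => hF.asymm (h.sub_of_isTO hs hF hx) (h'.sub_of_isTO hs hF hx)
  · exact fun h' => (hF.reverse hs).asymm (h.sub_of_isTO hs (hF.reverse hs) hx)
      (h'.sub_of_isTO hs (hF.reverse hs) hx)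

/-- An implication class of a comparability graph is transitive. If `a → b → c` lies in the class
and `a → c` does not, then following the class from `(b, c)` one sees that `a` is joined by arcs of
the class to the tails of all its arcs; but `a` is itself the tail of the arc `(a, b)`. -/
theorem Cls.transitive (hs : ∀ {u v}, E u v → E v u) (hF : IsTO E F) (hxy : E x y) {a b c : V}
    (hab : Cls E x y a b) (hbc : Cls E x y b c) : Cls E x y a c := by
  by_contra hac
  have hEac : E a c := by
    by_contra hE
    exact hbc.asymm hs hF hxy (hab.stepL (hs (hbc.edge hxy)) hE)
  have key : ∀ {b' c' : V}, Cls E b c b' c' →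
      Cls E x y b' c' ∧ Cls E x y a b' ∧ E a c' ∧ ¬ Cls E x y a c' := by
    intro b' c' h
    induction h with
    | base => exact ⟨hbc, hab, hEac, hac⟩
    | @stepR b' c' c'' h h1 h2 ih =>
      obtain ⟨i1, i2, i3, i4⟩ := ih
      have hn : Cls E x y b' c'' := i1.stepR h1 h2
      have hE : E a c'' := by
        by_contra hE
        exact hn.asymm hs hF hxy (i2.stepL (hs h1) hE)
      exact ⟨hn, i2, hE, fun h3 => i4 (h3.stepR i3 fun h4 => h2 (hs h4))⟩
    | @stepL b' c' b'' h h1 h2 ih =>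
      obtain ⟨i1, i2, i3, i4⟩ := ih
      have hn : Cls E x y b'' c' := i1.stepL h1 h2
      have hE : E a b'' := by
        by_contra hE
        exact i4 (hn.stepL i3 fun h4 => hE (hs h4))
      exact ⟨hn, i2.stepR hE h2, i3, i4⟩
  exact hF.edge_irrefl ((key ((hbc.symm hs hxy).trans hab)).2.1.edge hxy)

/-- The nodes spanned by the implication class of `(x, y)`. -/
def clsSpan (E : V → V → Prop) (x y : V) (m : V) : Prop := ∃ d, Cls E x y m d ∨ Cls E x y d m

/-- The span of an implication class is a module: a node outside of it is related to all of its
nodes or to none. -/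
theorem clsSpan_module (hs : ∀ {u v}, E u v → E v u) (hxy : E x y) {z m m' : V}
    (hz : ¬ clsSpan E x y z) (hm : clsSpan E x y m) (hm' : clsSpan E x y m') (h : E z m) :
    E z m' := by
  have arc : ∀ {b c}, Cls E x y b c → (E z b ↔ E z c) := by
    intro b c hbc
    constructor
    · intro h1
      by_contra h2
      exact hz ⟨b, .inr (hbc.stepR (hs h1) fun h => h2 (hs h))⟩
    · intro h1
      by_contra h2
      exact hz ⟨c, .inl (hbc.stepL h1 fun h => h2 (hs h))⟩
  have all : ∀ {b c b' c'}, Cls E x y b c → E z b → Cls E b c b' c' → E z b' := by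
    intro b c b' c' hbc hb h'
    induction h' with
    | base => exact hb
    | stepR _ _ _ ih => exact ih
    | stepL h1 h2 h3 ih =>
      exact (arc ((hbc.trans h1).stepL h2 h3)).2 ((arc (hbc.trans h1)).1 ih)
  obtain ⟨d, hd⟩ := hm
  obtain ⟨d', hd'⟩ := hm'
  obtain ⟨b, c, hbc, hb⟩ : ∃ b c, Cls E x y b c ∧ E z b := by
    rcases hd with hd | hd
    · exact ⟨_, _, hd, h⟩
    · exact ⟨_, _, hd, (arc hd).2 h⟩
  rcases hd' with hd' | hd'
  · exact all hbc hb ((hbc.symm hs hxy).trans hd')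
  · exact (arc hd').1 (all hbc hb ((hbc.symm hs hxy).trans hd'))

/-- A node that is joined to both ends of an arc of the class by edges outside of the class does
not belong to the span of the class. -/
theorem not_clsSpan_of_removeCls (hs : ∀ {u v}, E u v → E v u) (hF : IsTO E F) (hxy : E x y)
    {a b c : V} (hac : Cls E x y a c) (ha : removeCls E x y b a) (hc : removeCls E x y b c) :
    ¬ clsSpan E x y b := by
  have key : ∀ {a' c' : V}, Cls E a c a' c' →
      Cls E x y a' c' ∧ removeCls E x y b a' ∧ removeCls E x y b c' := by
    intro a' c' h
    induction h with
    | base => exact ⟨hac, ha, hc⟩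
    | @stepR a' c' c'' h h1 h2 ih =>
      obtain ⟨i1, i2, i3⟩ := ih
      have hn : Cls E x y a' c'' := i1.stepR h1 h2
      have hE : E b c'' := by
        by_contra hE
        exact i2.2.2 (hn.stepR (hs i2.1) fun h => hE (hs h))
      exact ⟨hn, i2, hE, fun h => i3.2.1 (h.stepR i3.1 fun h4 => h2 (hs h4)),
        fun h => i3.2.2 (h.stepL (hs i3.1) fun h4 => h2 (hs h4))⟩
    | @stepL a' c' a'' h h1 h2 ih =>
      obtain ⟨i1, i2, i3⟩ := ih
      have hn : Cls E x y a'' c' := i1.stepL h1 h2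
      have hE : E b a'' := by
        by_contra hE
        exact i3.2.1 (hn.stepL i3.1 fun h => hE (hs h))
      exact ⟨hn, ⟨hE, fun h => i2.2.1 (h.stepR i2.1 fun h4 => h2 (hs h4)),
        fun h => i2.2.2 (h.stepL (hs i2.1) fun h4 => h2 (hs h4))⟩, i3⟩
  rintro ⟨d, hd | hd⟩
  · exact hF.edge_irrefl (key ((hac.symm hs hxy).trans hd)).2.1.1
  · exact hF.edge_irrefl (key ((hac.symm hs hxy).trans hd)).2.2.1

open Classical in
/-- The orientation `F`, changed so that every node outside of the module `M` is directed to, or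
from, all nodes of `M` in the way `F` directs it relative to the representative `x` of `M`. -/
def collapse (F : V → V → Prop) (M : V → Prop) (x : V) (u v : V) : Prop :=
  if M u ∧ M v then F u v else F (if M u then x else u) (if M v then x else v)

/-- Removing an implication class from a comparability graph leaves a comparability graph. As the
span `M` of the class is a module, `collapse F M x` is a transitive orientation of the whole graph,
and it remains one when restricted to the edges that are left. -/
theorem exists_isTO_removeCls (hs : ∀ {u v}, E u v → E v u) (hF : IsTO E F) (hxy : E x y) :
    ∃ F', IsTO (removeCls E x y) F' := by
  classical
  set M := clsSpan E x y with hM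
  have hx : M x := ⟨y, .inl .base⟩
  have hmod : ∀ {z m m'}, ¬ M z → M m → M m' → E z m → E z m' :=
    fun h1 h2 h3 h4 => clsSpan_module hs hxy h1 h2 h3 h4
  have sub : ∀ {u v}, collapse F M x u v → E u v := by
    intro u v h
    unfold collapse at h
    by_cases hu : M u <;> by_cases hv : M v <;>
      simp only [hu, hv, reduceIte, and_self, and_true, and_false] at h
    · exact hF.sub h
    · exact hs (hmod hv hx hu (hs (hF.sub h)))
    · exact hmod hu hx hv (hF.sub h)
    · exact hF.sub h
  have total : ∀ {u v}, E u v → collapse F M x u v ∨ collapse F M x v u := by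
    intro u v h
    unfold collapse
    by_cases hu : M u <;> by_cases hv : M v <;>
      simp only [hu, hv, reduceIte, and_self, and_true, and_false]
    · exact hF.total h
    · exact (hF.total (hmod hv hu hx (hs h))).symm
    · exact hF.total (hmod hu hv hx h)
    · exact hF.total h
  have asymm : ∀ {u v}, collapse F M x u v → ¬ collapse F M x v u := by
    intro u v h
    unfold collapse at h ⊢
    by_cases hu : M u <;> by_cases hv : M v <;>
      simp only [hu, hv, reduceIte, and_self, and_true, and_false] at h ⊢ <;>
      exact hF.asymm h
  have trans : ∀ {u v z}, collapse F M x u v → collapse F M x v z → collapse F M x u z := by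
    intro u v z h h'
    unfold collapse at h h' ⊢
    by_cases hu : M u <;> by_cases hv : M v <;> by_cases hz : M z <;>
      simp only [hu, hv, hz, reduceIte, and_self, and_true, and_false] at h h' ⊢
    all_goals first
      | exact hF.trans h h'
      | exact h
      | exact h'
      | exact absurd h' (hF.asymm h)
  refine ⟨fun u v => collapse F M x u v ∧ removeCls E x y u v, fun h => h.2, fun h => ?_,
    fun h h' => asymm h.1 h'.1, ?_⟩
  · exact (total h.1).imp (fun h1 => ⟨h1, h⟩) fun h1 => ⟨h1, removeCls_symm hs h⟩
  · rintro u v z ⟨h1, h2⟩ ⟨h3, h4⟩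
    have h5 := trans h1 h3
    -- All arcs between `v ∉ M` and `M` have the same direction, so `u → v → z` with `u, z ∈ M` does
    -- not occur. If `u`, `z` were joined by an arc of the class, it would occur by
    -- `not_clsSpan_of_removeCls`.
    have aux : ¬ (clsSpan E x y u ∧ clsSpan E x y z ∧ ¬ clsSpan E x y v) := by
      rintro ⟨hu, hz, hv⟩
      unfold collapse at h1 h3
      rw [← hM] at hu hz hv
      simp only [hu, hz, hv, and_false, false_and, if_true, if_false] at h1 h3
      exact hF.asymm h1 h3
    refine ⟨h5, sub h5, fun hc => ?_, fun hc => ?_⟩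
    · exact aux ⟨⟨_, .inl hc⟩, ⟨_, .inr hc⟩,
        not_clsSpan_of_removeCls hs hF hxy hc (removeCls_symm hs h2) h4⟩
    · exact aux ⟨⟨_, .inr hc⟩, ⟨_, .inl hc⟩,
        not_clsSpan_of_removeCls hs hF hxy hc h4 (removeCls_symm hs h2)⟩

/-- An implication class together with any transitive orientation of what remains is a transitive
orientation of the whole. -/
theorem IsTO.union_cls (hs : ∀ {u v}, E u v → E v u) (hF : IsTO E F) (hxy : E x y)
    {F' : V → V → Prop} (hF' : IsTO (removeCls E x y) F') :
    IsTO E (fun u v => Cls E x y u v ∨ F' u v) where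
  sub h := h.elim (fun h => h.edge hxy) fun h => (hF'.sub h).1
  total {u v} h := by
    by_cases h1 : Cls E x y u v
    · exact .inl (.inl h1)
    by_cases h2 : Cls E x y v u
    · exact .inr (.inl h2)
    exact (hF'.total ⟨h, h1, h2⟩).imp .inr .inr
  asymm {u v} h h' := by
    rcases h with h | h <;> rcases h' with h' | h'
    · exact h.asymm hs hF hxy h'
    · exact (hF'.sub h').2.2 h
    · exact (hF'.sub h).2.2 h'
    · exact hF'.asymm h h'
  trans {a b c} h h' := by
    rcases h with h | h <;> rcases h' with h' | h'
    · exact .inl (h.transitive hs hF hxy h')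
    · have hb := hF'.sub h'
      have hE : E a c := by
        by_contra hE
        exact hb.2.2 (h.stepL (hs hb.1) hE)
      by_cases h1 : Cls E x y a c
      · exact .inl h1
      by_cases h2 : Cls E x y c a
      · exact absurd (h2.transitive hs hF hxy h) hb.2.2
      refine .inr ((hF'.total ⟨hE, h1, h2⟩).resolve_right fun h3 => ?_)
      exact (hF'.sub (hF'.trans h' h3)).2.2 h
    · have hb := hF'.sub h
      have hE : E a c := by
        by_contra hE
        exact hb.2.2 (h'.stepR (hs hb.1) fun h => hE (hs h))
      by_cases h1 : Cls E x y a c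
      · exact .inl h1
      by_cases h2 : Cls E x y c a
      · exact absurd (h'.transitive hs hF hxy h2) hb.2.2
      refine .inr ((hF'.total ⟨hE, h1, h2⟩).resolve_right fun h3 => ?_)
      exact (hF'.sub (hF'.trans h3 h)).2.2 h'
    · exact .inr (hF'.trans h h')

end Orientation

/-! ### Realizations from transitive orientations -/

section Ends

variable {V : Type*} {G : SimpleGraph V}

/-- Two distinct nodes that are not adjacent. -/
def nonAdj (G : SimpleGraph V) (u v : V) : Prop := u ≠ v ∧ ¬ G.Adj u v

theorem nonAdj_symm {u v : V} (h : nonAdj G u v) : nonAdj G v u :=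
  ⟨h.1.symm, fun h' => h.2 h'.symm⟩

theorem Realization.adj_iff' (I : Realization G) {u v : V} (h : u ≠ v) :
    G.Adj u v ↔ I.l u ≤ I.r v ∧ I.l v ≤ I.r u := by
  rw [I.adj_iff u v h]
  have hu := I.lt u
  have hv := I.lt v
  constructor
  · rintro ⟨p, ⟨h1, h2⟩, h3, h4⟩
    exact ⟨h1.trans h4, h3.trans h2⟩
  · rintro ⟨h1, h2⟩
    exact ⟨max (I.l u) (I.l v), ⟨le_max_left _ _, max_le hu.le h2⟩,
      ⟨le_max_right _ _, max_le h1 hv.le⟩⟩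

theorem Realization.nonAdj_iff (I : Realization G) {u v : V} :
    nonAdj G u v ↔ I.r u < I.l v ∨ I.r v < I.l u := by
  have hu := I.lt u
  have hv := I.lt v
  constructor
  · rintro ⟨h1, h2⟩
    rw [I.adj_iff' h1, not_and_or, not_le, not_le] at h2
    exact h2.symm
  · intro h
    have hne : u ≠ v := by
      rintro rfl
      rcases h with h | h <;> linarith
    refine ⟨hne, fun h2 => ?_⟩
    rw [I.adj_iff' hne] at h2
    rcases h with h | h
    · linarith [h2.2]
    · linarith [h2.1]

/-- The order "to the left of" of a realization orients the pairs of non-adjacent nodes. -/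
theorem Realization.isTO (I : Realization G) : IsTO (nonAdj G) (fun u v => I.r u < I.l v) where
  sub h := I.nonAdj_iff.2 (.inl h)
  total h := I.nonAdj_iff.1 h
  asymm {u v} h h' := by linarith [I.lt u, I.lt v]
  trans {u v z} h h' := by linarith [I.lt v]

/-- A transitive orientation of the complement of an interval graph is an interval order: if
`a → b` and `c → d` but neither `a → d` nor `c → b`, then `a, c, b, d` is an induced cycle of
length four. -/
theorem IsTO.interval_order (J : Realization G) {F : V → V → Prop} (hF : IsTO (nonAdj G) F)
    {a b c d : V} (hab : F a b) (hcd : F c d) : F a d ∨ F c b := by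
  by_contra! h
  obtain ⟨had, hcb⟩ := h
  have e1 : ¬ nonAdj G a d := fun h => (hF.total h).elim had fun h =>
    hcb (hF.trans hcd (hF.trans h hab))
  have e2 : ¬ nonAdj G c b := fun h => (hF.total h).elim hcb fun h =>
    had (hF.trans hab (hF.trans h hcd))
  have e3 : ¬ nonAdj G a c := fun h => (hF.total h).elim (fun h => had (hF.trans h hcd))
    fun h => hcb (hF.trans h hab)
  have e4 : ¬ nonAdj G b d := fun h => (hF.total h).elim (fun h => had (hF.trans hab h))
    fun h => hcb (hF.trans hcd h)
  have e5 := J.nonAdj_iff.1 (hF.sub hab)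
  have e6 := J.nonAdj_iff.1 (hF.sub hcd)
  simp only [J.nonAdj_iff, not_or, not_lt] at e1 e2 e3 e4
  rcases e5 with e5 | e5 <;> rcases e6 with e6 | e6 <;> linarith [e1.1, e1.2, e2.1, e2.2, e3.1,
    e3.2, e4.1, e4.2]

open Classical in
/-- The number of nodes that precede `v`. -/
def predCount [Fintype V] (F : V → V → Prop) (v : V) : ℕ :=
  (Finset.univ.filter fun u => F u v).card

open Classical in
/-- The number of nodes with fewer predecessors than `v`. -/
def leftRank [Fintype V] (F : V → V → Prop) (v : V) : ℕ :=
  (Finset.univ.filter fun u => predCount F u < predCount F v).card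

open Classical in
/-- The number of nodes that do not come after `v`. -/
def rightRank [Fintype V] (F : V → V → Prop) (v : V) : ℕ :=
  (Finset.univ.filter fun u => ¬ F v u).card

/-- In an interval order the sets of predecessors form a chain, so that the nodes after `v` are
those with many predecessors. -/
theorem IsTO.lt_iff_rank [Fintype V] (J : Realization G) {F : V → V → Prop}
    (hF : IsTO (nonAdj G) F) (u v : V) : F v u ↔ rightRank F v ≤ leftRank F u := by
  classical
  have key : ∀ u u', F v u → ¬ F v u' → predCount F u' < predCount F u := by
    intro u u' h h'
    refine Finset.card_lt_card (Finset.ssubset_iff_of_subset ?_ |>.2 ⟨v, ?_, ?_⟩)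
    · intro a ha
      simp only [Finset.mem_filter, Finset.mem_univ, true_and] at ha ⊢
      exact (hF.interval_order J h ha).resolve_left h'
    · simpa using h
    · simpa using h'
  constructor
  · intro h
    refine Finset.card_le_card fun u' hu' => ?_
    simp only [Finset.mem_filter, Finset.mem_univ, true_and] at hu' ⊢
    exact key u u' h hu'
  · intro h
    by_contra hn
    refine absurd h (not_le.2 (Finset.card_lt_card
      (Finset.ssubset_iff_of_subset ?_ |>.2 ⟨u, ?_, ?_⟩)))
    · intro u' hu'
      simp only [Finset.mem_filter, Finset.mem_univ, true_and] at hu' ⊢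
      exact fun hvu' => absurd hu' (key u' u hvu' hn).not_gt
    · simpa using hn
    · simp

theorem leftRank_le [Fintype V] (F : V → V → Prop) (v : V) : leftRank F v ≤ Fintype.card V :=
  Finset.card_le_univ _

theorem rightRank_le [Fintype V] (F : V → V → Prop) (v : V) : rightRank F v ≤ Fintype.card V :=
  Finset.card_le_univ _

theorem two_mul_add_lt_iff {n p q : ℕ} {u v : Fin n} :
    2 * n * p + u < 2 * n * q + n + v ↔ p ≤ q := by
  have hu := u.2
  have hv := v.2
  constructor
  · intro h
    by_contra! hqp
    have : 2 * n * (q + 1) ≤ 2 * n * p := Nat.mul_le_mul_left _ hqp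
    rw [mul_add] at this
    omega
  · intro h
    have : 2 * n * p ≤ 2 * n * q := Nat.mul_le_mul_left _ h
    omega

/-- The realization of an interval graph that is read off a transitive orientation of its
complement. The left end at rank `p` of the node `v` is `2np + n + v`, the right end at rank `p` is
`2np + v`: all ends are distinct, and at equal rank right ends come first. -/
def rankRealization {n : ℕ} {G : SimpleGraph (Fin n)} (J : Realization G)
    {F : Fin n → Fin n → Prop} (hF : IsTO (nonAdj G) F) : Realization G where
  l v := ((2 * n * leftRank F v + n + v : ℕ) : ℝ)
  r v := ((2 * n * rightRank F v + v : ℕ) : ℝ)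
  lt v := by
    have h := mt (hF.lt_iff_rank J v v).2 hF.irrefl
    have h1 : 2 * n * (leftRank F v + 1) ≤ 2 * n * rightRank F v :=
      Nat.mul_le_mul_left _ (not_le.1 h)
    rw [mul_add] at h1
    rw [Nat.cast_lt]
    omega
  adj_iff u v huv := by
    have hc : ∀ u v, ((2 * n * rightRank F v + v : ℕ) : ℝ) <
        ((2 * n * leftRank F u + n + u : ℕ) : ℝ) ↔ F v u := fun u v => by
      rw [Nat.cast_lt, two_mul_add_lt_iff, hF.lt_iff_rank J]
    have hlt : ∀ v, ((2 * n * leftRank F v + n + v : ℕ) : ℝ) ≤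
        ((2 * n * rightRank F v + v : ℕ) : ℝ) := fun v => not_lt.1 (by rw [hc]; exact hF.irrefl)
    have hA : G.Adj u v ↔ ¬ F v u ∧ ¬ F u v := by
      constructor
      · exact fun h => ⟨fun h' => (hF.sub h').2 h.symm, fun h' => (hF.sub h').2 h⟩
      · intro h
        by_contra h'
        exact (hF.total ⟨huv, h'⟩).elim h.2 h.1
    rw [hA, ← hc, ← hc, not_lt, not_lt]
    constructor
    · rintro ⟨h1, h2⟩
      exact ⟨_, ⟨le_max_left _ _, max_le (hlt u) h2⟩, ⟨le_max_right _ _, max_le h1 (hlt v)⟩⟩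
    · rintro ⟨p, ⟨h1, h2⟩, h3, h4⟩
      exact ⟨h1.trans h4, h3.trans h2⟩

theorem rankRealization_distinctEnds {n : ℕ} {G : SimpleGraph (Fin n)} (J : Realization G)
    {F : Fin n → Fin n → Prop} (hF : IsTO (nonAdj G) F) :
    (rankRealization J hF).DistinctEnds := by
  have aux : ∀ {p q x y : ℕ}, x < 2 * n → y < 2 * n → 2 * n * p + x = 2 * n * q + y → x = y := by
    intro p q x y hx hy h
    have := congrArg (· % (2 * n)) h
    simpa [Nat.mul_add_mod, Nat.mod_eq_of_lt hx, Nat.mod_eq_of_lt hy] using this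
  have hn : ∀ u : Fin n, n + u < 2 * n ∧ (u : ℕ) < 2 * n := fun u => by omega
  rintro (u | u) (v | v) h <;>
    simp only [rankRealization, Sum.elim_inl, Sum.elim_inr, Nat.cast_inj, add_assoc] at h
  · have := aux (hn u).1 (hn v).1 h
    rw [Fin.ext (Nat.add_left_cancel this)]
  · have := aux (hn u).1 (hn v).2 h
    omega
  · have := aux (hn u).2 (hn v).1 h
    omega
  · rw [Fin.ext (aux (hn u).2 (hn v).2 h)]

end Ends

/-! ### Connected sets and their hulls -/

/-- The other side. -/
def Side.opp : Side → Side
  | .left => .right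
  | .right => .left

namespace Realization

variable {V : Type*} {G : SimpleGraph V} (I : Realization G)

theorem neg_reach_lt (D : Side) (v : V) : - I.reach D v < I.reach D.opp v := by
  have := I.lt v
  cases D <;> simp only [reach, Side.opp] <;> linarith

/-- The relation `I(x) ∩_D I(y)` in terms of the reaches to `D` and to the other side. -/
theorem meets_iff {D : Side} {x y : V} : I.Meets D x y ↔
    I.reach D y < I.reach D x ∧ I.reach D.opp x < I.reach D.opp y ∧
      - I.reach D y < I.reach D.opp x := by
  cases D <;> simp only [Meets, reach, Side.opp, neg_lt_neg_iff, neg_neg]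
  tauto

theorem adj_iff_reach (D : Side) {u v : V} (h : u ≠ v) : G.Adj u v ↔
    - I.reach D u ≤ I.reach D.opp v ∧ - I.reach D v ≤ I.reach D.opp u := by
  rw [I.adj_iff' h]
  cases D <;> simp only [reach, Side.opp, neg_neg, neg_le_neg_iff]
  tauto

theorem adj_of_meets {D : Side} {x y : V} (h : I.Meets D x y) : G.Adj x y := by
  rw [I.meets_iff] at h
  have hne : x ≠ y := by
    rintro rfl
    exact h.1.false
  rw [I.adj_iff_reach D hne]
  exact ⟨by linarith [I.neg_reach_lt D y], h.2.2.le⟩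

theorem adj_of_inside {x y : V} (h : I.Inside x y) : G.Adj x y := by
  have hne : x ≠ y := by
    rintro rfl
    exact h.1.false
  rw [I.adj_iff' hne]
  exact ⟨by linarith [I.lt x, h.2], by linarith [I.lt x, h.1]⟩

theorem Inside.trans {I : Realization G} {x y z : V} (h : I.Inside x y) (h' : I.Inside y z) :
    I.Inside x z := ⟨h'.1.trans h.1, h.2.trans h'.2⟩

theorem DistinctEnds.left_ne {I : Realization G} (hI : I.DistinctEnds) {u v : V} (h : u ≠ v) :
    I.l u ≠ I.l v := fun h' => h (Sum.inl_injective (hI (a₁ := .inl u) (a₂ := .inl v) h'))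

theorem DistinctEnds.right_ne {I : Realization G} (hI : I.DistinctEnds) {u v : V} (h : u ≠ v) :
    I.r u ≠ I.r v := fun h' => h (Sum.inr_injective (hI (a₁ := .inr u) (a₂ := .inr v) h'))

theorem DistinctEnds.left_ne_right {I : Realization G} (hI : I.DistinctEnds) (u v : V) :
    I.l u ≠ I.r v := fun h' => Sum.inl_ne_inr (hI (a₁ := .inl u) (a₂ := .inr v) h')

theorem DistinctEnds.reach_ne {I : Realization G} (hI : I.DistinctEnds) (D : Side) {u v : V}
    (h : u ≠ v) : I.reach D u ≠ I.reach D v := by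
  cases D
  · exact fun h' => hI.left_ne h (neg_injective h')
  · exact hI.right_ne h

theorem DistinctEnds.neg_reach_ne {I : Realization G} (hI : I.DistinctEnds) (D : Side) (u v : V) :
    - I.reach D u ≠ I.reach D.opp v := by
  cases D <;> simp only [reach, Side.opp, neg_neg, ne_eq, neg_inj]
  · exact hI.left_ne_right u v
  · exact fun h => hI.left_ne_right v u h.symm

/-- The intervals of a connected set leave no gap: if one of them reaches beyond the point `-p` to
the side `D`, and one of them reaches it from the side `D`, then one of them does both. -/
theorem exists_cover (D : Side) {S : Finset V} (hS : (G.induce (S : Set V)).Connected) {p : ℝ}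
    (h1 : ∃ t ∈ S, p < I.reach D t) (h2 : ∃ t ∈ S, - p ≤ I.reach D.opp t) :
    ∃ t ∈ S, p < I.reach D t ∧ - p ≤ I.reach D.opp t := by
  by_contra! h
  obtain ⟨a, ha, ha'⟩ := h1
  obtain ⟨b, hb, hb'⟩ := h2
  have hr := hS.preconnected ⟨a, ha⟩ ⟨b, hb⟩
  rw [SimpleGraph.reachable_iff_reflTransGen] at hr
  have key : ∀ z : (S : Set V), Relation.ReflTransGen (G.induce (S : Set V)).Adj ⟨a, ha⟩ z →
      p < I.reach D z := by
    intro z hz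
    induction hz with
    | refl => exact ha'
    | @tail x y _ hxy ih =>
      have hadj : G.Adj x y := hxy
      have h3 := h x x.2 ih
      rw [I.adj_iff_reach D hadj.ne] at hadj
      linarith [hadj.2]
  exact absurd hb' (not_le.2 (h b hb (key _ hr)))

/-- The closed neighbourhood of a connected set consists of the nodes whose intervals meet its
hull. -/
theorem mem_closedNbhd_iff [Fintype V] {S : Finset V} (hS : (G.induce (S : Set V)).Connected)
    {a b : V} (ha : a ∈ S) (hb : b ∈ S) (hla : ∀ t ∈ S, I.l a ≤ I.l t)
    (hrb : ∀ t ∈ S, I.r t ≤ I.r b) (u : V) :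
    u ∈ closedNbhd G S ↔ I.l a ≤ I.r u ∧ I.l u ≤ I.r b := by
  simp only [closedNbhd, Finset.mem_filter, Finset.mem_univ, true_and]
  have hu := I.lt u
  constructor
  · rintro (h | ⟨t, ht, h⟩)
    · exact ⟨by linarith [hla u h], by linarith [hrb u h]⟩
    · rw [I.adj_iff' h.ne] at h
      exact ⟨by linarith [hla t ht], by linarith [hrb t ht]⟩
  · rintro ⟨h1, h2⟩
    by_contra! h
    obtain ⟨h0, h⟩ := h
    have h3 : ∀ t ∈ S, I.r t < I.l u ∨ I.r u < I.l t := by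
      intro t ht
      have := h t ht
      rw [I.adj_iff' (by rintro rfl; exact h0 ht), not_and_or, not_le, not_le] at this
      exact this.symm
    have ha3 := (h3 a ha).resolve_right (not_lt.2 h1)
    obtain ⟨t, ht, h4, h5⟩ := I.exists_cover .left hS (p := - I.l u)
      ⟨a, ha, by simp only [reach]; linarith [I.lt a]⟩
      ⟨b, hb, by simpa only [Side.opp, reach, neg_neg] using h2⟩
    simp only [Side.opp, reach, neg_neg] at h4 h5
    rcases h3 t ht with h6 | h6 <;> linarith

/-! ### Greedy chains -/

section Chain

variable [Fintype V]

theorem reach_le_of_next {D : Side} {v v' x : V} (h : I.next D v = some v')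
    (hx : I.Meets D x v) : I.reach D x ≤ I.reach D v' := by
  unfold next at h
  split_ifs at h with hne
  have hs := Classical.choose_spec ((I.candidates D v).exists_max_image (I.reach D) hne)
  rw [Option.some.inj h] at hs
  exact hs.2 x (by simpa [candidates] using hx)

theorem next_eq_none {D : Side} {v : V} : I.next D v = none ↔ ∀ x, ¬ I.Meets D x v := by
  unfold next
  split_ifs with h
  · simp only [false_iff, not_forall, not_not]
    obtain ⟨x, hx⟩ := h
    exact ⟨x, by simpa [candidates] using hx⟩
  · simp only [true_iff]
    intro x hx
    exact h ⟨x, by simpa [candidates] using hx⟩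

theorem next_eq_some (hI : I.DistinctEnds) {D : Side} {v v' : V} (h : I.Meets D v' v)
    (hmax : ∀ x, I.Meets D x v → I.reach D x ≤ I.reach D v') : I.next D v = some v' := by
  rcases hn : I.next D v with _ | z
  · exact absurd h (I.next_eq_none.1 hn v')
  · congr 1
    by_contra hz
    exact hI.reach_ne D hz (le_antisymm (hmax z (I.meets_of_next hn)) (I.reach_le_of_next hn h))

theorem expandFrom_none {D : Side} {v : V} {S : Finset V} (h : I.next D v = none) :
    I.expandFrom D v S = [S] := by
  rw [expandFrom]
  split
  · rfl
  · rename_i h'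
    rw [h] at h'
    cases h'

open Classical in
theorem expandFrom_some {D : Side} {v v' : V} {S : Finset V} (h : I.next D v = some v') :
    I.expandFrom D v S = S :: I.expandFrom D v' (insert v' S) := by
  rw [expandFrom]
  split
  · rename_i h'
    rw [h] at h'
    cases h'
  · rename_i h'
    rw [h] at h'
    cases h'
    rfl

open Classical in
/-- `I.Chain D c a Q`: the greedy expansion of `c` to the side `D` passes through `Q`, and `a` is
the node that was added last. -/
inductive Chain (D : Side) (c : V) : V → Finset V → Prop
  | base : Chain D c c {c}
  | step {a a' : V} {Q : Finset V} : Chain D c a Q → I.next D a = some a' →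
      Chain D c a' (insert a' Q)

theorem mem_expandFrom_of_chain {D : Side} {c a : V} {Q : Finset V} (h : I.Chain D c a Q) :
    ∀ Q' ∈ I.expandFrom D a Q, Q' ∈ I.expand D c := by
  induction h with
  | base => exact fun Q' h => h
  | step _ h ih =>
    intro Q' hQ'
    refine ih Q' ?_
    rw [I.expandFrom_some h]
    exact List.mem_cons_of_mem _ hQ'

theorem mem_expandFrom_self {D : Side} {a : V} {Q : Finset V} : Q ∈ I.expandFrom D a Q := by
  rcases h : I.next D a with _ | a'
  · simp [I.expandFrom_none h]
  · simp [I.expandFrom_some h]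

theorem exists_chain_of_mem_expandFrom {D : Side} {c : V} (k : ℕ) : ∀ {a : V} {Q Q' : Finset V},
    I.ahead D a ≤ k → I.Chain D c a Q → Q' ∈ I.expandFrom D a Q → ∃ b, I.Chain D c b Q' := by
  induction k with
  | zero =>
    intro a Q Q' hk h hQ'
    rcases hn : I.next D a with _ | a'
    · rw [I.expandFrom_none hn, List.mem_singleton] at hQ'
      exact ⟨a, hQ' ▸ h⟩
    · have := I.ahead_lt hn
      omega
  | succ k ih =>
    intro a Q Q' hk h hQ'
    rcases hn : I.next D a with _ | a'
    · rw [I.expandFrom_none hn, List.mem_singleton] at hQ'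
      exact ⟨a, hQ' ▸ h⟩
    · rw [I.expandFrom_some hn, List.mem_cons] at hQ'
      rcases hQ' with rfl | hQ'
      · exact ⟨a, h⟩
      · exact ih (by have := I.ahead_lt hn; omega) (h.step hn) hQ'

theorem mem_expand_iff {D : Side} {c : V} {Q : Finset V} :
    Q ∈ I.expand D c ↔ ∃ a, I.Chain D c a Q :=
  ⟨I.exists_chain_of_mem_expandFrom _ le_rfl .base,
    fun ⟨_, h⟩ => I.mem_expandFrom_of_chain h _ I.mem_expandFrom_self⟩

namespace Chain

variable {I} {D : Side} {c a : V} {Q : Finset V}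

theorem mem_last (h : I.Chain D c a Q) : a ∈ Q := by
  cases h <;> simp

theorem mem_first (h : I.Chain D c a Q) : c ∈ Q := by
  classical
  induction h with
  | base => simp
  | step _ _ ih => exact Finset.mem_insert_of_mem ih

theorem reach_le (h : I.Chain D c a Q) : ∀ q ∈ Q, I.reach D q ≤ I.reach D a := by
  classical
  induction h with
  | base => simp
  | step _ h1 ih =>
    intro q hq
    rcases Finset.mem_insert.1 hq with rfl | hq
    · exact le_rfl
    · exact (ih q hq).trans (I.reach_lt (I.meets_of_next h1)).le

theorem eq_or_lt (h : I.Chain D c a Q) : ∀ q ∈ Q, q = c ∨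
    (I.reach D c < I.reach D q ∧ I.reach D.opp q < I.reach D.opp c) := by
  classical
  induction h with
  | base => simp
  | step h0 h1 ih =>
    intro q hq
    rcases Finset.mem_insert.1 hq with rfl | hq
    · right
      have h2 := I.meets_iff.1 (I.meets_of_next h1)
      rcases ih _ h0.mem_last with rfl | h3
      · exact ⟨h2.1, h2.2.1⟩
      · exact ⟨h3.1.trans h2.1, h2.2.1.trans h3.2⟩
    · exact ih q hq

theorem first_reach_le (h : I.Chain D c a Q) : I.reach D c ≤ I.reach D a :=
  h.reach_le c h.mem_first

theorem next_notMem (h : I.Chain D c a Q) {a' : V} (h' : I.next D a = some a') : a' ∉ Q :=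
  fun hq => (h.reach_le a' hq).not_gt (I.reach_lt (I.meets_of_next h'))

theorem connected (h : I.Chain D c a Q) : (G.induce (Q : Set V)).Connected := by
  classical
  induction h with
  | base =>
    have : Subsingleton (({c} : Finset V) : Set V) := by
      rw [Finset.coe_singleton]
      infer_instance
    have hne : Nonempty (({c} : Finset V) : Set V) := ⟨⟨c, by simp⟩⟩
    exact ⟨fun x y => by rw [Subsingleton.elim x y]⟩
  | @step a a' Q h0 h1 ih =>
    have h2 : G.Adj a' a := I.adj_of_meets (I.meets_of_next h1)
    have h3 := SimpleGraph.induce_union_connected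
      (SimpleGraph.induce_pair_connected_of_adj h2).preconnected ih.preconnected
      ⟨a, by simp, h0.mem_last⟩
    have he : ((insert a' Q : Finset V) : Set V) = ({a', a} : Set V) ∪ (Q : Set V) := by
      ext z
      simp only [Finset.coe_insert, Set.mem_insert_iff, Finset.mem_coe, Set.mem_union,
        Set.mem_singleton_iff]
      have := h0.mem_last
      constructor
      · tauto
      · rintro ((h | rfl) | h) <;> tauto
    rw [he]
    exact h3

end Chain

/-- The greedy expansion is optimal: if no interval of the connected set `S` contains that of `a`,
the expansion from `a` reaches as far as `S` with at most as many further nodes as `S` has nodes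
that reach farther than `a`. -/
theorem exists_chain_of_connected (hI : I.DistinctEnds) {D : Side} {S : Finset V}
    (hS : (G.induce (S : Set V)).Connected) {v₀ c : V} (hv₀ : v₀ ∈ S) (k : ℕ) :
    ∀ {a : V} {Q : Finset V}, I.Chain D c a Q → I.reach D v₀ ≤ I.reach D a →
      (∀ t ∈ S, I.reach D a < I.reach D t → I.reach D.opp t ≤ I.reach D.opp a) →
      (S.filter fun t => I.reach D a < I.reach D t).card ≤ k →
      ∃ b Q', I.Chain D c b Q' ∧ Q'.card ≤ Q.card + k ∧ ∀ t ∈ S, I.reach D t ≤ I.reach D b := by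
  classical
  induction k with
  | zero =>
    intro a Q h _ _ hk
    refine ⟨a, Q, h, le_rfl, fun t ht => ?_⟩
    by_contra! hlt
    rw [Nat.le_zero, Finset.card_eq_zero] at hk
    exact Finset.notMem_empty t (hk ▸ Finset.mem_filter.2 ⟨ht, hlt⟩)
  | succ k ih =>
    intro a Q h h0 hmax hk
    by_cases hfar : ∃ t ∈ S, I.reach D a < I.reach D t
    swap
    · exact ⟨a, Q, h, by omega, fun t ht => not_lt.1 fun h' => hfar ⟨t, ht, h'⟩⟩
    obtain ⟨t, ht, ht1, ht2⟩ := I.exists_cover D hS hfar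
      ⟨v₀, hv₀, by linarith [I.neg_reach_lt D v₀]⟩
    have hmeet : ∀ s ∈ S, I.reach D a < I.reach D s → - I.reach D a ≤ I.reach D.opp s →
        I.Meets D s a := by
      intro s hs hs1 hs2
      refine I.meets_iff.2 ⟨hs1, lt_of_le_of_ne (hmax s hs hs1) ?_,
        lt_of_le_of_ne hs2 (hI.neg_reach_ne D a s)⟩
      refine hI.reach_ne _ ?_
      rintro rfl
      exact hs1.false
    have hm := hmeet t ht ht1 ht2
    rcases hn : I.next D a with _ | a'
    · exact absurd hm (I.next_eq_none.1 hn t)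
    have hn' := I.meets_iff.1 (I.meets_of_next hn)
    obtain ⟨b, Q', h1, h2, h3⟩ := ih (h.step hn) (h0.trans hn'.1.le) (by
      intro s hs hs1
      by_contra! hs2
      exact hs1.not_ge (I.reach_le_of_next hn
        (hmeet s hs (hn'.1.trans hs1) (hn'.2.2.trans hs2).le))) (by
      have : (S.filter fun t => I.reach D a' < I.reach D t) ⊂
          S.filter fun t => I.reach D a < I.reach D t := by
        rw [Finset.ssubset_iff_of_subset]
        · refine ⟨t, Finset.mem_filter.2 ⟨ht, ht1⟩, fun h' => ?_⟩
          exact (Finset.mem_filter.1 h').2.not_ge (I.reach_le_of_next hn hm)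
        · intro s hs
          rw [Finset.mem_filter] at hs ⊢
          exact ⟨hs.1, hn'.1.trans hs.2⟩
      have := Finset.card_lt_card this
      omega)
    refine ⟨b, Q', h1, ?_, h3⟩
    rw [Finset.card_insert_of_notMem (h.next_notMem hn)] at h2
    omega

end Chain

/-! ### The candidates -/

section Candidates

variable [Fintype V]

open Classical in
/-- The nodes from which the algorithm starts its expansions: `v₀` and the nodes of the core. -/
def bases (v₀ : V) : Finset V := insert v₀ (I.core v₀)

theorem mem_bases {v₀ c : V} : c ∈ I.bases v₀ ↔ c = v₀ ∨ c ∈ I.core v₀ := by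
  simp [bases]

theorem mem_containing {v₀ v : V} : v ∈ I.containing v₀ ↔ I.Inside v₀ v := by
  simp [containing]

theorem mem_core {v₀ c : V} : c ∈ I.core v₀ ↔
    I.Inside v₀ c ∧ ∀ v, I.Inside v₀ v → ¬ I.Inside c v := by
  simp only [core, Finset.mem_filter, mem_containing, not_exists, not_and]
  refine and_congr_right fun h => forall_congr' fun v => forall_congr' fun hv => ?_
  constructor
  · intro h1 h2
    refine h1 ?_ h2
    rintro rfl
    exact h2.1.false
  · exact fun h1 _ => h1

theorem eq_or_inside_of_mem_bases {v₀ c : V} (h : c ∈ I.bases v₀) : c = v₀ ∨ I.Inside v₀ c := by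
  classical
  rcases Finset.mem_insert.1 h with h | h
  · exact .inl h
  · exact .inr (I.mem_core.1 h).1

open Classical in
theorem mem_sols {v₀ : V} {p : Finset V × ℚ} : p ∈ sols I v₀ ↔
    ∃ c ∈ I.bases v₀, p = combine G {v₀, c} (I.expand .left c) (I.expand .right c) := by
  simp only [sols, bases, Finset.mem_union, Finset.mem_singleton, Finset.mem_image,
    Finset.mem_insert, exists_eq_or_imp, Finset.pair_eq_singleton, eq_comm (b := p)]

variable {I}

/-- The sets that occur in the call of `Combine` for the base `c`, with the nodes `a`, `b` that
reach farthest to the left and to the right. -/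
structure Candidate (I : Realization G) (v₀ c a b : V) (A B : Finset V) : Prop where
  base : c ∈ I.bases v₀
  left : I.Chain .left c a A
  right : I.Chain .right c b B

namespace Candidate

variable {v₀ c a b : V} {A B : Finset V}

open Classical in
theorem mem_iff (h : Candidate I v₀ c a b A B) {t : V} :
    t ∈ {v₀, c} ∪ A ∪ B ↔ t = v₀ ∨ t ∈ A ∨ t ∈ B := by
  have := h.left.mem_first
  simp only [Finset.mem_union, Finset.mem_insert, Finset.mem_singleton]
  constructor
  · rintro (((h | rfl) | h) | h) <;> tauto
  · tauto

open Classical in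
theorem connected (h : Candidate I v₀ c a b A B) :
    (G.induce (({v₀, c} ∪ A ∪ B : Finset V) : Set V)).Connected := by
  have h1 := SimpleGraph.induce_union_connected h.left.connected.preconnected
    h.right.connected.preconnected
    ⟨c, h.left.mem_first, h.right.mem_first⟩
  rcases I.eq_or_inside_of_mem_bases h.base with hc | hc
  · have he : (({v₀, c} ∪ A ∪ B : Finset V) : Set V) = (A : Set V) ∪ (B : Set V) := by
      ext t
      have := h.left.mem_first
      simp only [Finset.mem_coe, h.mem_iff, Set.mem_union]
      constructor
      · rintro (rfl | h) <;> [exact .inl (hc ▸ this); exact h]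
      · exact .inr
    rw [he]
    exact h1
  · have h2 := SimpleGraph.induce_union_connected
      (SimpleGraph.induce_pair_connected_of_adj (I.adj_of_inside hc)).preconnected h1.preconnected
      ⟨c, by simp, .inl h.left.mem_first⟩
    have he : (({v₀, c} ∪ A ∪ B : Finset V) : Set V) =
        ({v₀, c} : Set V) ∪ ((A : Set V) ∪ (B : Set V)) := by
      push_cast
      rw [Set.union_assoc]
    rw [he]
    exact h2

theorem left_le (h : Candidate I v₀ c a b A B) : I.l a ≤ I.l c :=
  neg_le_neg_iff.1 h.left.first_reach_le

theorem right_le (h : Candidate I v₀ c a b A B) : I.r c ≤ I.r b := h.right.first_reach_le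

open Classical in
theorem left_last (h : Candidate I v₀ c a b A B) :
    ∀ t ∈ {v₀, c} ∪ A ∪ B, I.l a ≤ I.l t := by
  intro t ht
  have hc : I.l c ≤ I.l v₀ := by
    rcases I.eq_or_inside_of_mem_bases h.base with rfl | hc
    · exact le_rfl
    · exact hc.1.le
  rcases h.mem_iff.1 ht with rfl | ht | ht
  · exact h.left_le.trans hc
  · exact neg_le_neg_iff.1 (h.left.reach_le t ht)
  · rcases h.right.eq_or_lt t ht with rfl | h1
    · exact h.left_le
    · exact h.left_le.trans (neg_lt_neg_iff.1 h1.2).le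

open Classical in
theorem right_last (h : Candidate I v₀ c a b A B) :
    ∀ t ∈ {v₀, c} ∪ A ∪ B, I.r t ≤ I.r b := by
  intro t ht
  have hc : I.r v₀ ≤ I.r c := by
    rcases I.eq_or_inside_of_mem_bases h.base with rfl | hc
    · exact le_rfl
    · exact hc.2.le
  rcases h.mem_iff.1 ht with rfl | ht | ht
  · exact hc.trans h.right_le
  · rcases h.left.eq_or_lt t ht with rfl | h1
    · exact h.right_le
    · exact (show I.r t ≤ I.r c from h1.2.le).trans h.right_le
  · exact h.right.reach_le t ht

open Classical in
theorem mem_closedNbhd_iff (h : Candidate I v₀ c a b A B) (u : V) :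
    u ∈ closedNbhd G ({v₀, c} ∪ A ∪ B) ↔ I.l a ≤ I.r u ∧ I.l u ≤ I.r b :=
  I.mem_closedNbhd_iff h.connected (h.mem_iff.2 (.inr (.inl h.left.mem_last)))
    (h.mem_iff.2 (.inr (.inr h.right.mem_last))) h.left_last h.right_last u

open Classical in
theorem card_closedNbhd (h : Candidate I v₀ c a b A B) :
    (closedNbhd G ({v₀, c} ∪ A ∪ B)).card = Fintype.card V -
      (Finset.univ.filter fun u => I.r u < I.l a).card -
      (Finset.univ.filter fun u => I.r b < I.l u).card := by
  have hd : Disjoint (Finset.univ.filter fun u => I.r u < I.l a)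
      (Finset.univ.filter fun u => I.r b < I.l u) := by
    rw [Finset.disjoint_filter]
    intro u _ h1 h2
    linarith [I.lt u, I.lt c, h.left_le, h.right_le]
  have hc : (closedNbhd G ({v₀, c} ∪ A ∪ B))ᶜ = (Finset.univ.filter fun u => I.r u < I.l a) ∪
      (Finset.univ.filter fun u => I.r b < I.l u) := by
    ext u
    simp only [Finset.mem_compl, h.mem_closedNbhd_iff, Finset.mem_union, Finset.mem_filter,
      Finset.mem_univ, true_and, not_and_or, not_le]
  rw [Nat.sub_sub, ← Finset.card_union_of_disjoint hd, ← hc, Finset.card_compl]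
  have := Finset.card_le_univ (closedNbhd G ({v₀, c} ∪ A ∪ B))
  omega

open Classical in
theorem card_eq (h : Candidate I v₀ c a b A B) :
    ({v₀, c} ∪ A ∪ B).card = A.card + B.card - if c = v₀ then 1 else 0 := by
  have hAB : A ∩ B = {c} := by
    ext t
    rw [Finset.mem_inter, Finset.mem_singleton]
    constructor
    · rintro ⟨h1, h2⟩
      by_contra hne
      have h3 := (h.left.eq_or_lt t h1).resolve_left hne
      have h4 := (h.right.eq_or_lt t h2).resolve_left hne
      exact h3.2.not_gt h4.1
    · rintro rfl
      exact ⟨h.left.mem_first, h.right.mem_first⟩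
  have hcard := Finset.card_union_add_card_inter A B
  rw [hAB, Finset.card_singleton] at hcard
  have hA : 0 < A.card := Finset.card_pos.2 ⟨c, h.left.mem_first⟩
  have hT : ({v₀, c} ∪ A ∪ B : Finset V) = insert v₀ (A ∪ B) := by
    ext t
    rw [h.mem_iff, Finset.mem_insert, Finset.mem_union]
  rw [hT]
  split_ifs with hc
  · rw [Finset.insert_eq_of_mem (Finset.mem_union_left _ (hc ▸ h.left.mem_first))]
    omega
  · have hin := (I.eq_or_inside_of_mem_bases h.base).resolve_left hc
    rw [Finset.card_insert_of_notMem]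
    · omega
    · rw [Finset.mem_union]
      rintro (h1 | h1)
      · rcases h.left.eq_or_lt _ h1 with h2 | h2
        · exact hc h2.symm
        · exact (neg_lt_neg_iff.1 h2.1).not_gt hin.1
      · rcases h.right.eq_or_lt _ h1 with h2 | h2
        · exact hc h2.symm
        · exact (show I.r c < I.r v₀ from h2.1).not_gt hin.2

end Candidate

open Classical in
/-- Every solution is dominated by a candidate: for a connected set `S ∋ v₀` there is a candidate
with at most as many nodes whose hull covers that of `S`. The base is a maximal interval of `C`
above one in `S`, if `S` meets `C`, and `v₀` otherwise. -/
theorem exists_candidate (hI : I.DistinctEnds) {v₀ : V} {S : Finset V} (hS : S ∈ Con G v₀) :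
    ∃ c a b A B, Candidate I v₀ c a b A B ∧ ({v₀, c} ∪ A ∪ B).card ≤ S.card ∧
      closedNbhd G S ⊆ closedNbhd G ({v₀, c} ∪ A ∪ B) := by
  obtain ⟨hv₀, hconn⟩ := hS
  obtain ⟨c, hc, hmax, hcard⟩ : ∃ c ∈ I.bases v₀, (∀ t ∈ S, ¬ I.Inside c t) ∧
      (S.filter fun t => I.reach .left c < I.reach .left t).card +
      (S.filter fun t => I.reach .right c < I.reach .right t).card +
      2 ≤ S.card + if c = v₀ then 1 else 0 := by
    have disj : ∀ c, (∀ t ∈ S, ¬ I.Inside c t) →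
        Disjoint (S.filter fun t => I.reach .left c < I.reach .left t)
          (S.filter fun t => I.reach .right c < I.reach .right t) := by
      intro c hc
      rw [Finset.disjoint_filter]
      exact fun t ht h1 h2 => hc t ht ⟨neg_lt_neg_iff.1 h1, h2⟩
    by_cases hex : ∃ s ∈ S, I.Inside v₀ s
    · obtain ⟨s, hs, hs1⟩ := hex
      -- Among `s` and the intervals that contain `I(s)`, the one with the greatest right end is
      -- maximal for inclusion.
      obtain ⟨c, hc, hcmax⟩ := (Finset.univ.filter fun x => x = s ∨ I.Inside s x).exists_max_image
        I.r ⟨s, by simp⟩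
      simp only [Finset.mem_filter, Finset.mem_univ, true_and] at hc hcmax
      have hvc : I.Inside v₀ c := by
        rcases hc with rfl | hc
        · exact hs1
        · exact hs1.trans hc
      have hsup : ∀ t, ¬ I.Inside c t := by
        intro t ht
        refine (hcmax t (.inr ?_)).not_gt ht.2
        rcases hc with rfl | hc
        · exact ht
        · exact hc.trans ht
      have hcne : c ≠ v₀ := by
        rintro rfl
        exact hvc.1.false
      refine ⟨c, Finset.mem_insert_of_mem (I.mem_core.2 ⟨hvc, fun v _ => hsup v⟩),
        fun t _ => hsup t, ?_⟩
      rw [if_neg hcne, ← Finset.card_union_of_disjoint (disj c fun t _ => hsup t)]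
      have hne : v₀ ≠ s := by
        rintro rfl
        exact hs1.1.false
      have hsc : I.l c ≤ I.l s ∧ I.r s ≤ I.r c := by
        rcases hc with rfl | hc
        · exact ⟨le_rfl, le_rfl⟩
        · exact ⟨hc.1.le, hc.2.le⟩
      rw [← Finset.card_pair hne, ← Finset.card_union_of_disjoint]
      · refine Finset.card_le_card ?_
        intro t
        simp only [Finset.mem_union, Finset.mem_filter, Finset.mem_insert, Finset.mem_singleton]
        rintro ((h | h) | (rfl | rfl))
        exacts [h.1, h.1, hv₀, hs]
      · rw [Finset.disjoint_left]
        intro t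
        simp only [Finset.mem_union, Finset.mem_filter, Finset.mem_insert, Finset.mem_singleton]
        rintro (h | h) (rfl | rfl)
        · exact hvc.1.not_gt (neg_lt_neg_iff.1 h.2)
        · exact hsc.1.not_gt (neg_lt_neg_iff.1 h.2)
        · exact hvc.2.not_gt h.2
        · exact hsc.2.not_gt h.2
    · push Not at hex
      refine ⟨v₀, Finset.mem_insert_self _ _, hex, ?_⟩
      rw [if_pos rfl, ← Finset.card_union_of_disjoint (disj v₀ hex)]
      have : (S.filter fun t => I.reach .left v₀ < I.reach .left t) ∪
          (S.filter fun t => I.reach .right v₀ < I.reach .right t) ⊆ S.erase v₀ := by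
        intro t
        simp only [Finset.mem_union, Finset.mem_filter, Finset.mem_erase]
        rintro (h | h) <;> refine ⟨?_, h.1⟩ <;> rintro rfl <;> exact h.2.false
      have := Finset.card_le_card this
      rw [Finset.card_erase_of_mem hv₀] at this
      have := Finset.card_pos.2 ⟨v₀, hv₀⟩
      omega
  have hle : ∀ D, I.reach D v₀ ≤ I.reach D c := by
    intro D
    rcases I.eq_or_inside_of_mem_bases hc with rfl | h
    · exact le_rfl
    · cases D
      · exact (neg_lt_neg h.1).le
      · exact h.2.le
  obtain ⟨a, A, hA, hA1, hA2⟩ := I.exists_chain_of_connected hI hconn hv₀ _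
    (Chain.base (I := I) (D := .left) (c := c)) (hle _)
    (fun t ht h => not_lt.1 fun h' => hmax t ht ⟨neg_lt_neg_iff.1 h, h'⟩) le_rfl
  obtain ⟨b, B, hB, hB1, hB2⟩ := I.exists_chain_of_connected hI hconn hv₀ _
    (Chain.base (I := I) (D := .right) (c := c)) (hle _)
    (fun t ht h => not_lt.1 fun h' => hmax t ht ⟨neg_lt_neg_iff.1 h', h⟩) le_rfl
  have hcand : Candidate I v₀ c a b A B := ⟨hc, hA, hB⟩
  refine ⟨c, a, b, A, B, hcand, ?_, ?_⟩
  · rw [hcand.card_eq]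
    rw [Finset.card_singleton] at hA1 hB1
    omega
  · intro u hu
    rw [hcand.mem_closedNbhd_iff]
    have hA3 : ∀ t ∈ S, I.l a ≤ I.l t := fun t ht => neg_le_neg_iff.1 (hA2 t ht)
    have hB3 : ∀ t ∈ S, I.r t ≤ I.r b := hB2
    have := I.lt u
    simp only [closedNbhd, Finset.mem_filter, Finset.mem_univ, true_and] at hu
    rcases hu with h | ⟨t, ht, h⟩
    · exact ⟨by linarith [hA3 u h], by linarith [hB3 u h]⟩
    · rw [I.adj_iff' h.ne] at h
      exact ⟨by linarith [hA3 t ht], by linarith [hB3 t ht]⟩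

end Candidates

end Realization

/-! ### The value of `Combine` -/

section Combine

variable {V : Type*} [Fintype V] {G : SimpleGraph V}

open Classical in
/-- One step of `Combine`: `T` replaces the current pair if its ratio is greater. -/
def improve (G : SimpleGraph V) (acc : Finset V × ℚ) (T : Finset V) : Finset V × ℚ :=
  if acc.2 < ratio G T then (T, ratio G T) else acc

/-- A loop of improvements preserves a property `P` of the set and the agreement of the set with its
ratio, and its result is at least as good as the start and as everything that was tried. -/
theorem foldl_improve {P : Finset V → Prop} (f : Finset V → Finset V) : ∀ (L : List (Finset V))
    (acc : Finset V × ℚ), P acc.1 → acc.2 = ratio G acc.1 → (∀ r ∈ L, P (f r)) →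
      P (L.foldl (fun acc r => improve G acc (f r)) acc).1 ∧
      (L.foldl (fun acc r => improve G acc (f r)) acc).2 =
        ratio G (L.foldl (fun acc r => improve G acc (f r)) acc).1 ∧
      acc.2 ≤ (L.foldl (fun acc r => improve G acc (f r)) acc).2 ∧
      ∀ r ∈ L, ratio G (f r) ≤ (L.foldl (fun acc r => improve G acc (f r)) acc).2 := by
  intro L
  induction L with
  | nil => simp
  | cons r L ih =>
    intro acc h1 h2 h3
    have hstep : P (improve G acc (f r)).1 ∧
        (improve G acc (f r)).2 = ratio G (improve G acc (f r)).1 ∧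
        acc.2 ≤ (improve G acc (f r)).2 ∧ ratio G (f r) ≤ (improve G acc (f r)).2 := by
      unfold improve
      split_ifs with h
      · exact ⟨h3 r (by simp), rfl, h.le, le_rfl⟩
      · exact ⟨h1, h2, le_rfl, not_lt.1 h⟩
    obtain ⟨i1, i2, i3, i4⟩ := ih (improve G acc (f r)) hstep.1 hstep.2.1
      fun r' hr' => h3 r' (by simp [hr'])
    rw [List.foldl_cons]
    refine ⟨i1, i2, hstep.2.2.1.trans i3, fun r' hr' => ?_⟩
    rcases List.mem_cons.1 hr' with rfl | hr'
    · exact hstep.2.2.2.trans i3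
    · exact i4 r' hr'

open Classical in
/-- The inner loop of `Combine`. -/
def combineRight (G : SimpleGraph V) (S : Finset V) (Right : List (Finset V)) (l : Finset V)
    (acc : Finset V × ℚ) : Finset V × ℚ :=
  Right.foldl (fun acc r => improve G acc (S ∪ l ∪ r)) acc

theorem combine_eq (S : Finset V) (Left Right : List (Finset V)) : combine G S Left Right =
    Left.foldl (fun acc l => combineRight G S Right l acc) (S, ratio G S) := rfl

open Classical in
/-- `Combine` returns a set with its ratio, and no candidate has a greater one. -/
theorem combine_spec {P : Finset V → Prop} (S : Finset V) (Left Right : List (Finset V))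
    (hS : P S) (hP : ∀ l ∈ Left, ∀ r ∈ Right, P (S ∪ l ∪ r)) :
    P (combine G S Left Right).1 ∧
      (combine G S Left Right).2 = ratio G (combine G S Left Right).1 ∧
      ∀ l ∈ Left, ∀ r ∈ Right, ratio G (S ∪ l ∪ r) ≤ (combine G S Left Right).2 := by
  rw [combine_eq]
  have key : ∀ (L : List (Finset V)) (acc : Finset V × ℚ), P acc.1 → acc.2 = ratio G acc.1 →
      (∀ l ∈ L, ∀ r ∈ Right, P (S ∪ l ∪ r)) →
      P (L.foldl (fun acc l => combineRight G S Right l acc) acc).1 ∧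
      (L.foldl (fun acc l => combineRight G S Right l acc) acc).2 =
        ratio G (L.foldl (fun acc l => combineRight G S Right l acc) acc).1 ∧
      acc.2 ≤ (L.foldl (fun acc l => combineRight G S Right l acc) acc).2 ∧
      ∀ l ∈ L, ∀ r ∈ Right,
        ratio G (S ∪ l ∪ r) ≤ (L.foldl (fun acc l => combineRight G S Right l acc) acc).2 := by
    intro L
    induction L with
    | nil => simp
    | cons l L ih =>
      intro acc h1 h2 h3
      obtain ⟨j1, j2, j3, j4⟩ := foldl_improve (G := G) (P := P) (fun r => S ∪ l ∪ r) Right acc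
        h1 h2 (h3 l (by simp))
      obtain ⟨i1, i2, i3, i4⟩ := ih (combineRight G S Right l acc) j1 j2
        fun l' hl' => h3 l' (by simp [hl'])
      rw [List.foldl_cons]
      refine ⟨i1, i2, j3.trans i3, fun l' hl' r hr => ?_⟩
      rcases List.mem_cons.1 hl' with rfl | hl'
      · exact (j4 r hr).trans i3
      · exact i4 l' hl' r hr
  obtain ⟨h1, h2, -, h4⟩ := key Left (S, ratio G S) hS rfl hP
  exact ⟨h1, h2, h4⟩

theorem exists_isIntervalOutput (I : Realization G) (v₀ : V) : ∃ p, IsIntervalOutput I v₀ p := by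
  classical
  obtain ⟨p, hp, hmax⟩ := (sols I v₀).exists_max_image Prod.snd
    ⟨_, I.mem_sols.2 ⟨v₀, Finset.mem_insert_self _ _, rfl⟩⟩
  exact ⟨p, hp, hmax⟩

/-- Every output of the algorithm is an optimal solution. -/
theorem IsIntervalOutput.isOptimal {I : Realization G} (hI : I.DistinctEnds) {v₀ : V}
    {p : Finset V × ℚ} (hp : IsIntervalOutput I v₀ p) : IsOptimal G v₀ p := by
  classical
  have hcomb : ∀ c ∈ I.bases v₀,
      let q := combine G {v₀, c} (I.expand .left c) (I.expand .right c)
      q.1 ∈ Con G v₀ ∧ q.2 = ratio G q.1 ∧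
        ∀ l ∈ I.expand .left c, ∀ r ∈ I.expand .right c, ratio G ({v₀, c} ∪ l ∪ r) ≤ q.2 := by
    intro c hc
    have h1 : ∀ l ∈ I.expand .left c, ∀ r ∈ I.expand .right c,
        {v₀, c} ∪ l ∪ r ∈ Con G v₀ := by
      intro l hl r hr
      obtain ⟨a, ha⟩ := I.mem_expand_iff.1 hl
      obtain ⟨b, hb⟩ := I.mem_expand_iff.1 hr
      have hcand : Realization.Candidate I v₀ c a b l r := ⟨hc, ha, hb⟩
      exact ⟨hcand.mem_iff.2 (.inl rfl), hcand.connected⟩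
    refine combine_spec (P := fun S => S ∈ Con G v₀) _ _ _ ?_ h1
    have := h1 {c} (I.mem_expand_iff.2 ⟨c, .base⟩) {c} (I.mem_expand_iff.2 ⟨c, .base⟩)
    convert this using 1
    ext t
    simp
  obtain ⟨c, hc, hpc⟩ := I.mem_sols.1 hp.1
  obtain ⟨h1, h2, -⟩ := hcomb c hc
  rw [← hpc] at h1 h2
  refine ⟨h1, h2, ⟨p.1, h1, h2.symm⟩, ?_⟩
  rintro _ ⟨S, hS, rfl⟩
  obtain ⟨c', a, b, A, B, hcand, hcard, hsub⟩ := Realization.exists_candidate hI hS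
  obtain ⟨-, -, h3⟩ := hcomb c' hcand.base
  refine le_trans ?_ ((h3 A (I.mem_expand_iff.2 ⟨a, hcand.left⟩) B
    (I.mem_expand_iff.2 ⟨b, hcand.right⟩)).trans
    (hp.2 _ (I.mem_sols.2 ⟨c', hcand.base, rfl⟩)))
  have hpos : 0 < ({v₀, c'} ∪ A ∪ B).card := Finset.card_pos.2 ⟨v₀, hcand.mem_iff.2 (.inl rfl)⟩
  unfold ratio
  exact div_le_div₀ (by positivity) (by exact_mod_cast Finset.card_le_card hsub)
    (by exact_mod_cast hpos) (by exact_mod_cast hcard)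

end Combine

/-! ### The position relative to the root -/

section Position

variable {V : Type*} [Fintype V] {G : SimpleGraph V} (I : Realization G)

open Classical in
/-- The index of the set of the partition to which `v` belongs, found by comparing ends. -/
def Realization.regionIndex (v₀ v : V) : Fin 7 :=
  if v = v₀ then 4 else if I.r v < I.l v₀ then 0 else if I.r v₀ < I.l v then 6 else
  if I.l v < I.l v₀ then (if I.r v < I.r v₀ then 1 else 3) else
  if I.r v < I.r v₀ then 2 else 5

theorem Realization.mem_region_iff (hI : I.DistinctEnds) {v₀ v : V} {k : Fin 7} :
    v ∈ I.region v₀ k ↔ I.regionIndex v₀ v = k := by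
  classical
  have h1 := I.lt v
  have h2 := I.lt v₀
  have hk : v ∈ I.region v₀ k ↔ (![I.r v < I.l v₀,
      I.l v < I.l v₀ ∧ I.l v₀ < I.r v ∧ I.r v < I.r v₀,
      I.l v₀ < I.l v ∧ I.r v < I.r v₀, I.l v < I.l v₀ ∧ I.r v₀ < I.r v, v = v₀,
      I.r v₀ < I.r v ∧ I.l v₀ < I.l v ∧ I.l v < I.r v₀, I.r v₀ < I.l v] : Fin 7 → Prop) k := by
    fin_cases k
    · exact Finset.mem_filter_univ _
    · exact Finset.mem_filter_univ _
    · exact Finset.mem_filter_univ _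
    · exact Finset.mem_filter_univ _
    · exact Finset.mem_singleton
    · exact Finset.mem_filter_univ _
    · exact Finset.mem_filter_univ _
  rw [hk]
  unfold regionIndex
  by_cases hv : v = v₀
  · subst hv
    fin_cases k <;> simp [h1.not_gt]
  · have e1 := hI.left_ne hv
    have e2 := hI.right_ne hv
    have e3 := hI.left_ne_right v₀ v
    have e4 := hI.left_ne_right v v₀
    rw [if_neg hv]
    rcases e1.lt_or_gt with e1 | e1 <;> rcases e2.lt_or_gt with e2 | e2 <;>
      rcases e3.lt_or_gt with e3 | e3 <;> rcases e4.lt_or_gt with e4 | e4 <;>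
      first
      | (exfalso; linarith)
      | (fin_cases k <;> simp [hv, e1, e2, e3, e4, e1.not_gt, e2.not_gt, e3.not_gt, e4.not_gt])

theorem Realization.existsUnique_region (hI : I.DistinctEnds) (v₀ v : V) :
    ∃! k, v ∈ I.region v₀ k :=
  ⟨_, (I.mem_region_iff hI).2 rfl, fun _ h => ((I.mem_region_iff hI).1 h).symm⟩

end Position

/-! ### Reasoning about programs -/

namespace Store

@[simp] theorem setVar_arr (σ : Store) (x k : ℕ) : (σ.setVar x k).arr = σ.arr := rfl

@[simp] theorem setVar_var (σ : Store) (x k y : ℕ) :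
    (σ.setVar x k).var y = if y = x then k else σ.var y := by
  simp [setVar, Function.update_apply]

@[simp] theorem setArr_var (σ : Store) (a i k : ℕ) : (σ.setArr a i k).var = σ.var := rfl

@[simp] theorem setArr_arr (σ : Store) (a i k b j : ℕ) :
    (σ.setArr a i k).arr b j = if b = a ∧ j = i then k else σ.arr b j := by
  by_cases hb : b = a
  · subst hb
    simp [setArr, Function.update_apply]
  · simp [setArr, hb]

end Store

/-- The variables that a program may change. -/
def Cmd.vars : Cmd → List ℕ
  | .assign x _ => [x]
  | .store _ _ _ => []
  | .seq c d => c.vars ++ d.vars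
  | .ite _ c d => c.vars ++ d.vars
  | .while _ c => c.vars

/-- The arrays that a program may change. -/
def Cmd.arrs : Cmd → List ℕ
  | .assign _ _ => []
  | .store a _ _ => [a]
  | .seq c d => c.arrs ++ d.arrs
  | .ite _ c d => c.arrs ++ d.arrs
  | .while _ c => c.arrs

/-- The stores `σ` and `σ'` differ only in what the program `c` may change. -/
structure Same (c : Cmd) (σ σ' : Store) : Prop where
  var : ∀ x, x ∉ c.vars → σ'.var x = σ.var x
  arr : ∀ a, a ∉ c.arrs → σ'.arr a = σ.arr a

theorem Same.refl (c : Cmd) (σ : Store) : Same c σ σ := ⟨fun _ _ => rfl, fun _ _ => rfl⟩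

theorem Same.trans {c : Cmd} {σ σ' σ'' : Store} (h : Same c σ σ') (h' : Same c σ' σ'') :
    Same c σ σ'' :=
  ⟨fun x hx => (h'.var x hx).trans (h.var x hx), fun a ha => (h'.arr a ha).trans (h.arr a ha)⟩

theorem Same.mono {c d : Cmd} {σ σ' : Store} (h : Same c σ σ') (hv : ∀ x ∈ c.vars, x ∈ d.vars)
    (ha : ∀ a ∈ c.arrs, a ∈ d.arrs) : Same d σ σ' :=
  ⟨fun x hx => h.var x fun h' => hx (hv x h'), fun a h1 => h.arr a fun h' => h1 (ha a h')⟩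

theorem Exec.same {w : ℕ} {c : Cmd} {σ σ' : Store} {t : ℕ} (h : Exec w c σ σ' t) :
    Same c σ σ' := by
  induction h with
  | assign x e σ =>
    refine ⟨fun y hy => ?_, fun _ _ => rfl⟩
    rw [Store.setVar_var, if_neg (by simpa [Cmd.vars] using hy)]
  | store a i e σ =>
    refine ⟨fun _ _ => rfl, fun b hb => ?_⟩
    ext j
    rw [Store.setArr_arr, if_neg]
    rintro ⟨rfl, -⟩
    simp [Cmd.arrs] at hb
  | seq _ _ ih1 ih2 =>
    exact (ih1.mono (by simp +contextual [Cmd.vars]) (by simp +contextual [Cmd.arrs])).trans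
      (ih2.mono (by simp +contextual [Cmd.vars]) (by simp +contextual [Cmd.arrs]))
  | ite_true _ _ ih =>
    exact ih.mono (by simp +contextual [Cmd.vars]) (by simp +contextual [Cmd.arrs])
  | ite_false _ _ ih =>
    exact ih.mono (by simp +contextual [Cmd.vars]) (by simp +contextual [Cmd.arrs])
  | while_true _ _ _ ih1 ih2 => exact (ih1.mono (by simp [Cmd.vars]) (by simp [Cmd.arrs])).trans ih2
  | while_false _ => exact .refl _ _

/-- Started in `σ`, the program `c` halts, and the final store and the number of steps satisfy
`Q`. -/
def Runs (w : ℕ) (c : Cmd) (σ : Store) (Q : Store → ℕ → Prop) : Prop :=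
  ∃ σ' t, Exec w c σ σ' t ∧ Q σ' t

namespace Runs

variable {w : ℕ} {c d : Cmd} {e : Expr} {σ : Store} {Q Q' : Store → ℕ → Prop}

theorem mono (h : Runs w c σ Q) (hQ : ∀ σ' t, Q σ' t → Q' σ' t) : Runs w c σ Q' := by
  obtain ⟨σ', t, h1, h2⟩ := h
  exact ⟨σ', t, h1, hQ _ _ h2⟩

/-- What the program does not write to keeps its value. -/
theorem mono_same (h : Runs w c σ Q) (hQ : ∀ σ' t, Same c σ σ' → Q σ' t → Q' σ' t) :
    Runs w c σ Q' := by
  obtain ⟨σ', t, h1, h2⟩ := h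
  exact ⟨σ', t, h1, hQ _ _ h1.same h2⟩

theorem assign {x k : ℕ} (he : e.eval w σ = k) (h : Q (σ.setVar x k) (e.cost + 1)) :
    Runs w (.assign x e) σ Q := ⟨_, _, .assign x e σ, he ▸ h⟩

theorem store {a j k : ℕ} {i : Expr} (hi : i.eval w σ = j) (he : e.eval w σ = k)
    (h : Q (σ.setArr a j k) (i.cost + e.cost + 1)) : Runs w (.store a i e) σ Q :=
  ⟨_, _, .store a i e σ, hi ▸ he ▸ h⟩

theorem seq (h : Runs w c σ fun σ' s => Runs w d σ' fun σ'' t => Q σ'' (s + t)) :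
    Runs w (.seq c d) σ Q := by
  obtain ⟨σ', s, h1, σ'', t, h2, h3⟩ := h
  exact ⟨_, _, .seq h1 h2, h3⟩

theorem ite (h1 : e.eval w σ ≠ 0 → Runs w c σ fun σ' t => Q σ' (e.cost + 1 + t))
    (h2 : e.eval w σ = 0 → Runs w d σ fun σ' t => Q σ' (e.cost + 1 + t)) :
    Runs w (.ite e c d) σ Q := by
  by_cases h : e.eval w σ = 0
  · obtain ⟨σ', t, h3, h4⟩ := h2 h
    exact ⟨_, _, .ite_false h h3, h4⟩
  · obtain ⟨σ', t, h3, h4⟩ := h1 h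
    exact ⟨_, _, .ite_true h h3, h4⟩

/-- The rule for loops. The invariant speaks of the store and of the time that has passed since the
start of the loop. -/
theorem whileLoop (Inv : Store → ℕ → Prop) (μ : Store → ℕ) (h0 : Inv σ 0)
    (step : ∀ σ' t, Inv σ' t → Same (.while e c) σ σ' → e.eval w σ' ≠ 0 →
      Runs w c σ' fun σ'' s => Inv σ'' (t + (e.cost + 1 + s)) ∧ μ σ'' < μ σ')
    (hQ : ∀ σ' t, Inv σ' t → Same (.while e c) σ σ' → e.eval w σ' = 0 → Q σ' (t + (e.cost + 1))) :
    Runs w (.while e c) σ Q := by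
  have key : ∀ (k : ℕ) (σ' : Store) (t : ℕ), μ σ' ≤ k → Inv σ' t → Same (.while e c) σ σ' →
      Runs w (.while e c) σ' fun σ'' s => Q σ'' (t + s) := by
    intro k
    induction k with
    | zero =>
      intro σ' t hk hI hs
      by_cases h : e.eval w σ' = 0
      · exact ⟨_, _, .while_false h, hQ _ _ hI hs h⟩
      · obtain ⟨σ'', s, -, -, h2⟩ := step σ' t hI hs h
        omega
    | succ k ih =>
      intro σ' t hk hI hs
      by_cases h : e.eval w σ' = 0
      · exact ⟨_, _, .while_false h, hQ _ _ hI hs h⟩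
      · obtain ⟨σ'', s, h1, h2, h3⟩ := step σ' t hI hs h
        obtain ⟨σ₃, s', h4, h5⟩ := ih σ'' _ (by omega) h2
          (hs.trans (h1.same.mono (by simp [Cmd.vars]) (by simp [Cmd.arrs])))
        refine ⟨_, _, .while_true h h1 h4, ?_⟩
        rwa [add_assoc t] at h5
  exact (key _ σ 0 le_rfl h0 (.refl _ _)).mono fun σ' t h => by simpa using h

end Runs

/-! ### Evaluation without overflow -/

section Eval

variable {w : ℕ} {σ : Store} {e f : Expr}

theorem eval_const {k : ℕ} (h : k < 2 ^ w) : (Expr.const k).eval w σ = k := Nat.mod_eq_of_lt h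

theorem eval_var {x k : ℕ} (h : σ.var x = k) : (Expr.var x).eval w σ = k := h

theorem eval_add {a b : ℕ} (he : e.eval w σ = a) (hf : f.eval w σ = b) (h : a + b < 2 ^ w) :
    (Expr.add e f).eval w σ = a + b := by
  rw [Expr.eval, he, hf, Nat.mod_eq_of_lt h]

theorem eval_mul {a b : ℕ} (he : e.eval w σ = a) (hf : f.eval w σ = b) (h : a * b < 2 ^ w) :
    (Expr.mul e f).eval w σ = a * b := by
  rw [Expr.eval, he, hf, Nat.mod_eq_of_lt h]

theorem eval_sub {a b : ℕ} (he : e.eval w σ = a) (hf : f.eval w σ = b) :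
    (Expr.sub e f).eval w σ = a - b := by
  rw [Expr.eval, he, hf]

theorem eval_get {a i : ℕ} (he : e.eval w σ = i) : (Expr.get a e).eval w σ = σ.arr a i := by
  rw [Expr.eval, he]

theorem eval_lt {a b : ℕ} (he : e.eval w σ = a) (hf : f.eval w σ = b) (h : 1 < 2 ^ w) :
    (Expr.lt e f).eval w σ = if a < b then 1 else 0 := by
  rw [Expr.eval, he, hf]
  split_ifs
  · exact Nat.mod_eq_of_lt h
  · exact Nat.zero_mod _

theorem eval_eq {a b : ℕ} (he : e.eval w σ = a) (hf : f.eval w σ = b) (h : 1 < 2 ^ w) :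
    (Expr.eq e f).eval w σ = if a = b then 1 else 0 := by
  rw [Expr.eval, he, hf]
  split_ifs
  · exact Nat.mod_eq_of_lt h
  · exact Nat.zero_mod _

/-- Conjunction of truth values is multiplication. -/
theorem eval_and {p q : Prop} [Decidable p] [Decidable q] (he : e.eval w σ = if p then 1 else 0)
    (hf : f.eval w σ = if q then 1 else 0) (h : 1 < 2 ^ w) :
    (Expr.mul e f).eval w σ = if p ∧ q then 1 else 0 := by
  rw [eval_mul he hf] <;> split_ifs <;> first | omega | tauto

theorem ite_ne_zero {p : Prop} [Decidable p] : (if p then 1 else 0) ≠ 0 ↔ p := by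
  split_ifs <;> simp_all

theorem ite_eq_zero {p : Prop} [Decidable p] : (if p then 1 else 0) = 0 ↔ ¬ p := by
  split_ifs <;> simp_all

end Eval

/-! ### Counting loops -/

/-- `for i < n do c`, where the variable `0` holds `n`. -/
def loop (i : ℕ) (c : Cmd) : Cmd :=
  .seq (.assign i (.const 0))
    (.while (.lt (.var i) (.var 0)) (.seq c (.assign i (.add (.var i) (.const 1)))))

/-- The rule for counting loops, with the time that has passed in the invariant, as it is needed for
amortized bounds. -/
theorem Runs.loop {w n i : ℕ} {c : Cmd} {σ : Store} {Q : Store → ℕ → Prop}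
    (hn : σ.var 0 = n) (hw : n < 2 ^ w) (hi : i ∉ c.vars) (h0 : 0 ∉ (loop i c).vars)
    (Inv : ℕ → Store → ℕ → Prop)
    (hset : ∀ j σ k t, Inv j σ t → Inv j (σ.setVar i k) t) (init : Inv 0 σ 0)
    (step : ∀ (j : Fin n) (σ' : Store) (t : ℕ), σ'.var i = j →
      Same (MRCE.loop i c) σ σ' → Inv j σ' t →
        Runs w c σ' fun σ'' s => Inv (j + 1) σ'' (t + (s + 8)))
    (hQ : ∀ σ' t, Same (MRCE.loop i c) σ σ' → Inv n σ' t → Q σ' (t + 6)) :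
    Runs w (MRCE.loop i c) σ Q := by
  have hpos : 0 < 2 ^ w := Nat.two_pow_pos w
  have hvars : ∀ x, x ∈ (MRCE.loop i c).vars ↔ x = i ∨ x ∈ c.vars := by
    intro x
    simp only [MRCE.loop, Cmd.vars, List.mem_append, List.mem_singleton]
    tauto
  have harrs : ∀ x, x ∈ (MRCE.loop i c).arrs ↔ x ∈ c.arrs := by
    intro x
    simp [MRCE.loop, Cmd.arrs]
  rw [hvars, not_or] at h0
  have h0c : i ≠ 0 := fun h => h0.1 h.symm
  refine .seq (.assign rfl ?_)
  refine .whileLoop (fun σ' t => ∃ j ≤ n, σ'.var i = j ∧ σ'.var 0 = n ∧ Same (MRCE.loop i c) σ σ' ∧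
    Inv j σ' t) (fun σ' => n - σ'.var i) ?_ ?_ ?_
  · refine ⟨0, Nat.zero_le _, by simp [Expr.eval], by simp [h0.1, hn], ⟨?_, fun _ _ => rfl⟩,
      hset _ _ _ _ init⟩
    intro x hx
    rw [hvars, not_or] at hx
    simp [hx.1]
  · rintro σ' t ⟨j, hj, h1, h2, h3, h4⟩ - hg
    have hlt : j < n := by
      rw [Expr.eval, Expr.eval, Expr.eval, h1, h2] at hg
      by_contra hlt
      simp [hlt] at hg
    refine .seq ((step ⟨j, hlt⟩ σ' t h1 h3 h4).mono_same fun σ'' s hs hI => .assign rfl ?_)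
    have hi'' : σ''.var i = j := (hs.var i hi).trans h1
    have hv : (Expr.add (.var i) (.const 1)).eval w σ'' = j + 1 :=
      eval_add hi'' (eval_const (by omega)) (by omega)
    rw [hv]
    refine ⟨⟨j + 1, hlt, by simp, ?_, ?_, ?_⟩, ?_⟩
    · rw [Store.setVar_var, if_neg h0.1, hs.var 0 h0.2, h2]
    · refine h3.trans ⟨fun x hx => ?_, fun a ha => ?_⟩
      · rw [hvars, not_or] at hx
        rw [Store.setVar_var, if_neg hx.1, hs.var x hx.2]
      · rw [harrs] at ha
        exact hs.arr a ha
    · have := hset _ _ (j + 1) _ hI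
      simp only [Expr.cost]
      convert this using 1
      ring
    · simp only [Store.setVar_var, if_true, h1]
      omega
  · rintro σ' t ⟨j, hj, h1, h2, h3, h4⟩ - hg
    have hge : n ≤ j := by
      rw [Expr.eval, Expr.eval, Expr.eval, h1, h2] at hg
      by_contra hlt
      rw [if_pos (by omega), Nat.mod_eq_of_lt (by omega)] at hg
      omega
    obtain rfl : j = n := le_antisymm hj hge
    have := hQ σ' t h3 h4
    simp only [Expr.cost]
    convert this using 1
    ring

/-- A loop whose body takes at most `T` steps. -/
theorem Runs.loop_const {w n i T : ℕ} {c : Cmd} {σ : Store} {Q : Store → ℕ → Prop}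
    (hn : σ.var 0 = n) (hw : n < 2 ^ w) (hi : i ∉ c.vars) (h0 : 0 ∉ (MRCE.loop i c).vars)
    (Inv : ℕ → Store → Prop)
    (hset : ∀ j σ k, Inv j σ → Inv j (σ.setVar i k)) (init : Inv 0 σ)
    (step : ∀ (j : Fin n) (σ' : Store), σ'.var i = j → Same (MRCE.loop i c) σ σ' → Inv j σ' →
      Runs w c σ' fun σ'' s => s ≤ T ∧ Inv (j + 1) σ'')
    (hQ : ∀ σ' t, Same (MRCE.loop i c) σ σ' → t ≤ n * (T + 8) + 6 → Inv n σ' → Q σ' t) :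
    Runs w (MRCE.loop i c) σ Q := by
  refine .loop hn hw hi h0 (fun j σ' t => t ≤ j * (T + 8) ∧ Inv j σ')
    (fun j σ' k t h => ⟨h.1, hset j σ' k h.2⟩) ⟨Nat.zero_le _, init⟩ ?_
    fun σ' t h1 h2 => hQ σ' _ h1 (by omega) h2.2
  intro j σ' t h1 h2 h3
  refine (step j σ' h1 h2 h3.2).mono fun σ'' s h => ⟨?_, h.2⟩
  have := h3.1
  rw [add_mul]
  omega

/-- `s := ∑ i < n, e`. -/
def count (i s : ℕ) (e : Expr) : Cmd :=
  .seq (.assign s (.const 0)) (loop i (.assign s (.add (.var s) e)))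

/-- If the value of `e` is the indicator of a property, its sum counts the property. -/
theorem Runs.count {w n i s : ℕ} {e : Expr} {σ : Store} {Q : Store → ℕ → Prop}
    (P : Fin n → Prop) [DecidablePred P] (hn : σ.var 0 = n) (hw : n < 2 ^ w) (his : i ≠ s)
    (hi : i ≠ 0) (hs : s ≠ 0)
    (he : ∀ (j : Fin n) (σ' : Store), σ'.var i = j → Same (count i s e) σ σ' →
      e.eval w σ' = if P j then 1 else 0)
    (hQ : ∀ σ' t, Same (MRCE.count i s e) σ σ' → t ≤ n * (e.cost + 11) + 8 →
      σ'.var s = (Finset.univ.filter P).card → Q σ' t) : Runs w (MRCE.count i s e) σ Q := by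
  have hpos : 0 < 2 ^ w := Nat.two_pow_pos w
  refine .seq (.assign rfl ?_)
  have hmono : ∀ {σ'}, Same (MRCE.loop i (.assign s (.add (.var s) e)))
      (σ.setVar s ((Expr.const 0).eval w σ)) σ' → Same (MRCE.count i s e) σ σ' := by
    intro σ' h
    constructor
    · intro x hx
      rw [h.var x (by
        simp only [MRCE.count, Cmd.vars, List.mem_append, not_or] at hx
        exact hx.2)]
      simp only [MRCE.count, Cmd.vars, List.mem_append, not_or, List.mem_singleton] at hx
      simp [hx.1]
    · intro a ha
      exact h.arr a (by simp [MRCE.loop, Cmd.arrs])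
  refine .loop_const (n := n) (T := e.cost + 3) (by simp [hn, hs.symm]) hw (by simp [Cmd.vars, his])
    (by simp [MRCE.loop, Cmd.vars, hi.symm, hs.symm])
    (fun j σ' => σ'.var s = (Finset.univ.filter fun u : Fin n => (u : ℕ) < j ∧ P u).card)
    (fun j σ' k h => by simpa [his.symm] using h) (by simp [Expr.eval]) ?_ ?_
  · intro j σ' h1 h2 h3
    have hcard : (Finset.univ.filter fun u : Fin n => (u : ℕ) < j + 1 ∧ P u).card =
        (Finset.univ.filter fun u : Fin n => (u : ℕ) < j ∧ P u).card + if P j then 1 else 0 := by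
      split_ifs with hP
      · rw [← Finset.card_insert_of_notMem (a := j) (by simp)]
        congr 1
        ext u
        simp only [Finset.mem_filter, Finset.mem_univ, true_and, Finset.mem_insert, Fin.ext_iff,
          Nat.lt_succ_iff_lt_or_eq]
        constructor
        · rintro ⟨h | h, h'⟩ <;> tauto
        · rintro (h | h)
          · exact ⟨.inr h, by rwa [show u = j from Fin.ext h]⟩
          · exact ⟨.inl h.1, h.2⟩
      · rw [add_zero]
        congr 1
        ext u
        simp only [Finset.mem_filter, Finset.mem_univ, true_and, Nat.lt_succ_iff_lt_or_eq]
        constructor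
        · rintro ⟨h | h, h'⟩
          · exact ⟨h, h'⟩
          · exact absurd (by rwa [show u = j from Fin.ext h] at h') hP
        · exact fun h => ⟨.inl h.1, h.2⟩
    have hle := Finset.card_le_univ (Finset.univ.filter fun u : Fin n => (u : ℕ) < j + 1 ∧ P u)
    rw [Fintype.card_fin, hcard] at hle
    refine .assign rfl ⟨by simp only [Expr.cost]; omega, ?_⟩
    have hv : (Expr.var s).eval w σ' = _ := h3
    rw [eval_add hv (he j σ' h1 (hmono h2)) (by omega), Store.setVar_var, if_pos rfl, hcard]
  · intro σ' t h1 h2 h3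
    refine hQ σ' _ (hmono h1) ?_ ?_
    · simp only [Expr.cost]
      have : n * (e.cost + 3 + 8) = n * (e.cost + 11) := by ring
      omega
    · rw [h3]
      congr 1
      ext u
      simp

/-- `for v < n do (c; a[v] := e)`. -/
def tabulate (v a : ℕ) (c : Cmd) (e : Expr) : Cmd := loop v (.seq c (.store a (.var v) e))

theorem Runs.tabulate {w n v a T : ℕ} {c : Cmd} {e : Expr} {σ : Store} {Q : Store → ℕ → Prop}
    (f : Fin n → ℕ) (hn : σ.var 0 = n) (hw : n < 2 ^ w) (hv : v ∉ c.vars)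
    (h0 : 0 ∉ (MRCE.tabulate v a c e).vars) (ha : a ∉ c.arrs)
    (hc : ∀ (j : Fin n) (σ' : Store), σ'.var v = j → Same (MRCE.tabulate v a c e) σ σ' →
      Runs w c σ' fun σ'' s => s ≤ T ∧ e.eval w σ'' = f j)
    (hQ : ∀ σ' t, Same (MRCE.tabulate v a c e) σ σ' → t ≤ n * (T + e.cost + 10) + 6 →
      (∀ j : Fin n, σ'.arr a j = f j) → Q σ' t) : Runs w (MRCE.tabulate v a c e) σ Q := by
  refine .loop_const (n := n) (T := T + e.cost + 2) hn hw (by simpa [Cmd.vars] using hv) h0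
    (fun j σ' => ∀ i : Fin n, (i : ℕ) < j → σ'.arr a i = f i) (fun j σ' k h => h)
    (fun i hi => absurd hi (Nat.not_lt_zero _)) ?_
    fun σ' t h1 h2 h3 => hQ σ' t h1 (by linarith) fun j => h3 j j.2
  intro j σ' h1 h2 h3
  refine .seq ((hc j σ' h1 h2).mono_same fun σ'' s hs h => .store rfl rfl ⟨?_, fun i hi => ?_⟩)
  · simp only [Expr.cost]
    omega
  · have h4 : (Expr.var v).eval w σ'' = j := (hs.var v hv).trans h1
    rw [Store.setArr_arr, h4, h.2]
    split_ifs with h5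
    · rw [Fin.ext h5.2]
    · rw [hs.arr a ha]
      exact h3 i (lt_of_le_of_ne (Nat.lt_succ_iff.1 hi) fun h6 => h5 ⟨rfl, h6⟩)

/-! ### Matrices -/

/-- The index `x * n + y` of a matrix entry, where the variables `x`, `y`, `0` hold the row, the
column and the number of columns. -/
def ix (x y : ℕ) : Expr := .add (.mul (.var x) (.var 0)) (.var y)

theorem index_inj {n : ℕ} {u v u' v' : Fin n} :
    (u : ℕ) * n + v = u' * n + v' ↔ u = u' ∧ v = v' := by
  constructor
  · intro h
    have hv := v.2
    have hv' := v'.2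
    have hu : (u : ℕ) = u' := by
      rcases lt_trichotomy (u : ℕ) u' with h1 | h1 | h1
      · have := Nat.mul_le_mul_right n h1
        rw [Nat.succ_mul] at this
        omega
      · exact h1
      · have := Nat.mul_le_mul_right n h1
        rw [Nat.succ_mul] at this
        omega
    refine ⟨Fin.ext hu, Fin.ext ?_⟩
    rw [hu] at h
    omega
  · rintro ⟨rfl, rfl⟩
    rfl

theorem index_lt {n : ℕ} (u v : Fin n) : (u : ℕ) * n + v < n * n := by
  have := Nat.mul_le_mul_right n u.2
  rw [Nat.succ_mul] at this
  have := v.2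
  omega

theorem eval_ix {w n x y : ℕ} {σ : Store} (u v : Fin n) (hw : n * n < 2 ^ w) (hn : σ.var 0 = n)
    (hx : σ.var x = u) (hy : σ.var y = v) : (ix x y).eval w σ = u * n + v := by
  have := index_lt u v
  exact eval_add (eval_mul hx hn (by omega)) hy (by omega)

/-! ### Orienting the complement -/

/-- A command without effect on the rest of the program. -/
def noop : Cmd := .assign 9 (.const 0)

/-- Puts the arc in the variables `x`, `y` at the end of the queue of the current implication
class: it is marked by `2` in the state matrix `5` and entered in the matrix `6` of the
orientation; the arrays `7` and `8` hold the tails and the heads of the arcs in the queue, the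
variable `8` the length of the queue. -/
def push (x y : ℕ) : Cmd :=
  .seq (.store 5 (ix x y) (.const 2)) <| .seq (.store 6 (ix x y) (.const 1)) <|
  .seq (.store 7 (.var 8) (.var x)) <| .seq (.store 8 (.var 8) (.var y)) <|
  .assign 8 (.add (.var 8) (.const 1))

/-- Puts the arc in the variables `x`, `y` into the queue if it is an edge that is not yet marked
and the pair in the variables `s`, `t` is not an edge. -/
def tryPush (x y s t : ℕ) : Cmd :=
  .ite (.eq (.get 5 (ix x y)) (.const 1))
    (.ite (.eq (.get 5 (ix s t)) (.const 0)) (push x y) noop) noop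

/-- Appends to the queue all arcs that are forced by its elements. -/
def closeQueue : Cmd :=
  .while (.lt (.var 7) (.var 8)) <|
    .seq (.assign 10 (.get 7 (.var 7))) <| .seq (.assign 11 (.get 8 (.var 7))) <|
    .seq (.assign 7 (.add (.var 7) (.const 1))) <|
    loop 6 (.seq (tryPush 10 6 11 6) (tryPush 6 11 10 6))

/-- Deletes the edges in the queue from the state matrix. -/
def clearQueue : Cmd :=
  .while (.lt (.var 7) (.var 8)) <|
    .seq (.assign 10 (.get 7 (.var 7))) <| .seq (.assign 11 (.get 8 (.var 7))) <|
    .seq (.assign 7 (.add (.var 7) (.const 1))) <|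
    .seq (.store 5 (ix 10 11) (.const 0)) (.store 5 (ix 11 10) (.const 0))

/-- Orients the implication class of the arc in the variables `4`, `5` and deletes it from the
state matrix. -/
def orientClass : Cmd :=
  .seq (.assign 7 (.const 0)) <| .seq (.assign 8 (.const 0)) <| .seq (push 4 5) <|
  .seq closeQueue <| .seq (.assign 7 (.const 0)) clearQueue

/-- Computes a transitive orientation of the graph in the state matrix. -/
def orient : Cmd :=
  loop 4 (loop 5 (.ite (.eq (.get 5 (ix 4 5)) (.const 1)) orientClass noop))

/-- Fills the state matrix with the adjacency matrix of the complement. -/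
def initState : Cmd :=
  loop 4 (loop 5 (.store 5 (ix 4 5)
    (.eq (.add (.get 0 (ix 4 5)) (.eq (.var 4) (.var 5))) (.const 0))))

open Classical in
/-- The arrays represent the remaining graph `E`, the orientation `P` of the arcs of the earlier
classes and the queue `q` of the current class. -/
structure Queue {n : ℕ} (E P : Fin n → Fin n → Prop) (q : List (Fin n × Fin n)) (σ : Store) :
    Prop where
  state : ∀ u v : Fin n, σ.arr 5 (u * n + v) = if (u, v) ∈ q then 2 else if E u v then 1 else 0
  arcs : ∀ u v : Fin n, σ.arr 6 (u * n + v) = if (u, v) ∈ q ∨ P u v then 1 else 0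
  tail : σ.var 8 = q.length
  row : ∀ i (h : i < q.length), σ.arr 7 i = q[i].1
  col : ∀ i (h : i < q.length), σ.arr 8 i = q[i].2
  nodup : q.Nodup
  sub : ∀ p ∈ q, E p.1 p.2

section Orient

variable {n w : ℕ} {E P : Fin n → Fin n → Prop} {q : List (Fin n × Fin n)} {σ : Store}
  {Q : Store → ℕ → Prop}

theorem Queue.setVar (h : Queue E P q σ) {x k : ℕ} (hx : x ≠ 8) : Queue E P q (σ.setVar x k) :=
  ⟨h.state, h.arcs, by rw [Store.setVar_var, if_neg hx.symm, h.tail], h.row, h.col, h.nodup, h.sub⟩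

theorem Queue.length_le (h : Queue E P q σ) : q.length ≤ n * n := by
  have := h.nodup.length_le_card
  simpa using this

theorem Queue.length_lt (h : Queue E P q σ) {a : Fin n × Fin n} (ha : a ∉ q) :
    q.length < n * n := by
  have := (List.nodup_cons.2 ⟨ha, h.nodup⟩).length_le_card
  simpa using this

theorem Queue.state_eq_one (h : Queue E P q σ) {u v : Fin n} :
    σ.arr 5 (u * n + v) = 1 ↔ E u v ∧ (u, v) ∉ q := by
  rw [h.state]
  split_ifs <;> simp [*]

theorem Queue.state_eq_zero (h : Queue E P q σ) {u v : Fin n} :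
    σ.arr 5 (u * n + v) = 0 ↔ ¬ E u v := by
  rw [h.state]
  split_ifs with h1
  · simpa using h.sub _ h1
  · simpa
  · simpa

theorem runs_push (hw : 4 * (n * n) + 16 * n + 16 < 2 ^ w) (hn : σ.var 0 = n)
    (h : Queue E P q σ) {u v : Fin n} (hE : E u v) (hq : (u, v) ∉ q) {x y : ℕ}
    (hx : σ.var x = u) (hy : σ.var y = v)
    (hQ : ∀ σ' t, t ≤ 27 → Queue E P (q ++ [(u, v)]) σ' → Q σ' t) :
    Runs w (push x y) σ Q := by
  classical
  have hlen := h.length_lt hq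
  have e1 : ∀ σ' : Store, σ'.var = σ.var → (ix x y).eval w σ' = u * n + v := fun σ' h' =>
    eval_ix u v (by omega) (by rw [h', hn]) (by rw [h', hx]) (by rw [h', hy])
  refine .seq <| .store (e1 _ rfl) (eval_const (by omega)) <|
    .seq <| .store (e1 _ rfl) (eval_const (by omega)) <| .seq <| .store h.tail hx <|
    .seq <| .store h.tail hy <| .assign (k := q.length + 1)
      (eval_add h.tail (eval_const (by omega)) (by omega)) ?_
  refine hQ _ _ (by simp [Expr.cost, ix]) ⟨?_, ?_, by simp, ?_, ?_, ?_, ?_⟩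
  · intro u' v'
    have := h.state u' v'
    simp only [Store.setVar_arr, Store.setArr_arr, index_inj, List.mem_append,
      List.mem_singleton, Prod.mk.injEq]
    norm_num
    split_ifs at this ⊢ <;> simp_all
  · intro u' v'
    have := h.arcs u' v'
    simp only [Store.setVar_arr, Store.setArr_arr, index_inj, List.mem_append,
      List.mem_singleton, Prod.mk.injEq]
    norm_num
    split_ifs at this ⊢ <;> simp_all
  · intro i hi
    simp only [Store.setVar_arr, Store.setArr_arr]
    norm_num
    rw [List.length_append, List.length_singleton] at hi
    split_ifs with h1
    · subst h1
      simp
    · have h2 : i < q.length := by omega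
      rw [h.row i h2, List.getElem_append_left h2]
  · intro i hi
    simp only [Store.setVar_arr, Store.setArr_arr]
    norm_num
    rw [List.length_append, List.length_singleton] at hi
    split_ifs with h1
    · subst h1
      simp
    · have h2 : i < q.length := by omega
      rw [h.col i h2, List.getElem_append_left h2]
  · exact List.nodup_append.2 ⟨h.nodup, by simp, by
      intro a ha b hb
      rw [List.mem_singleton] at hb
      rintro rfl
      exact hq (hb ▸ ha)⟩
  · intro p hp
    rcases List.mem_append.1 hp with hp | hp
    · exact h.sub p hp
    · rw [List.mem_singleton] at hp
      rwa [hp]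

theorem runs_tryPush (hw : 4 * (n * n) + 16 * n + 16 < 2 ^ w) (hn : σ.var 0 = n)
    (h : Queue E P q σ) {u v a b : Fin n} {x y s t : ℕ}
    (hx : σ.var x = u) (hy : σ.var y = v) (hs : σ.var s = a) (ht : σ.var t = b)
    (hQ : ∀ σ' t q', t ≤ 60 → Queue E P q' σ' →
      (q' = q ∨ q' = q ++ [(u, v)] ∧ E u v ∧ ¬ E a b) → (E u v → ¬ E a b → (u, v) ∈ q') →
      Q σ' t) :
    Runs w (tryPush x y s t) σ Q := by
  classical
  have hxy : (ix x y).eval w σ = u * n + v := eval_ix u v (by omega) hn hx hy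
  have hst : (ix s t).eval w σ = a * n + b := eval_ix a b (by omega) hn hs ht
  refine .ite (fun hg => .ite (fun hg' => ?_) fun hg' => .assign rfl ?_) fun hg => .assign rfl ?_
  all_goals
    rw [eval_eq (eval_get hxy) (eval_const (by omega)) (by omega)] at hg
    try rw [eval_eq (eval_get hst) (eval_const (by omega)) (by omega)] at hg'
    simp only [ne_eq, ite_eq_zero, h.state_eq_one, not_not] at hg
    try simp only [ne_eq, ite_eq_zero, h.state_eq_zero, not_not] at hg'
  · exact runs_push hw hn h hg.1 hg.2 hx hy fun σ' t ht h' => hQ σ' _ _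
      (by simp only [Expr.cost, ix]; omega) h' (.inr ⟨rfl, hg.1, hg'⟩) fun _ _ => by simp
  · exact hQ _ _ q (by simp [Expr.cost, ix]) (h.setVar (by decide)) (.inl rfl)
      fun _ h' => absurd hg' h'
  · exact hQ _ _ q (by simp [Expr.cost, ix]) (h.setVar (by decide)) (.inl rfl)
      fun h' _ => by_contra fun h'' => hg ⟨h', h''⟩

/-- The arcs between `c` and an end of the arc `p` that `p` forces belong to the queue `q`. -/
def Forced (E : Fin n → Fin n → Prop) (q : List (Fin n × Fin n)) (p : Fin n × Fin n)
    (c : Fin n) : Prop :=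
  (E p.1 c → ¬ E p.2 c → (p.1, c) ∈ q) ∧ (E c p.2 → ¬ E p.1 c → (c, p.2) ∈ q)

theorem Forced.mono {q q' : List (Fin n × Fin n)} {p : Fin n × Fin n} {c : Fin n}
    (h : Forced E q p c) (hq : q ⊆ q') : Forced E q' p c :=
  ⟨fun h1 h2 => hq (h.1 h1 h2), fun h1 h2 => hq (h.2 h1 h2)⟩

theorem runs_forceLoop (hw : 4 * (n * n) + 16 * n + 16 < 2 ^ w) (hn : σ.var 0 = n)
    (h : Queue E P q σ) {a b x y : Fin n}
    (ha : σ.var 10 = a) (hb : σ.var 11 = b) (hab : Cls E x y a b)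
    (hq : ∀ p ∈ q, Cls E x y p.1 p.2)
    (hQ : ∀ σ' t q', t ≤ n * 128 + 6 → Queue E P q' σ' → q <+: q' →
      (∀ p ∈ q', Cls E x y p.1 p.2) → (∀ c, Forced E q' (a, b) c) →
      Same (loop 6 (.seq (tryPush 10 6 11 6) (tryPush 6 11 10 6))) σ σ' → Q σ' t) :
    Runs w (loop 6 (.seq (tryPush 10 6 11 6) (tryPush 6 11 10 6))) σ Q := by
  refine .loop_const (n := n) (T := 120) hn (by omega) (by decide) (by decide)
    (fun j σ' => ∃ q', Queue E P q' σ' ∧ q <+: q' ∧ (∀ p ∈ q', Cls E x y p.1 p.2) ∧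
      ∀ c : Fin n, (c : ℕ) < j → Forced E q' (a, b) c) ?_ ?_ ?_ ?_
  · rintro j σ' k ⟨q', h1, h2⟩
    exact ⟨q', h1.setVar (by decide), h2⟩
  · exact ⟨q, h, List.prefix_rfl, hq, fun c hc => absurd hc (Nat.not_lt_zero _)⟩
  · rintro c σ' hc hsame ⟨q', h1, h2, h3, h4⟩
    refine .seq (Runs.mono_same (runs_tryPush hw ((hsame.var 0 (by decide)).trans hn) h1
      ((hsame.var 10 (by decide)).trans ha) hc ((hsame.var 11 (by decide)).trans hb) hc
      (Q := fun σ₁ s => ∃ q₁, s ≤ 60 ∧ Queue E P q₁ σ₁ ∧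
        (q₁ = q' ∨ q₁ = q' ++ [(a, c)] ∧ E a c ∧ ¬ E b c) ∧ (E a c → ¬ E b c → (a, c) ∈ q₁))
      (fun σ₁ s q₁ g1 g2 g3 g4 => ⟨q₁, g1, g2, g3, g4⟩)) ?_)
    rintro σ₁ s hs1 ⟨q₁, g1, g2, g3, g4⟩
    refine runs_tryPush hw ((hs1.var 0 (by decide)).trans ((hsame.var 0 (by decide)).trans hn)) g2
      ((hs1.var 6 (by decide)).trans hc)
      ((hs1.var 11 (by decide)).trans ((hsame.var 11 (by decide)).trans hb))
      ((hs1.var 10 (by decide)).trans ((hsame.var 10 (by decide)).trans ha))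
      ((hs1.var 6 (by decide)).trans hc) ?_
    intro σ₂ s' q₂ k1 k2 k3 k4
    have p1 : q' <+: q₁ := by
      rcases g3 with rfl | ⟨rfl, -⟩
      · exact List.prefix_rfl
      · exact List.prefix_append _ _
    have p2 : q₁ <+: q₂ := by
      rcases k3 with rfl | ⟨rfl, -⟩
      · exact List.prefix_rfl
      · exact List.prefix_append _ _
    have c1 : ∀ p ∈ q₁, Cls E x y p.1 p.2 := by
      rcases g3 with rfl | ⟨rfl, e1, e2⟩
      · exact h3
      · intro p hp
        rcases List.mem_append.1 hp with hp | hp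
        · exact h3 p hp
        · rw [List.mem_singleton.1 hp]
          exact hab.stepR e1 e2
    have c2 : ∀ p ∈ q₂, Cls E x y p.1 p.2 := by
      rcases k3 with rfl | ⟨rfl, e1, e2⟩
      · exact c1
      · intro p hp
        rcases List.mem_append.1 hp with hp | hp
        · exact c1 p hp
        · rw [List.mem_singleton.1 hp]
          exact hab.stepL e1 e2
    refine ⟨by omega, q₂, k2, h2.trans (p1.trans p2), c2, fun c' hc' => ?_⟩
    rcases Nat.lt_succ_iff_lt_or_eq.1 hc' with h5 | h5
    · exact (h4 c' h5).mono (p1.trans p2).subset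
    · rw [Fin.ext h5]
      exact ⟨fun e1 e2 => p2.subset (g4 e1 e2), fun e1 e2 => k4 e1 e2⟩
  · rintro σ' t hsame ht ⟨q', h1, h2, h3, h4⟩
    exact hQ σ' t q' ht h1 h2 h3 (fun c => h4 c c.2) hsame

theorem runs_closeQueue (hw : 4 * (n * n) + 16 * n + 16 < 2 ^ w) (hn : σ.var 0 = n)
    {x y : Fin n} (h : Queue E P [(x, y)] σ)
    (h7 : σ.var 7 = 0)
    (hQ : ∀ σ' t q', t ≤ q'.length * (n * 128 + 30) + 4 → Queue E P q' σ' →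
      (∀ p : Fin n × Fin n, p ∈ q' ↔ Cls E x y p.1 p.2) → Same closeQueue σ σ' → Q σ' t) :
    Runs w closeQueue σ Q := by
  have hg : ∀ σ' : Store, (Expr.lt (.var 7) (.var 8)).eval w σ' =
      if σ'.var 7 < σ'.var 8 then 1 else 0 := fun σ' => eval_lt rfl rfl (by omega)
  refine .whileLoop (fun σ' t => ∃ q', Queue E P q' σ' ∧ (x, y) ∈ q' ∧
    (∀ p ∈ q', Cls E x y p.1 p.2) ∧ σ'.var 7 ≤ q'.length ∧
    (∀ i (h : i < q'.length), i < σ'.var 7 → ∀ c, Forced E q' q'[i] c) ∧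
    t ≤ σ'.var 7 * (n * 128 + 30)) (fun σ' => n * n - σ'.var 7) ?_ ?_ ?_
  · refine ⟨_, h, by simp, ?_, by simp [h7], ?_, by simp [h7]⟩
    · intro p hp
      rw [List.mem_singleton.1 hp]
      exact .base
    · intro i hi hi'
      omega
  · rintro σ' t ⟨q', h1, h2, h3, h4, h5, h6⟩ hsame hne
    rw [hg, ite_ne_zero, h1.tail] at hne
    have hlen := h1.length_le
    refine .seq <| .assign (k := q'[σ'.var 7].1) (h1.row _ hne) <|
      .seq <| .assign (k := q'[σ'.var 7].2) (h1.col _ hne) <|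
      .seq <| .assign (k := σ'.var 7 + 1)
        (eval_add rfl (eval_const (by omega)) (?_ : σ'.var 7 + 1 < 2 ^ w)) ?_
    · omega
    refine runs_forceLoop (x := x) (y := y) (q := q') (a := q'[σ'.var 7].1) (b := q'[σ'.var 7].2)
      hw (by simpa using (hsame.var 0 (by decide)).trans hn)
      (((h1.setVar (by decide)).setVar (by decide)).setVar (by decide)) (by simp) (by simp)
      (h3 _ (List.getElem_mem hne)) h3 ?_
    intro σ'' s q'' k1 k2 k3 k4 k5 k6
    have h7' : σ''.var 7 = σ'.var 7 + 1 := (k6.var 7 (by decide)).trans (by simp)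
    have hle := k3.length_le
    refine ⟨⟨q'', k2, k3.subset h2, k4, by omega, ?_, ?_⟩, ?_⟩
    · intro i hi hi' c
      rw [h7'] at hi'
      have hi2 : i < q'.length := by omega
      rw [← k3.getElem hi2]
      rcases Nat.lt_succ_iff_lt_or_eq.1 hi' with h8 | rfl
      · exact (h5 i hi2 h8 c).mono k3.subset
      · exact k5 c
    · rw [h7', add_mul]
      simp only [Expr.cost]
      omega
    · rw [h7']
      omega
  · rintro σ' t ⟨q', h1, h2, h3, h4, h5, h6⟩ hsame hne
    rw [hg, ite_eq_zero, h1.tail] at hne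
    have h7' : σ'.var 7 = q'.length := by omega
    refine hQ σ' _ q' ?_ h1 (fun p => ⟨h3 p, fun hp => ?_⟩) hsame
    · rw [h7'] at h6
      simp only [Expr.cost]
      omega
    · obtain ⟨a, b⟩ := p
      -- The queue contains `(x, y)` and is closed under forcing, hence contains the whole class.
      have hcl : ∀ p ∈ q', ∀ c, Forced E q' p c := by
        intro p hp c
        obtain ⟨i, hi, rfl⟩ := List.getElem_of_mem hp
        exact h5 i hi (by omega) c
      change Cls E x y a b at hp
      induction hp with
      | base => exact h2
      | stepR _ e1 e2 ih => exact (hcl _ ih _).1 e1 e2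
      | stepL _ e1 e2 ih => exact (hcl _ ih _).2 e1 e2

open Classical in
theorem runs_clearQueue (hw : 4 * (n * n) + 16 * n + 16 < 2 ^ w) (hn : σ.var 0 = n)
    (h : Queue E P q σ) (h7 : σ.var 7 = 0)
    (hQ : ∀ σ' t, t ≤ q.length * 40 + 4 → (∀ u v : Fin n, σ'.arr 5 (u * n + v) =
      if (u, v) ∈ q ∨ (v, u) ∈ q then 0 else if E u v then 1 else 0) →
      Same clearQueue σ σ' → Q σ' t) :
    Runs w clearQueue σ Q := by
  have hlen := h.length_le
  have hg : ∀ σ' : Store, (Expr.lt (.var 7) (.var 8)).eval w σ' =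
      if σ'.var 7 < σ'.var 8 then 1 else 0 := fun σ' => eval_lt rfl rfl (by omega)
  refine .whileLoop (fun σ' t => σ'.var 7 ≤ q.length ∧ t ≤ σ'.var 7 * 40 ∧
      ∀ u v : Fin n, σ'.arr 5 (u * n + v) =
        if (u, v) ∈ q.take (σ'.var 7) ∨ (v, u) ∈ q.take (σ'.var 7) then 0 else
        σ.arr 5 (u * n + v))
    (fun σ' => q.length - σ'.var 7) (by simp [h7]) ?_ ?_
  · rintro σ' t ⟨h1, h2, h3⟩ hsame hne
    have h8 : σ'.var 8 = q.length := (hsame.var 8 (by decide)).trans h.tail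
    rw [hg, ite_ne_zero, h8] at hne
    have hn' : σ'.var 0 = n := (hsame.var 0 (by decide)).trans hn
    set a := q[σ'.var 7].1 with ha
    set b := q[σ'.var 7].2 with hb
    have hab : q[σ'.var 7] = (a, b) := rfl
    have e1 : (Expr.get 7 (.var 7)).eval w σ' = a := by
      rw [ha, ← h.row _ hne, ← hsame.arr 7 (by decide)]
      rfl
    have e2 : ∀ k, (Expr.get 8 (.var 7)).eval w (σ'.setVar 10 k) = b := by
      intro k
      rw [hb, ← h.col _ hne, ← hsame.arr 8 (by decide)]
      rfl
    refine .seq <| .assign e1 <| .seq <| .assign (e2 _) <|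
      .seq <| .assign (k := σ'.var 7 + 1)
        (eval_add rfl (eval_const (by omega)) (?_ : σ'.var 7 + 1 < 2 ^ w)) <|
      .seq <| .store (eval_ix (n := n) a b (by omega) (by simp [hn']) (by simp) (by simp))
        (eval_const (by omega)) <|
      .store (eval_ix (n := n) b a (by omega) (by simp [hn']) (by simp) (by simp))
        (eval_const (by omega)) ?_
    · omega
    refine ⟨⟨?_, ?_, ?_⟩, ?_⟩
    · simp
      omega
    · simp [Expr.cost, ix]
      omega
    · intro u v
      have := h3 u v
      simp only [Store.setArr_arr, Store.setArr_var, Store.setVar_var, Store.setVar_arr, true_and,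
        if_true, index_inj]
      rw [List.take_succ_eq_append_getElem hne, hab]
      simp only [List.mem_append, List.mem_singleton, Prod.mk.injEq]
      rw [this]
      split_ifs <;> first | rfl | (exfalso; tauto)
    · simp
      omega
  · rintro σ' t ⟨h1, h2, h3⟩ hsame hne
    have h8 : σ'.var 8 = q.length := (hsame.var 8 (by decide)).trans h.tail
    rw [hg, ite_eq_zero, h8] at hne
    have h9 : σ'.var 7 = q.length := by omega
    refine hQ σ' _ ?_ ?_ hsame
    · rw [h9] at h2
      simp only [Expr.cost]
      omega
    · intro u v
      rw [h3, h9, List.take_length, h.state]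
      split_ifs <;> first | rfl | (exfalso; tauto)

open Classical in
/-- The state matrix represents the remaining graph `E`, the matrix `6` the orientation `P`. -/
def GraphState (E P : Fin n → Fin n → Prop) (σ : Store) : Prop :=
  (∀ u v : Fin n, σ.arr 5 (u * n + v) = if E u v then 1 else 0) ∧
    ∀ u v : Fin n, σ.arr 6 (u * n + v) = if P u v then 1 else 0

open Classical in
/-- The number of arcs of `E`. It pays for the time that is spent on the queue. -/
def arcCount (E : Fin n → Fin n → Prop) : ℕ :=
  (Finset.univ.filter fun p : Fin n × Fin n => E p.1 p.2).card

theorem arcCount_le (E : Fin n → Fin n → Prop) : arcCount E ≤ n * n := by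
  classical
  exact (Finset.card_le_univ _).trans (by simp)

/-- The time for an implication class is bounded in terms of the number `m` of its arcs, all of
which are deleted. -/
theorem runs_orientClass (hw : 4 * (n * n) + 16 * n + 16 < 2 ^ w) (hn : σ.var 0 = n)
    (h : GraphState E P σ) {x y : Fin n} (hE : E x y) (hx : σ.var 4 = x) (hy : σ.var 5 = y)
    (hQ : ∀ σ' t m, t ≤ m * (n * 128 + 70) + 60 → arcCount (removeCls E x y) + m ≤ arcCount E →
      GraphState (removeCls E x y) (fun u v => Cls E x y u v ∨ P u v) σ' → Q σ' t) :
    Runs w orientClass σ Q := by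
  classical
  have e0 : ∀ σ', (Expr.const 0).eval w σ' = 0 := fun _ => eval_const (by omega)
  have hq0 : Queue E P [] ((σ.setVar 7 0).setVar 8 0) :=
    ⟨by simpa using h.1, by simpa using h.2, by simp, by simp, by simp, by simp, by simp⟩
  refine .seq <| .assign (e0 _) <| .seq <| .assign (e0 _) <| .seq <|
    Runs.mono_same (runs_push (u := x) (v := y) hw (by simp [hn]) hq0 hE (by simp)
      (by simp [hx]) (by simp [hy]) (Q := fun σ' t => t ≤ 27 ∧ Queue E P [(x, y)] σ')
      fun σ' t h1 h2 => ⟨h1, h2⟩) ?_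
  rintro σ₁ t₁ hs1 ⟨ht1, hq1⟩
  have hn1 : σ₁.var 0 = n := (hs1.var 0 (by decide)).trans (by simp [hn])
  refine .seq <| runs_closeQueue hw hn1 hq1 ((hs1.var 7 (by decide)).trans (by simp)) ?_
  intro σ₂ t₂ q ht2 hq2 hmem hs2
  have hn2 : σ₂.var 0 = n := (hs2.var 0 (by decide)).trans hn1
  refine .seq <| .assign (e0 _) <| runs_clearQueue (σ := σ₂.setVar 7 0) hw (by simp [hn2])
    (hq2.setVar (by decide)) (by simp) ?_
  intro σ₃ t₃ ht3 h5 hs3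
  refine hQ _ _ q.length ?_ ?_ ⟨?_, ?_⟩
  · simp only [Expr.cost]
    have : q.length * (n * 128 + 70) = q.length * (n * 128 + 30) + q.length * 40 := by ring
    omega
  · have hd : Disjoint (Finset.univ.filter fun p : Fin n × Fin n => removeCls E x y p.1 p.2)
        q.toFinset := by
      rw [Finset.disjoint_left]
      intro p hp hp'
      rw [List.mem_toFinset] at hp'
      exact (Finset.mem_filter.1 hp).2.2.1 ((hmem p).1 hp')
    rw [← List.toFinset_card_of_nodup hq2.nodup]
    refine (Finset.card_union_of_disjoint hd).symm.trans_le (Finset.card_le_card ?_)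
    intro p hp
    rw [Finset.mem_union, List.mem_toFinset] at hp
    rcases hp with hp | hp
    · exact Finset.mem_filter.2 ⟨Finset.mem_univ _, (Finset.mem_filter.1 hp).2.1⟩
    · exact Finset.mem_filter.2 ⟨Finset.mem_univ _, hq2.sub p hp⟩
  · intro u v
    rw [h5]
    simp only [hmem, removeCls]
    by_cases h1 : Cls E x y u v <;> by_cases h2 : Cls E x y v u <;> simp [h1, h2]
  · intro u v
    rw [hs3.arr 6 (by decide), Store.setVar_arr]
    have := hq2.arcs u v
    simp only [hmem] at this
    by_cases h9 : Cls E x y u v ∨ P u v <;> simpa only [h9, if_true, if_false] using this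

/-- What is left to be oriented is a comparability graph, and each of its transitive orientations
extends the orientation `P` found so far to one of `E₀`. -/
structure Extends (E₀ E P : Fin n → Fin n → Prop) : Prop where
  symm : ∀ {u v}, E u v → E v u
  exists_isTO : ∃ F, IsTO E F
  isTO : ∀ F, IsTO E F → IsTO E₀ fun u v => P u v ∨ F u v

theorem Extends.removeCls {E₀ : Fin n → Fin n → Prop} (h : Extends E₀ E P) {x y : Fin n}
    (hxy : E x y) : Extends E₀ (removeCls E x y) (fun u v => Cls E x y u v ∨ P u v) := by
  obtain ⟨F, hF⟩ := h.exists_isTO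
  refine ⟨removeCls_symm h.symm, exists_isTO_removeCls h.symm hF hxy, fun F' hF' => ?_⟩
  have := h.isTO _ (hF.union_cls h.symm hxy hF')
  simpa only [or_assoc, or_left_comm] using this

theorem runs_orient_row (hw : 4 * (n * n) + 16 * n + 16 < 2 ^ w) (hn : σ.var 0 = n)
    {E₀ : Fin n → Fin n → Prop} (h : GraphState E P σ) (he : Extends E₀ E P) {x : Fin n}
    (hx : σ.var 4 = x)
    (hQ : ∀ σ' t E' P', GraphState E' P' σ' → Extends E₀ E' P' → (∀ u v, E' u v → E u v) →
      (∀ v, ¬ E' x v) →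
      t + (n * 128 + 70) * arcCount E' ≤ (n * 128 + 70) * arcCount E + n * 100 + 6 → Q σ' t) :
    Runs w (loop 5 (.ite (.eq (.get 5 (ix 4 5)) (.const 1)) orientClass noop)) σ Q := by
  classical
  refine .loop hn (by omega) (by decide) (by decide)
    (fun j σ' t => ∃ E' P', GraphState E' P' σ' ∧ Extends E₀ E' P' ∧ (∀ u v, E' u v → E u v) ∧
      (∀ v : Fin n, (v : ℕ) < j → ¬ E' x v) ∧
      t + (n * 128 + 70) * arcCount E' ≤ (n * 128 + 70) * arcCount E + j * 100)
    (fun j σ' k t h => h) ⟨E, P, h, he, fun _ _ h => h, fun v hv => absurd hv (Nat.not_lt_zero _),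
      by omega⟩ ?_ ?_
  · rintro y σ' t hy hs ⟨E', P', h1, h2, h3, h4, h5⟩
    have hn' : σ'.var 0 = n := (hs.var 0 (by decide)).trans hn
    have hx' : σ'.var 4 = x := (hs.var 4 (by decide)).trans hx
    have hg : (Expr.eq (.get 5 (ix 4 5)) (.const 1)).eval w σ' = if E' x y then 1 else 0 := by
      rw [eval_eq (eval_get (eval_ix x y (by omega) hn' hx' hy)) (eval_const (by omega)) (by omega),
        h1.1]
      split_ifs <;> simp_all
    refine .ite (fun hne => ?_) fun hne => .assign rfl ?_
    · rw [hg, ite_ne_zero] at hne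
      refine runs_orientClass hw hn' h1 hne hx' hy ?_
      intro σ'' s m hs' hm hgs
      refine ⟨_, _, hgs, h2.removeCls hne, fun u v huv => h3 u v huv.1, ?_, ?_⟩
      · intro v hv hxv
        rcases Nat.lt_succ_iff_lt_or_eq.1 hv with hv | hv
        · exact h4 v hv hxv.1
        · rw [Fin.ext hv] at hxv
          exact hxv.2.1 .base
      · have := Nat.mul_le_mul_left (n * 128 + 70) hm
        rw [mul_add, mul_comm _ m] at this
        simp only [Expr.cost, ix]
        omega
    · rw [hg, ite_eq_zero] at hne
      refine ⟨E', P', h1, h2, h3, ?_, ?_⟩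
      · intro v hv
        rcases Nat.lt_succ_iff_lt_or_eq.1 hv with hv | hv
        · exact h4 v hv
        · rwa [Fin.ext hv]
      · simp only [Expr.cost, ix]
        omega
  · rintro σ' t hs ⟨E', P', h1, h2, h3, h4, h5⟩
    exact hQ _ _ E' P' h1 h2 h3 (fun v => h4 v v.2) (by omega)

open Classical in
theorem runs_orient (hw : 4 * (n * n) + 16 * n + 16 < 2 ^ w) (hn : σ.var 0 = n)
    (h : GraphState E (fun _ _ => False) σ) (hs : ∀ {u v}, E u v → E v u) (hF : ∃ F, IsTO E F)
    (hQ : ∀ σ' t F, t ≤ (n * 128 + 70) * (n * n) + n * (n * 100 + 20) + 6 → IsTO E F →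
      (∀ u v : Fin n, σ'.arr 6 (u * n + v) = if F u v then 1 else 0) → Same orient σ σ' →
      Q σ' t) : Runs w orient σ Q := by
  refine .loop hn (by omega) (by decide) (by decide)
    (fun j σ' t => ∃ E' P', GraphState E' P' σ' ∧ Extends E E' P' ∧
      (∀ u v : Fin n, (u : ℕ) < j → ¬ E' u v) ∧
      t + (n * 128 + 70) * arcCount E' ≤ (n * 128 + 70) * arcCount E + j * (n * 100 + 20))
    (fun j σ' k t h => h) ⟨E, _, h, ⟨hs, hF, fun F hF => by simpa using hF⟩,
      fun u v hv => absurd hv (Nat.not_lt_zero _), by omega⟩ ?_ ?_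
  · rintro x σ' t hx hsame ⟨E', P', h1, h2, h4, h5⟩
    refine runs_orient_row hw ((hsame.var 0 (by decide)).trans hn) h1 h2 hx ?_
    intro σ'' s E'' P'' k1 k2 k3 k4 k5
    refine ⟨E'', P'', k1, k2, ?_, ?_⟩
    · intro u v hu huv
      rcases Nat.lt_succ_iff_lt_or_eq.1 hu with hu | hu
      · exact h4 u v hu (k3 u v huv)
      · rw [Fin.ext hu] at huv
        exact k4 v huv
    · have : (x + 1) * (n * 100 + 20) = x * (n * 100 + 20) + (n * 100 + 20) := by ring
      omega
  · rintro σ' t hsame ⟨E', P', h1, h2, h4, h5⟩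
    -- No edge is left, so the empty relation orients what is left.
    have hE' : IsTO E' fun _ _ => False :=
      ⟨False.elim, fun {u v} huv => absurd huv (h4 u v u.2), False.elim, fun h => h.elim⟩
    refine hQ _ _ P' ?_ (by simpa using h2.isTO _ hE') h1.2 hsame
    have := Nat.mul_le_mul_left (n * 128 + 70) (arcCount_le E)
    omega

theorem runs_initState {G : SimpleGraph (Fin n)} {v₀ : Fin n}
    (hw : 4 * (n * n) + 16 * n + 16 < 2 ^ w)
    (hQ : ∀ σ' t, t ≤ n * (n * 30 + 20) + 6 → GraphState (nonAdj G) (fun _ _ => False) σ' →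
      Same initState (inputStore G v₀) σ' → Q σ' t) :
    Runs w initState (inputStore G v₀) Q := by
  classical
  have hadj : ∀ u v : Fin n, (inputStore G v₀).arr 0 (u * n + v) = if G.Adj u v then 1 else 0 := by
    intro u v
    simp only [inputStore, true_and]
    congr 1
    rw [eq_iff_iff]
    constructor
    · rintro ⟨u', v', h1, h2⟩
      rw [index_inj] at h1
      rwa [h1.1, h1.2]
    · exact fun h => ⟨u, v, rfl, h⟩
  refine .loop_const (n := n) (T := n * 30 + 10) (by simp [inputStore]) (by omega) (by decide)
    (by decide) (fun j σ' => ∀ u v : Fin n, (u : ℕ) < j → σ'.arr 5 (u * n + v) =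
      if nonAdj G u v then 1 else 0) (fun j σ' k h => h)
    (fun u v hu => absurd hu (Nat.not_lt_zero _)) ?_ ?_
  · rintro u σ' hu hs h
    refine .loop_const (n := n) (T := 20) ((hs.var 0 (by decide)).trans (by simp [inputStore]))
      (by omega) (by decide) (by decide) (fun j σ'' => ∀ u' v : Fin n, (u' : ℕ) < u ∨
        (u' = u ∧ (v : ℕ) < j) → σ''.arr 5 (u' * n + v) = if nonAdj G u' v then 1 else 0)
      (fun j σ' k h => h) ?_ ?_ ?_
    · rintro u' v (h1 | h1)
      · exact h u' v h1
      · exact absurd h1.2 (Nat.not_lt_zero _)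
    · rintro v σ'' hv hs' h'
      have hn : σ''.var 0 = n := (hs'.var 0 (by decide)).trans ((hs.var 0 (by decide)).trans
        (by simp [inputStore]))
      have hu' : σ''.var 4 = u := (hs'.var 4 (by decide)).trans hu
      have hix := eval_ix (n := n) (w := w) u v (by omega) hn hu' hv
      have harr : σ''.arr 0 (u * n + v) = if G.Adj u v then 1 else 0 := by
        rw [hs'.arr 0 (by decide), hs.arr 0 (by decide), hadj]
      have he : (Expr.eq (.add (.get 0 (ix 4 5)) (.eq (.var 4) (.var 5))) (.const 0)).eval w σ'' =
          if nonAdj G u v then 1 else 0 := by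
        rw [eval_eq (eval_add ((eval_get hix).trans harr)
          (eval_eq (eval_var hu') (eval_var hv) (by omega)) (by split_ifs <;> omega))
          (eval_const (by omega)) (by omega)]
        by_cases h1 : G.Adj u v <;> by_cases h2 : u = v <;> simp [nonAdj, h1, h2, Fin.val_inj]
      refine .store hix he ⟨by simp [Expr.cost, ix], ?_⟩
      intro u' v' h1
      rw [Store.setArr_arr]
      simp only [true_and, index_inj]
      by_cases h2 : u' = u ∧ v' = v
      · rw [if_pos h2, h2.1, h2.2]
      · rw [if_neg h2]
        refine h' u' v' (h1.imp_right fun h3 => ⟨h3.1, ?_⟩)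
        exact lt_of_le_of_ne (Nat.lt_succ_iff.1 h3.2) fun h4 => h2 ⟨h3.1, Fin.ext h4⟩
    · intro σ'' t hs' ht h'
      refine ⟨by omega, fun u' v hu' => h' u' v ?_⟩
      rcases Nat.lt_succ_iff_lt_or_eq.1 hu' with h1 | h1
      · exact .inl h1
      · exact .inr ⟨Fin.ext h1, v.2⟩
  · intro σ' t hs ht h
    refine hQ σ' t (by linarith) ⟨fun u v => ?_, fun u v => ?_⟩ hs
    · rw [h u v u.2]
    · rw [hs.arr 6 (by decide)]
      simp [inputStore]

end Orient

/-! ### Tables -/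

section Tables

variable {n w : ℕ} {σ : Store} {Q : Store → ℕ → Prop}

/-- A table of counts: the entry for `v` is the value of `g` when the variable `s` holds the number
of all `i` for which `e` is true. -/
def tabulateCount (v a i s : ℕ) (e g : Expr) : Cmd := tabulate v a (count i s e) g

theorem runs_tabulateCount {v a i s : ℕ} {e g : Expr} (P : Fin n → Fin n → Prop)
    [∀ u, DecidablePred (P u)] (f : Fin n → ℕ) (hn : σ.var 0 = n) (hw : n < 2 ^ w)
    (hv : v ≠ i ∧ v ≠ s ∧ i ≠ s) (h0 : v ≠ 0 ∧ i ≠ 0 ∧ s ≠ 0)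
    (he : ∀ (u j : Fin n) (σ' : Store), σ'.var v = u → σ'.var i = j → σ'.var 0 = n →
      Same (tabulateCount v a i s e g) σ σ' → e.eval w σ' = if P u j then 1 else 0)
    (hg : ∀ (u : Fin n) (σ' : Store), σ'.var v = u → σ'.var 0 = n →
      σ'.var s = (Finset.univ.filter (P u)).card →
      Same (tabulateCount v a i s e g) σ σ' → g.eval w σ' = f u)
    (hQ : ∀ (σ' : Store) (t : ℕ), Same (tabulateCount v a i s e g) σ σ' →
      t ≤ n * (n * (e.cost + 11) + 8 + g.cost + 10) + 6 →
      (∀ u : Fin n, σ'.arr a u = f u) → Q σ' t) :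
    Runs w (tabulateCount v a i s e g) σ Q := by
  have hvars : (count i s e).vars = [s, i, s, i] := rfl
  have htab : (tabulate v a (count i s e) g).vars = [v, s, i, s, i, v] := rfl
  refine Runs.tabulate (T := n * (e.cost + 11) + 8) f hn hw ?_ ?_ ?_ ?_ hQ
  · simp [hvars, hv.1, hv.2.1]
  · simp [htab, h0.1.symm, h0.2.1.symm, h0.2.2.symm]
  · exact List.not_mem_nil
  · intro u σ' hu hs
    have hn' : σ'.var 0 = n := (hs.var 0 (by
      simp [htab, h0.1.symm, h0.2.1.symm, h0.2.2.symm])).trans hn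
    have hmono : ∀ {σ''}, Same (count i s e) σ' σ'' →
        Same (tabulateCount v a i s e g) σ σ'' ∧ σ''.var v = u ∧ σ''.var 0 = n := by
      intro σ'' h
      refine ⟨hs.trans (h.mono ?_ ?_), (h.var v ?_).trans hu, (h.var 0 ?_).trans hn'⟩
      · rw [hvars]
        intro x hx
        simp only [htab]
        simp only [List.mem_cons, List.not_mem_nil, or_false] at hx ⊢
        tauto
      · exact fun x hx => absurd hx List.not_mem_nil
      · simp [hvars, hv.1, hv.2.1]
      · simp [hvars, h0.2.1.symm, h0.2.2.symm]
    refine Runs.count (P u) hn' hw hv.2.2 h0.2.1 h0.2.2 ?_ ?_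
    · intro j σ'' hj h
      exact he u j σ'' (hmono h).2.1 hj (hmono h).2.2 (hmono h).1
    · intro σ'' t h ht hcard
      exact ⟨ht, hg u σ'' (hmono h).2.1 (hmono h).2.2 hcard (hmono h).1⟩

/-- Computes the ends of the intervals of `rankRealization` (arrays `2` and `3`) from the matrix
`6` of a transitive orientation; the array `9` holds the numbers of predecessors. -/
def computeEnds : Cmd :=
  .seq (tabulateCount 4 9 6 12 (.get 6 (ix 6 4)) (.var 12)) <|
  .seq (tabulateCount 4 2 6 12 (.lt (.get 9 (.var 6)) (.get 9 (.var 4)))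
    (.add (.add (.mul (.mul (.const 2) (.var 0)) (.var 12)) (.var 0)) (.var 4))) <|
  tabulateCount 4 3 6 12 (.eq (.get 6 (ix 4 6)) (.const 0))
    (.add (.mul (.mul (.const 2) (.var 0)) (.var 12)) (.var 4))

open Classical in
theorem runs_computeEnds (hw : 4 * (n * n) + 16 * n + 16 < 2 ^ w) (hn : σ.var 0 = n)
    {F : Fin n → Fin n → Prop}
    (hF : ∀ u v : Fin n, σ.arr 6 (u * n + v) = if F u v then 1 else 0)
    (hQ : ∀ σ' t, t ≤ n * (n * 60 + 120) + 18 →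
      (∀ v : Fin n, σ'.arr 2 v = 2 * n * leftRank F v + n + v) →
      (∀ v : Fin n, σ'.arr 3 v = 2 * n * rightRank F v + v) → Same computeEnds σ σ' → Q σ' t) :
    Runs w computeEnds σ Q := by
  have hmul : ∀ k ≤ n, 2 * n * k ≤ 2 * (n * n) := fun k hk => by
    rw [mul_assoc]
    exact Nat.mul_le_mul_left 2 (Nat.mul_le_mul_left n hk)
  refine Runs.mono_same (Q := fun σ' t => t ≤ n * (n * 60 + 120) + 18 ∧
      (∀ v : Fin n, σ'.arr 2 v = 2 * n * leftRank F v + n + v) ∧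
      (∀ v : Fin n, σ'.arr 3 v = 2 * n * rightRank F v + v)) ?_
    (fun σ' t hs h => hQ σ' t h.1 h.2.1 h.2.2 hs)
  refine .seq (runs_tabulateCount (n := n) (fun v u => F u v) (fun v => predCount F v) hn (by omega)
    (by decide) (by decide) ?_ ?_ ?_)
  · intro v u σ' hv hu hn' hs
    rw [eval_get (eval_ix u v (by omega) hn' hu hv), hs.arr 6 (by decide), hF]
  · intro v σ' _ _ h _
    exact h
  intro σ₁ t₁ hs1 ht1 h1
  have hn1 : σ₁.var 0 = n := (hs1.var 0 (by decide)).trans hn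
  refine .seq (runs_tabulateCount (n := n) (fun v u => predCount F u < predCount F v)
    (fun v => 2 * n * leftRank F v + n + v) hn1 (by omega) (by decide) (by decide) ?_ ?_ ?_)
  · intro v u σ' hv hu hn' hs
    rw [eval_lt (eval_get (eval_var hu)) (eval_get (eval_var hv)) (by omega), hs.arr 9 (by decide),
      h1, h1]
  · intro v σ' hv hn' h _
    have h2 := leftRank_le F v
    rw [Fintype.card_fin] at h2
    have h3 := hmul _ h2
    have h4 : σ'.var 12 = leftRank F v := h.trans (by unfold leftRank; congr)
    have h5 := v.2
    exact eval_add (eval_add (eval_mul (eval_mul (eval_const (by omega)) (eval_var hn') (by omega))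
      (eval_var h4) (by omega)) (eval_var hn') (by omega)) (eval_var hv) (by omega)
  intro σ₂ t₂ hs2 ht2 h2
  have hn2 : σ₂.var 0 = n := (hs2.var 0 (by decide)).trans hn1
  refine runs_tabulateCount (n := n) (fun v u => ¬ F v u)
    (fun v => 2 * n * rightRank F v + v) hn2 (by omega) (by decide) (by decide) ?_ ?_ ?_
  · intro v u σ' hv hu hn' hs
    rw [eval_eq (eval_get (eval_ix v u (by omega) hn' hv hu)) (eval_const (by omega)) (by omega),
      hs.arr 6 (by decide), hs2.arr 6 (by decide), hs1.arr 6 (by decide), hF]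
    by_cases hvu : F v u <;> simp [hvu]
  · intro v σ' hv hn' h _
    have h2 := rightRank_le F v
    rw [Fintype.card_fin] at h2
    have h3 := hmul _ h2
    have h4 : σ'.var 12 = rightRank F v := h.trans (by unfold rightRank; congr)
    have h5 := v.2
    exact eval_add (eval_mul (eval_mul (eval_const (by omega)) (eval_var hn') (by omega))
      (eval_var h4) (by omega)) (eval_var hv) (by omega)
  intro σ₃ t₃ hs3 ht3 h3
  refine ⟨?_, fun v => by rw [hs3.arr 2 (by decide), h2], h3⟩
  simp only [Expr.cost, ix] at ht1 ht2 ht3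
  ring_nf at ht1 ht2 ht3 ⊢
  omega

variable {G : SimpleGraph (Fin n)} {I : Realization G} {v₀ : Fin n}

/-- The arrays `2` and `3` hold the ends of the intervals. -/
def HasEnds (I : Realization G) (σ : Store) : Prop :=
  ∀ v : Fin n, I.l v = (σ.arr 2 v : ℝ) ∧ I.r v = (σ.arr 3 v : ℝ)

theorem HasEnds.same (h : HasEnds I σ) {σ' : Store} (h2 : σ'.arr 2 = σ.arr 2)
    (h3 : σ'.arr 3 = σ.arr 3) : HasEnds I σ' := by
  unfold HasEnds
  rw [h2, h3]
  exact h

theorem HasEnds.left_lt_left (h : HasEnds I σ) {u v : Fin n} :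
    σ.arr 2 u < σ.arr 2 v ↔ I.l u < I.l v := by
  rw [(h u).1, (h v).1, Nat.cast_lt]

theorem HasEnds.left_lt_right (h : HasEnds I σ) {u v : Fin n} :
    σ.arr 2 u < σ.arr 3 v ↔ I.l u < I.r v := by
  rw [(h u).1, (h v).2, Nat.cast_lt]

theorem HasEnds.right_lt_left (h : HasEnds I σ) {u v : Fin n} :
    σ.arr 3 u < σ.arr 2 v ↔ I.r u < I.l v := by
  rw [(h u).2, (h v).1, Nat.cast_lt]

theorem HasEnds.right_lt_right (h : HasEnds I σ) {u v : Fin n} :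
    σ.arr 3 u < σ.arr 3 v ↔ I.r u < I.r v := by
  rw [(h u).2, (h v).2, Nat.cast_lt]

/-- `end k of x < end k' of y`, where `k`, `k'` are the numbers of the arrays of the ends. -/
def endLt (k x k' y : ℕ) : Expr := .lt (.get k (.var x)) (.get k' (.var y))

theorem eval_endLt {k x k' y : ℕ} {u v : ℕ} (hw : 1 < 2 ^ w) (hx : σ.var x = u)
    (hy : σ.var y = v) : (endLt k x k' y).eval w σ = if σ.arr k u < σ.arr k' v then 1 else 0 :=
  eval_lt (eval_get (eval_var hx)) (eval_get (eval_var hy)) hw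

/-- The expression for `I(x) ⊏ I(y)`. -/
def insideExpr (x y : ℕ) : Expr := .mul (endLt 2 y 2 x) (endLt 3 x 3 y)

open Classical in
theorem eval_insideExpr {x y : ℕ} {u v : Fin n} (hw : 1 < 2 ^ w) (h : HasEnds I σ)
    (hx : σ.var x = u) (hy : σ.var y = v) :
    (insideExpr x y).eval w σ = if I.Inside u v then 1 else 0 := by
  exact (eval_and (eval_endLt hw hy hx) (eval_endLt hw hx hy) hw).trans
    (if_congr (and_congr h.left_lt_left h.right_lt_right) rfl rfl)

/-- The expression for `I(x) ∩_D I(y)`. -/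
def meetsExpr : Side → ℕ → ℕ → Expr
  | .left, x, y => .mul (endLt 2 x 2 y) (.mul (endLt 2 y 3 x) (endLt 3 x 3 y))
  | .right, x, y => .mul (endLt 3 y 3 x) (.mul (endLt 2 y 2 x) (endLt 2 x 3 y))

open Classical in
theorem eval_meetsExpr {D : Side} {x y : ℕ} {u v : Fin n} (hw : 1 < 2 ^ w) (h : HasEnds I σ)
    (hx : σ.var x = u) (hy : σ.var y = v) :
    (meetsExpr D x y).eval w σ = if I.Meets D u v then 1 else 0 := by
  cases D
  · exact (eval_and (eval_endLt hw hx hy) (eval_and (eval_endLt hw hy hx)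
      (eval_endLt hw hx hy) hw) hw).trans (if_congr (and_congr h.left_lt_left
        (and_congr h.left_lt_right h.right_lt_right)) rfl rfl)
  · exact (eval_and (eval_endLt hw hy hx) (eval_and (eval_endLt hw hy hx)
      (eval_endLt hw hx hy) hw) hw).trans (if_congr (and_congr h.right_lt_right
        (and_congr h.left_lt_left h.left_lt_right)) rfl rfl)

/-- The expression for "`x` reaches farther to the side `D` than `y`". -/
def fartherExpr : Side → ℕ → ℕ → Expr
  | .left, x, y => endLt 2 x 2 y
  | .right, x, y => endLt 3 y 3 x

open Classical in
theorem eval_fartherExpr {D : Side} {x y : ℕ} {u v : Fin n} (hw : 1 < 2 ^ w) (h : HasEnds I σ)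
    (hx : σ.var x = u) (hy : σ.var y = v) :
    (fartherExpr D x y).eval w σ = if I.reach D v < I.reach D u then 1 else 0 := by
  cases D
  · exact (eval_endLt hw hx hy).trans
      (if_congr (h.left_lt_left.trans neg_lt_neg_iff.symm) rfl rfl)
  · exact (eval_endLt hw hy hx).trans (if_congr h.right_lt_right rfl rfl)

/-! ### Positions, cores and successors -/

/-- Puts the index of the region of the node in the variable `4` into the variable `12`. -/
def regionCmd : Cmd :=
  .ite (.eq (.var 4) (.var 1)) (.assign 12 (.const 4)) <|
  .ite (endLt 3 4 2 1) (.assign 12 (.const 0)) <|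
  .ite (endLt 3 1 2 4) (.assign 12 (.const 6)) <|
  .ite (endLt 2 4 2 1)
    (.ite (endLt 3 4 3 1) (.assign 12 (.const 1)) (.assign 12 (.const 3)))
    (.ite (endLt 3 4 3 1) (.assign 12 (.const 2)) (.assign 12 (.const 5)))

theorem runs_regionCmd (hw : 8 < 2 ^ w) (h : HasEnds I σ) {v : Fin n} (h1 : σ.var 1 = v₀)
    (h4 : σ.var 4 = v) :
    Runs w regionCmd σ fun σ' t => t ≤ 40 ∧ σ'.var 12 = I.regionIndex v₀ v := by
  have hw1 : 1 < 2 ^ w := by omega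
  have c0 : (Expr.eq (.var 4) (.var 1)).eval w σ = if (v : ℕ) = v₀ then 1 else 0 :=
    eval_eq (eval_var h4) (eval_var h1) hw1
  have c1 := eval_endLt (k := 3) (k' := 2) hw1 h4 h1
  have c2 := eval_endLt (k := 3) (k' := 2) hw1 h1 h4
  have c3 := eval_endLt (k := 2) (k' := 2) hw1 h4 h1
  have c4 := eval_endLt (k := 3) (k' := 3) hw1 h4 h1
  have e : ∀ {k : ℕ}, k < 8 → ∀ σ', (Expr.const k).eval w σ' = k := fun hk σ' =>
    eval_const (by omega)
  unfold Realization.regionIndex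
  refine .ite (fun g => ?_) fun g => .ite (fun g1 => ?_) fun g1 => .ite (fun g2 => ?_) fun g2 =>
    .ite (fun g3 => .ite (fun g4 => ?_) fun g4 => ?_)
      fun g3 => .ite (fun g4 => ?_) fun g4 => ?_
  all_goals
    refine .assign (e (by decide) _) ⟨by simp [Expr.cost, endLt], ?_⟩
    simp only [c0, ne_eq, ite_eq_zero, not_not, ← Fin.ext_iff] at g
    try simp only [c1, ne_eq, ite_eq_zero, not_not, h.right_lt_left] at g1
    try simp only [c2, ne_eq, ite_eq_zero, not_not, h.right_lt_left] at g2
    try simp only [c3, ne_eq, ite_eq_zero, not_not, h.left_lt_left] at g3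
    try simp only [c4, ne_eq, ite_eq_zero, not_not, h.right_lt_right] at g4
    simp [*]

/-- Puts the successor of the node in the variable `4` in the expansion to the side `D` into the
variable `12`, or the number `n` if there is none. -/
def nextCmd (D : Side) : Cmd :=
  .seq (.assign 12 (.var 0)) <| loop 6 <|
    .ite (meetsExpr D 6 4)
      (.ite (.eq (.var 12) (.var 0)) (.assign 12 (.var 6))
        (.ite (fartherExpr D 6 12) (.assign 12 (.var 6)) noop)) noop

/-- The successor of `v` as a number, where `n` stands for "none". -/
def nextIndex (I : Realization G) (D : Side) (v : Fin n) : ℕ :=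
  (I.next D v).elim n (fun u => (u : ℕ))

theorem cost_meetsExpr_le (D : Side) (x y : ℕ) : (meetsExpr D x y).cost ≤ 20 := by
  cases D <;> simp [meetsExpr, endLt, Expr.cost]

theorem cost_fartherExpr_le (D : Side) (x y : ℕ) : (fartherExpr D x y).cost ≤ 6 := by
  cases D <;> simp [fartherExpr, endLt, Expr.cost]

theorem runs_nextCmd (hw : n + 8 < 2 ^ w) (hn : σ.var 0 = n) (hI : I.DistinctEnds)
    (h : HasEnds I σ) {D : Side} {v : Fin n} (h4 : σ.var 4 = v) :
    Runs w (nextCmd D) σ fun σ' t => t ≤ n * 60 + 8 ∧ σ'.var 12 = nextIndex I D v := by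
  classical
  have hw1 : 1 < 2 ^ w := by omega
  refine .seq (.assign (eval_var hn) ?_)
  refine .loop_const (n := n) (T := 52) (by simpa using hn) (by omega)
    (by cases D <;> decide) (by cases D <;> decide)
    (fun j σ' => (σ'.var 12 = n ∧ ∀ u : Fin n, (u : ℕ) < j → ¬ I.Meets D u v) ∨
      ∃ x : Fin n, σ'.var 12 = x ∧ I.Meets D x v ∧
        ∀ u : Fin n, (u : ℕ) < j → I.Meets D u v → I.reach D u ≤ I.reach D x)
    (fun j σ' k h => by simpa using h)
    (.inl ⟨by simp, fun u hu => absurd hu (Nat.not_lt_zero _)⟩) ?_ ?_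
  · intro j σ' hj hs hinv
    have hn' : σ'.var 0 = n := (hs.var 0 (by cases D <;> decide)).trans (by simpa using hn)
    have h4' : σ'.var 4 = v := (hs.var 4 (by cases D <;> decide)).trans (by simpa using h4)
    have h' : HasEnds I σ' := h.same (hs.arr 2 (by cases D <;> decide))
      (hs.arr 3 (by cases D <;> decide))
    have c1 := cost_meetsExpr_le D 6 4
    have c2 := cost_fartherExpr_le D 6 12
    have step : ∀ u : Fin n, (u : ℕ) < j + 1 ↔ (u : ℕ) < j ∨ u = j := fun u => by
      rw [Nat.lt_succ_iff_lt_or_eq, Fin.ext_iff]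
    refine .ite (fun g => .ite (fun g1 => .assign hj ?_) fun g1 => .ite (fun g2 => .assign hj ?_)
      fun g2 => .assign rfl ?_) fun g => .assign rfl ?_
    all_goals
      refine ⟨by simp only [Expr.cost]; omega, ?_⟩
      rw [eval_meetsExpr hw1 h' hj h4'] at g
      simp only [ne_eq, ite_eq_zero, not_not] at g
      try rw [eval_eq (eval_var rfl) (eval_var hn') hw1] at g1
      try simp only [ne_eq, ite_eq_zero, not_not] at g1
    · right
      refine ⟨j, by simp, g, fun u hu hm => ?_⟩
      rcases (step u).1 hu with hu | rfl
      · rcases hinv with ⟨-, hinv⟩ | ⟨x, hx, -⟩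
        · exact absurd hm (hinv u hu)
        · have := x.2
          omega
      · exact le_rfl
    · obtain ⟨x, hx, hm, hmax⟩ := hinv.resolve_left fun h => g1 h.1
      rw [eval_fartherExpr hw1 h' hj hx] at g2
      simp only [ne_eq, ite_eq_zero, not_not] at g2
      right
      refine ⟨j, by simp, g, fun u hu hm => ?_⟩
      rcases (step u).1 hu with hu | rfl
      · exact (hmax u hu hm).trans g2.le
      · exact le_rfl
    · obtain ⟨x, hx, hm, hmax⟩ := hinv.resolve_left fun h => g1 h.1
      rw [eval_fartherExpr hw1 h' hj hx] at g2
      simp only [ite_eq_zero] at g2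
      right
      refine ⟨x, by simpa using hx, hm, fun u hu hm => ?_⟩
      rcases (step u).1 hu with hu | rfl
      · exact hmax u hu hm
      · exact not_lt.1 g2
    · rcases hinv with ⟨hx, hinv⟩ | ⟨x, hx, hm, hmax⟩
      · refine .inl ⟨by simpa using hx, fun u hu => ?_⟩
        rcases (step u).1 hu with hu | rfl
        · exact hinv u hu
        · exact g
      · refine .inr ⟨x, by simpa using hx, hm, fun u hu hm => ?_⟩
        rcases (step u).1 hu with hu | rfl
        · exact hmax u hu hm
        · exact absurd hm g
  · rintro σ' t hs ht hinv
    refine ⟨by simp only [Expr.cost]; omega, ?_⟩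
    unfold nextIndex
    rcases hinv with ⟨hx, hinv⟩ | ⟨x, hx, hm, hmax⟩
    · rw [I.next_eq_none.2 fun u => hinv u u.2]
      exact hx
    · rw [I.next_eq_some hI hm fun u hu => hmax u u.2 hu]
      exact hx

/-- Computes the positions of the nodes (array `4`), the numbers of intervals to the left and to
the right of an interval (arrays `12` and `13`), the successors in the expansions (arrays `14` and
`15`) and the bases (array `16`). -/
def computeTables : Cmd :=
  .seq (tabulate 4 4 regionCmd (.var 12)) <|
  .seq (tabulateCount 4 12 6 12 (endLt 3 6 2 4) (.var 12)) <|
  .seq (tabulateCount 4 13 6 12 (endLt 3 4 2 6) (.var 12)) <|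
  .seq (tabulate 4 14 (nextCmd .left) (.var 12)) <|
  .seq (tabulate 4 15 (nextCmd .right) (.var 12)) <|
  tabulateCount 4 16 6 12 (.mul (insideExpr 1 6) (insideExpr 4 6))
    (.lt (.const 0) (.add (.eq (.var 4) (.var 1))
      (.mul (insideExpr 1 4) (.eq (.var 12) (.const 0)))))

open Classical in
/-- The number of intervals that lie strictly to the left of the interval of `v`. -/
def leftCount (I : Realization G) (v : Fin n) : ℕ :=
  (Finset.univ.filter fun u => I.r u < I.l v).card

open Classical in
/-- The number of intervals that lie strictly to the right of the interval of `v`. -/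
def rightCount (I : Realization G) (v : Fin n) : ℕ :=
  (Finset.univ.filter fun u => I.r v < I.l u).card

open Classical in
/-- The tables on which the search relies, together with the input `n`, `v₀`. -/
structure HasTables (I : Realization G) (v₀ : Fin n) (σ : Store) : Prop where
  size : σ.var 0 = n
  root : σ.var 1 = v₀
  leftCount : ∀ v : Fin n, σ.arr 12 v = leftCount I v
  rightCount : ∀ v : Fin n, σ.arr 13 v = rightCount I v
  nextLeft : ∀ v : Fin n, σ.arr 14 v = nextIndex I .left v
  nextRight : ∀ v : Fin n, σ.arr 15 v = nextIndex I .right v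
  base : ∀ v : Fin n, σ.arr 16 v = if v ∈ I.bases v₀ then 1 else 0

theorem runs_computeTables (hw : 4 * (n * n) + 16 * n + 16 < 2 ^ w) (hn : σ.var 0 = n)
    (h1 : σ.var 1 = v₀) (hI : I.DistinctEnds) (h : HasEnds I σ)
    (hQ : ∀ σ' t, t ≤ n * (n * 300 + 600) + 40 → HasTables I v₀ σ' →
      (∀ v : Fin n, σ'.arr 4 v = I.regionIndex v₀ v) → Same computeTables σ σ' → Q σ' t) :
    Runs w computeTables σ Q := by
  classical
  have hw1 : 1 < 2 ^ w := by omega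
  refine Runs.mono_same (Q := fun σ' t => t ≤ n * (n * 300 + 600) + 40 ∧ HasTables I v₀ σ' ∧
      ∀ v : Fin n, σ'.arr 4 v = I.regionIndex v₀ v) ?_
    (fun σ' t hs h => hQ σ' t h.1 h.2.1 h.2.2 hs)
  refine .seq (Runs.tabulate (n := n) (T := 40) (fun v => (I.regionIndex v₀ v : ℕ)) hn (by omega)
    (by decide) (by decide) (by decide) ?_ ?_)
  · intro v σ' hv hs
    exact runs_regionCmd (by omega) (h.same (hs.arr 2 (by decide)) (hs.arr 3 (by decide)))
      ((hs.var 1 (by decide)).trans h1) hv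
  intro σ₁ t₁ hs1 ht1 r1
  have hn1 : σ₁.var 0 = n := (hs1.var 0 (by decide)).trans hn
  have he1 : HasEnds I σ₁ := h.same (hs1.arr 2 (by decide)) (hs1.arr 3 (by decide))
  refine .seq (runs_tabulateCount (n := n) (fun v u => I.r u < I.l v) (fun v => leftCount I v) hn1
    (by omega) (by decide) (by decide) ?_ ?_ ?_)
  · intro v u σ' hv hu hn' hs
    exact (eval_endLt hw1 hu hv).trans (if_congr
      (he1.same (hs.arr 2 (by decide)) (hs.arr 3 (by decide))).right_lt_left rfl rfl)
  · intro v σ' hv hn' h _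
    exact h.trans (by unfold leftCount; congr)
  intro σ₂ t₂ hs2 ht2 r2
  have hn2 : σ₂.var 0 = n := (hs2.var 0 (by decide)).trans hn1
  have he2 : HasEnds I σ₂ := he1.same (hs2.arr 2 (by decide)) (hs2.arr 3 (by decide))
  refine .seq (runs_tabulateCount (n := n) (fun v u => I.r v < I.l u) (fun v => rightCount I v) hn2
    (by omega) (by decide) (by decide) ?_ ?_ ?_)
  · intro v u σ' hv hu hn' hs
    exact (eval_endLt hw1 hv hu).trans (if_congr
      (he2.same (hs.arr 2 (by decide)) (hs.arr 3 (by decide))).right_lt_left rfl rfl)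
  · intro v σ' hv hn' h _
    exact h.trans (by unfold rightCount; congr)
  intro σ₃ t₃ hs3 ht3 r3
  have hn3 : σ₃.var 0 = n := (hs3.var 0 (by decide)).trans hn2
  have he3 : HasEnds I σ₃ := he2.same (hs3.arr 2 (by decide)) (hs3.arr 3 (by decide))
  refine .seq (Runs.tabulate (n := n) (T := n * 60 + 8) (fun v => nextIndex I .left v) hn3
    (by omega) (by decide) (by decide) (by decide) ?_ ?_)
  · intro v σ' hv hs
    exact runs_nextCmd (by omega) ((hs.var 0 (by decide)).trans hn3) hI
      (he3.same (hs.arr 2 (by decide)) (hs.arr 3 (by decide))) hv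
  intro σ₄ t₄ hs4 ht4 r4
  have hn4 : σ₄.var 0 = n := (hs4.var 0 (by decide)).trans hn3
  have he4 : HasEnds I σ₄ := he3.same (hs4.arr 2 (by decide)) (hs4.arr 3 (by decide))
  refine .seq (Runs.tabulate (n := n) (T := n * 60 + 8) (fun v => nextIndex I .right v) hn4
    (by omega) (by decide) (by decide) (by decide) ?_ ?_)
  · intro v σ' hv hs
    exact runs_nextCmd (by omega) ((hs.var 0 (by decide)).trans hn4) hI
      (he4.same (hs.arr 2 (by decide)) (hs.arr 3 (by decide))) hv
  intro σ₅ t₅ hs5 ht5 r5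
  have hn5 : σ₅.var 0 = n := (hs5.var 0 (by decide)).trans hn4
  have he5 : HasEnds I σ₅ := he4.same (hs5.arr 2 (by decide)) (hs5.arr 3 (by decide))
  have h15 : σ₅.var 1 = v₀ := by
    rw [hs5.var 1 (by decide), hs4.var 1 (by decide), hs3.var 1 (by decide),
      hs2.var 1 (by decide), hs1.var 1 (by decide), h1]
  refine runs_tabulateCount (n := n) (fun c u => I.Inside v₀ u ∧ I.Inside c u)
    (fun c => if c ∈ I.bases v₀ then 1 else 0) hn5 (by omega) (by decide) (by decide) ?_ ?_ ?_
  · intro c u σ' hc hu hn' hs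
    have he' := he5.same (hs.arr 2 (by decide)) (hs.arr 3 (by decide))
    exact eval_and (eval_insideExpr hw1 he' ((hs.var 1 (by decide)).trans h15) hu)
      (eval_insideExpr hw1 he' hc hu) hw1
  · intro c σ' hc hn' hcard hs
    have he' := he5.same (hs.arr 2 (by decide)) (hs.arr 3 (by decide))
    have hv' : σ'.var 1 = v₀ := (hs.var 1 (by decide)).trans h15
    rw [eval_lt (eval_const (by omega)) (eval_add (eval_eq (eval_var hc) (eval_var hv') hw1)
      (eval_and (eval_insideExpr hw1 he' hv' hc)
        (eval_eq (eval_var hcard) (eval_const (by omega)) hw1) hw1)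
      (by split_ifs <;> omega)) hw1]
    have hiff : c ∈ I.bases v₀ ↔ c = v₀ ∨ (I.Inside v₀ c ∧
        (Finset.univ.filter fun u => I.Inside v₀ u ∧ I.Inside c u).card = 0) := by
      rw [I.mem_bases, I.mem_core, Finset.card_eq_zero,
        Finset.filter_eq_empty_iff]
      simp only [Finset.mem_univ, true_imp_iff, not_and]
    simp only [hiff, Fin.val_inj]
    by_cases b1 : c = v₀
    · simp [b1]
    · simp only [b1, if_false, false_or, zero_add]
      split_ifs <;> first | rfl | omega
  intro σ₆ t₆ hs6 ht6 r6
  refine ⟨?_, ⟨(hs6.var 0 (by decide)).trans hn5, (hs6.var 1 (by decide)).trans h15, ?_, ?_, ?_, ?_,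
    r6⟩, ?_⟩
  · simp only [Expr.cost, endLt, insideExpr] at ht1 ht2 ht3 ht4 ht5 ht6
    ring_nf at ht1 ht2 ht3 ht4 ht5 ht6 ⊢
    omega
  · intro v
    rw [hs6.arr 12 (by decide), hs5.arr 12 (by decide), hs4.arr 12 (by decide),
      hs3.arr 12 (by decide), r2]
  · intro v
    rw [hs6.arr 13 (by decide), hs5.arr 13 (by decide), hs4.arr 13 (by decide), r3]
  · intro v
    rw [hs6.arr 14 (by decide), hs5.arr 14 (by decide), r4]
  · intro v
    rw [hs6.arr 15 (by decide), r5]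
  · intro v
    rw [hs6.arr 4 (by decide), hs5.arr 4 (by decide), hs4.arr 4 (by decide),
      hs3.arr 4 (by decide), hs2.arr 4 (by decide), r1]

end Tables

/-! ### Walking along an expansion -/

section Walk

variable {V : Type*} [Fintype V] {G : SimpleGraph V}

namespace Realization

variable {I : Realization G} {D : Side} {c a b : V} {A Q : Finset V}

/-- The solutions of an expansion that are still to come, when `a` was added last and `Q` is the
current solution. -/
theorem Chain.expandFrom_eq_cons (h : I.Chain D c a Q) : ∃ L, I.expandFrom D a Q = Q :: L ∧
    ((I.next D a = none ∧ L = []) ∨ ∃ a' Q', I.next D a = some a' ∧ I.Chain D c a' Q' ∧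
      Q'.card = Q.card + 1 ∧ (∀ v, v ∈ Q' ↔ v = a' ∨ v ∈ Q) ∧ L = I.expandFrom D a' Q') := by
  classical
  rcases hn : I.next D a with _ | a'
  · exact ⟨[], I.expandFrom_none hn, .inl ⟨rfl, rfl⟩⟩
  · refine ⟨_, I.expandFrom_some hn, .inr ⟨a', _, rfl, h.step hn, ?_, fun v => ?_, rfl⟩⟩
    · exact Finset.card_insert_of_notMem (h.next_notMem hn)
    · exact Finset.mem_insert

/-- The solutions of an expansion that are still to come contain the current one. -/
theorem subset_of_mem_expandFrom (k : ℕ) : ∀ {a : V} {Q : Finset V}, I.ahead D a ≤ k →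
    I.Chain D c a Q → A ∈ I.expandFrom D a Q → Q ⊆ A := by
  induction k with
  | zero =>
    intro a Q hk h hA
    obtain ⟨L, h1, ⟨-, rfl⟩ | ⟨a', Q', h2, -⟩⟩ := h.expandFrom_eq_cons
    · rw [h1, List.mem_singleton] at hA
      exact hA.ge
    · have := I.ahead_lt h2
      omega
  | succ k ih =>
    intro a Q hk h hA
    obtain ⟨L, h1, ⟨-, rfl⟩ | ⟨a', Q', h2, h3, -, h4, rfl⟩⟩ := h.expandFrom_eq_cons
    · rw [h1, List.mem_singleton] at hA
      exact hA.ge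
    · rw [h1, List.mem_cons] at hA
      rcases hA with rfl | hA
      · exact subset_rfl
      · exact fun v hv => ih (by have := I.ahead_lt h2; omega) h3 hA ((h4 v).2 (.inr hv))

/-- A walk along the expansion recovers the solution `A` from the node `b` that was added last to
it: the walk has reached `A` if and only if it is at `b`. -/
theorem Chain.eq_or_next (hI : I.DistinctEnds) (h : I.Chain D c a Q) (hb : I.Chain D c b A)
    (hA : A ∈ I.expandFrom D a Q) : (a = b ∧ Q = A) ∨ (a ≠ b ∧ ∃ a' Q', I.next D a = some a' ∧
      I.Chain D c a' Q' ∧ (∀ v, v ∈ Q' ↔ v = a' ∨ v ∈ Q) ∧ A ∈ I.expandFrom D a' Q') := by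
  have heq : Q = A → a = b := by
    rintro rfl
    by_contra hne
    exact hI.reach_ne D hne (le_antisymm (hb.reach_le a h.mem_last) (h.reach_le b hb.mem_last))
  obtain ⟨L, h1, ⟨-, rfl⟩ | ⟨a', Q', h2, h3, -, h4, rfl⟩⟩ := h.expandFrom_eq_cons
  · rw [h1, List.mem_singleton] at hA
    exact .inl ⟨heq hA.symm, hA.symm⟩
  · rw [h1, List.mem_cons] at hA
    rcases hA with rfl | hA
    · exact .inl ⟨heq rfl, rfl⟩
    · refine .inr ⟨?_, a', Q', h2, h3, h4, hA⟩
      rintro rfl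
      exact (hb.reach_le a' (subset_of_mem_expandFrom _ le_rfl h3 hA h3.mem_last)).not_gt
        (I.reach_lt (I.meets_of_next h2))

theorem ahead_lt_card (I : Realization G) (D : Side) (v : V) : I.ahead D v < Fintype.card V := by
  classical
  refine Finset.card_lt_card (Finset.ssubset_iff_of_subset (Finset.subset_univ _) |>.2
    ⟨v, Finset.mem_univ v, ?_⟩)
  simp

end Realization

open Classical in
/-- The set of nodes that the candidate with the expansions `A` and `B` consists of. -/
def joined (v₀ c : V) (A B : Finset V) : Finset V := {v₀, c} ∪ A ∪ B

/-- What `Combine` makes of the pair `acc`, when the expansion to the left is `A` and the solutions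
`R` of the expansion to the right are still to be tried. -/
def tryRight (G : SimpleGraph V) (v₀ c : V) (A : Finset V) (R : List (Finset V))
    (acc : Finset V × ℚ) : Finset V × ℚ :=
  R.foldl (fun acc B => improve G acc (joined v₀ c A B)) acc

/-- What `Combine` makes of the pair `acc`, when the solutions `L` of the expansion to the left are
still to be tried. -/
def tryLeft (I : Realization G) (v₀ c : V) (L : List (Finset V)) (acc : Finset V × ℚ) :
    Finset V × ℚ :=
  L.foldl (fun acc A => tryRight G v₀ c A (I.expand .right c) acc) acc

/-- The result of `Combine` for the base `c`. -/
def bestFor (I : Realization G) (v₀ c : V) : Finset V × ℚ :=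
  tryLeft I v₀ c (I.expand .left c) (joined v₀ c {c} {c}, ratio G (joined v₀ c {c} {c}))

theorem mem_sols_iff {I : Realization G} {v₀ : V} {p : Finset V × ℚ} :
    p ∈ sols I v₀ ↔ ∃ c ∈ I.bases v₀, p = bestFor I v₀ c := by
  classical
  have h : ∀ c, joined v₀ c {c} {c} = {v₀, c} := fun c => by
    ext v
    simp [joined]
  rw [I.mem_sols]
  unfold bestFor
  simp only [h]
  rfl

/-- The numbers `N`, `d` are the size of the neighbourhood and the size of a candidate for the base
`c`, the nodes `a`, `b` are the last ones of its two expansions, and `p` is the corresponding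
pair. -/
structure Records (I : Realization G) (v₀ c a b : V) (A B : Finset V) (p : Finset V × ℚ)
    (N d : ℕ) : Prop where
  candidate : I.Candidate v₀ c a b A B
  set_eq : p.1 = joined v₀ c A B
  value_eq : p.2 = ratio G p.1
  card_nbhd : N = (closedNbhd G p.1).card
  card_set : d = p.1.card

namespace Records

variable {I : Realization G} {v₀ c a b : V} {A B : Finset V} {p : Finset V × ℚ} {N d : ℕ}

theorem value (h : Records I v₀ c a b A B p N d) : p.2 = (N : ℚ) / d := by
  rw [h.value_eq, h.card_nbhd, h.card_set, ratio]

theorem mem_iff (h : Records I v₀ c a b A B p N d) {t : V} :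
    t ∈ p.1 ↔ t = v₀ ∨ t ∈ A ∨ t ∈ B := by
  rw [h.set_eq]
  exact h.candidate.mem_iff

theorem card_pos (h : Records I v₀ c a b A B p N d) : 0 < d := by
  rw [h.card_set]
  exact Finset.card_pos.2 ⟨v₀, h.mem_iff.2 (.inl rfl)⟩

theorem nbhd_pos (h : Records I v₀ c a b A B p N d) : 0 < N := by
  rw [h.card_nbhd]
  refine Finset.card_pos.2 ⟨v₀, ?_⟩
  simp [closedNbhd, h.mem_iff]

theorem card_le (h : Records I v₀ c a b A B p N d) : d ≤ Fintype.card V := by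
  rw [h.card_set]
  exact Finset.card_le_univ _

theorem nbhd_le (h : Records I v₀ c a b A B p N d) : N ≤ Fintype.card V := by
  rw [h.card_nbhd]
  exact Finset.card_le_univ _

/-- Ratios are compared by cross-multiplication. -/
theorem lt_iff (h : Records I v₀ c a b A B p N d) {c' a' b' : V} {A' B' : Finset V}
    {q : Finset V × ℚ} {N' d' : ℕ} (h' : Records I v₀ c' a' b' A' B' q N' d') :
    p.2 < q.2 ↔ N * d' < N' * d := by
  rw [h.value, h'.value, div_lt_div_iff₀ (by exact_mod_cast h.card_pos)
    (by exact_mod_cast h'.card_pos)]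
  norm_cast

end Records

open Classical in
/-- The pair that belongs to the expansions `A` and `B`. The node `c` is counted in both of them,
and `v₀` in none of them unless it is `c`. -/
theorem Realization.Candidate.records {I : Realization G} {v₀ c a b : V} {A B : Finset V}
    (h : I.Candidate v₀ c a b A B) {o : ℕ} (ho : (c = v₀ → o = 1) ∧ (c ≠ v₀ → o = 0)) :
    Records I v₀ c a b A B (joined v₀ c A B, ratio G (joined v₀ c A B))
      (Fintype.card V - (Finset.univ.filter fun u => I.r u < I.l a).card -
        (Finset.univ.filter fun u => I.r b < I.l u).card)
      (A.card + B.card - o) := by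
  refine ⟨h, rfl, rfl, h.card_closedNbhd.symm, Eq.trans ?_ h.card_eq.symm⟩
  split_ifs with hc
  · rw [ho.1 hc]
  · rw [ho.2 hc]

theorem improve_of_lt {acc : Finset V × ℚ} {T : Finset V} (h : acc.2 < ratio G T) :
    improve G acc T = (T, ratio G T) := if_pos h

theorem improve_of_not_lt {acc : Finset V × ℚ} {T : Finset V} (h : ¬ acc.2 < ratio G T) :
    improve G acc T = acc := if_neg h

end Walk

/-! ### Searching the candidates -/

section Search

variable {n w : ℕ} {σ : Store} {G : SimpleGraph (Fin n)} {I : Realization G} {v₀ c : Fin n}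

/-- The numbers of the arrays with the successors. -/
def nextArr : Side → ℕ
  | .left => 14
  | .right => 15

theorem HasTables.next (h : HasTables I v₀ σ) (D : Side) (v : Fin n) :
    σ.arr (nextArr D) v = nextIndex I D v := by
  cases D
  · exact h.nextLeft v
  · exact h.nextRight v

theorem HasTables.same (h : HasTables I v₀ σ) {d : Cmd} {σ' : Store} (hs : Same d σ σ')
    (hv : ∀ x ∈ [0, 1], x ∉ d.vars) (ha : ∀ a ∈ [12, 13, 14, 15, 16], a ∉ d.arrs) :
    HasTables I v₀ σ' where
  size := (hs.var 0 (hv 0 (by decide))).trans h.size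
  root := (hs.var 1 (hv 1 (by decide))).trans h.root
  leftCount v := by rw [hs.arr 12 (ha 12 (by decide)), h.leftCount]
  rightCount v := by rw [hs.arr 13 (ha 13 (by decide)), h.rightCount]
  nextLeft v := by rw [hs.arr 14 (ha 14 (by decide)), h.nextLeft]
  nextRight v := by rw [hs.arr 15 (ha 15 (by decide)), h.nextRight]
  base v := by rw [hs.arr 16 (ha 16 (by decide)), h.base]

/-- A bound on the number of steps that the expansion can still take at the node with index `x`. -/
def stepsFrom (I : Realization G) (D : Side) (x : ℕ) : ℕ :=
  if h : x < n then I.ahead D ⟨x, h⟩ + 1 else 0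

theorem stepsFrom_le (I : Realization G) (D : Side) (x : ℕ) : stepsFrom I D x ≤ n := by
  unfold stepsFrom
  split_ifs with h
  · have := I.ahead_lt_card D ⟨x, h⟩
    rwa [Fintype.card_fin] at this
  · exact Nat.zero_le n

theorem nextIndex_none {D : Side} {v : Fin n} (h : I.next D v = none) : nextIndex I D v = n := by
  rw [nextIndex, h]
  rfl

theorem nextIndex_some {D : Side} {v v' : Fin n} (h : I.next D v = some v') :
    nextIndex I D v = v' := by
  rw [nextIndex, h]
  rfl

theorem stepsFrom_next (I : Realization G) (D : Side) (v : Fin n) :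
    stepsFrom I D (nextIndex I D v) + 1 ≤ stepsFrom I D v := by
  rcases h : I.next D v with _ | v'
  · rw [nextIndex_none h]
    simp [stepsFrom]
  · rw [nextIndex_some h]
    have := I.ahead_lt h
    simp only [stepsFrom, Fin.is_lt, dif_pos, Fin.eta]
    omega

/-- In the expansion of `c`, the solutions `L` are still to come; the current one has `k` nodes, and
`x` is the node that was added last (or `n`, if the expansion has come to its end). -/
def Pending (I : Realization G) (D : Side) (c : Fin n) (x k : ℕ) (L : List (Finset (Fin n))) :
    Prop :=
  (x = n ∧ L = []) ∨
    ∃ (a : Fin n) (Q : Finset (Fin n)), x = a ∧ k = Q.card ∧ I.Chain D c a Q ∧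
      L = I.expandFrom D a Q

theorem pending_expand (I : Realization G) (D : Side) (c : Fin n) :
    Pending I D c c 1 (I.expand D c) :=
  .inr ⟨c, {c}, rfl, (Finset.card_singleton c).symm, .base, rfl⟩

theorem Pending.eq_cons {D : Side} {x k : ℕ} {L : List (Finset (Fin n))}
    (h : Pending I D c x k L) (hx : x < n) :
    ∃ (a : Fin n) (Q : Finset (Fin n)) (L' : List (Finset (Fin n))), x = a ∧ k = Q.card ∧
      I.Chain D c a Q ∧ L = Q :: L' ∧ Pending I D c (nextIndex I D a) (k + 1) L' := by
  obtain ⟨rfl, -⟩ | ⟨a, Q, rfl, rfl, h1, rfl⟩ := h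
  · exact absurd hx (lt_irrefl _)
  obtain ⟨L, h2, h3⟩ := h1.expandFrom_eq_cons
  refine ⟨a, Q, L, rfl, rfl, h1, h2, ?_⟩
  obtain ⟨h3, rfl⟩ | ⟨a', Q', h3, h4, h5, -, rfl⟩ := h3
  · exact .inl ⟨nextIndex_none h3, rfl⟩
  · exact .inr ⟨a', Q', nextIndex_some h3, h5.symm, h4, rfl⟩

theorem Pending.eq_nil {D : Side} {x k : ℕ} {L : List (Finset (Fin n))}
    (h : Pending I D c x k L) (hx : ¬ x < n) : L = [] := by
  obtain ⟨-, h⟩ | ⟨a, -, rfl, -⟩ := h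
  · exact h
  · exact absurd a.2 hx

/-- The pair `p` is stored by means of four numbers: the sizes `N`, `d` of its neighbourhood and its
set, and the last nodes `x`, `y` of its two expansions. -/
def Stored (I : Realization G) (v₀ c : Fin n) (p : Finset (Fin n) × ℚ) (N d x y : ℕ) : Prop :=
  ∃ (a b : Fin n) (A B : Finset (Fin n)), Records I v₀ c a b A B p N d ∧ x = a ∧ y = b

/-- The data of the current base `c`: besides the tables, the node itself (variable `4`) and the
correction for the number of nodes (variable `17`). -/
structure HasBase (I : Realization G) (v₀ c : Fin n) (σ : Store) : Prop extends
    HasTables I v₀ σ where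
  mem : c ∈ I.bases v₀
  node : σ.var 4 = c
  offset : (c = v₀ → σ.var 17 = 1) ∧ (c ≠ v₀ → σ.var 17 = 0)

theorem HasBase.same (h : HasBase I v₀ c σ) {d : Cmd} {σ' : Store} (hs : Same d σ σ')
    (hv : ∀ x ∈ [0, 1, 4, 17], x ∉ d.vars) (ha : d.arrs = []) : HasBase I v₀ c σ' where
  toHasTables := h.toHasTables.same hs (fun x hx => hv x (by
    simp only [List.mem_cons, List.not_mem_nil, or_false] at hx ⊢
    tauto)) (fun a _ => by simp [ha])
  mem := h.mem
  node := (hs.var 4 (hv 4 (by decide))).trans h.node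
  offset := by
    rw [hs.var 17 (hv 17 (by decide))]
    exact h.offset

theorem HasBase.setVar (h : HasBase I v₀ c σ) {x : ℕ} (k : ℕ) (hx : x ∉ [0, 1, 4, 17]) :
    HasBase I v₀ c (σ.setVar x k) := by
  refine h.same (d := .assign x (.const 0)) ⟨fun y hy => ?_, fun _ _ => rfl⟩ ?_ rfl
  · rw [Store.setVar_var, if_neg (by simpa [Cmd.vars] using hy)]
  · intro y hy h1
    rw [List.mem_singleton.1 h1] at hy
    exact hx hy

/-- Compares the candidate with the last nodes in the variables `22`, `24` and the sizes of its
expansions in the variables `23`, `25` with the one stored in the variables `18`, `19`, `20`, `21`,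
and stores it there if its ratio is greater. -/
def tryCmd : Cmd :=
  .seq (.assign 26 (.sub (.sub (.var 0) (.get 12 (.var 22))) (.get 13 (.var 24)))) <|
  .seq (.assign 27 (.sub (.add (.var 23) (.var 25)) (.var 17))) <|
  .ite (.lt (.mul (.var 18) (.var 27)) (.mul (.var 26) (.var 19)))
    (.seq (.assign 18 (.var 26)) <| .seq (.assign 19 (.var 27)) <|
      .seq (.assign 20 (.var 22)) (.assign 21 (.var 24))) noop

theorem runs_tryCmd (hw : 4 * (n * n) + 16 * n + 16 < 2 ^ w) (h : HasBase I v₀ c σ)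
    {a b : Fin n} {A B : Finset (Fin n)} (hA : I.Chain .left c a A) (hB : I.Chain .right c b B)
    (h22 : σ.var 22 = a) (h23 : σ.var 23 = A.card) (h24 : σ.var 24 = b) (h25 : σ.var 25 = B.card)
    {p : Finset (Fin n) × ℚ}
    (hp : Stored I v₀ c p (σ.var 18) (σ.var 19) (σ.var 20) (σ.var 21)) :
    Runs w tryCmd σ fun σ' t => t ≤ 30 ∧ Stored I v₀ c (improve G p (joined v₀ c A B))
      (σ'.var 18) (σ'.var 19) (σ'.var 20) (σ'.var 21) := by
  have hr := (⟨h.mem, hA, hB⟩ : I.Candidate v₀ c a b A B).records h.offset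
  change Records I v₀ c a b A B _ (Fintype.card (Fin n) - leftCount I a - rightCount I b) _ at hr
  obtain ⟨a', b', A', B', hp, ha', hb'⟩ := hp
  have l1 := hr.nbhd_le
  have l2 := hr.card_le
  have l3 := hp.nbhd_le
  have l4 := hp.card_le
  have l5 := Finset.card_le_univ A
  have l6 := Finset.card_le_univ B
  rw [Fintype.card_fin] at l1 l2 l3 l4 l5 l6 hr
  -- All sizes are at most `n`, so the cross products do not overflow.
  have l7 := Nat.mul_le_mul l3 l2
  have l8 := Nat.mul_le_mul l1 l4
  refine .seq (.assign (k := n - leftCount I a - rightCount I b) ?_ ?_)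
  · rw [eval_sub (eval_sub (eval_var h.size) (eval_get (eval_var h22))) (eval_get (eval_var h24)),
      h.leftCount, h.rightCount]
  refine .seq (.assign (k := A.card + B.card - σ.var 17) ?_ ?_)
  · exact eval_sub (eval_add (by simpa [Expr.eval] using h23) (by simpa [Expr.eval] using h25)
      (by omega)) (by simp [Expr.eval])
  have hlt := hp.lt_iff hr
  have heval := eval_lt (w := w)
    (eval_mul (w := w) (σ := (σ.setVar 26 (n - leftCount I a - rightCount I b)).setVar 27
      (A.card + B.card - σ.var 17)) (e := .var 18) (f := .var 27) (a := σ.var 18)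
      (by simp [Expr.eval])
      (b := A.card + B.card - σ.var 17) (by simp [Expr.eval]) (by omega))
    (eval_mul (w := w) (e := .var 26) (f := .var 19) (a := n - leftCount I a - rightCount I b)
      (by simp [Expr.eval]) (b := σ.var 19) (by simp [Expr.eval]) (by omega)) (by omega)
  refine .ite (fun g => ?_) fun g => ?_
  · rw [heval, ite_ne_zero, ← hlt] at g
    rw [improve_of_lt g]
    refine .seq (.assign rfl (.seq (.assign rfl (.seq (.assign rfl
      (.assign rfl ⟨by decide, ?_⟩))))))
    refine ⟨a, b, A, B, ?_, by simp [Expr.eval, h22], by simp [Expr.eval, h24]⟩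
    simpa [Expr.eval] using hr
  · rw [heval, ite_eq_zero, ← hlt] at g
    rw [improve_of_not_lt g]
    exact .assign rfl ⟨by decide, a', b', A', B', by simpa using hp, by simpa using ha',
      by simpa using hb'⟩

/-- Tries all candidates with a fixed expansion to the left. -/
def rightCmd : Cmd :=
  .seq (.assign 24 (.var 4)) <| .seq (.assign 25 (.const 1)) <|
  .while (.lt (.var 24) (.var 0)) <| .seq tryCmd <|
  .seq (.assign 24 (.get 15 (.var 24))) (.assign 25 (.add (.var 25) (.const 1)))

theorem runs_rightCmd (hw : 4 * (n * n) + 16 * n + 16 < 2 ^ w) (h : HasBase I v₀ c σ)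
    {a : Fin n} {A : Finset (Fin n)} (hA : I.Chain .left c a A)
    (h22 : σ.var 22 = a) (h23 : σ.var 23 = A.card) {p : Finset (Fin n) × ℚ}
    (hp : Stored I v₀ c p (σ.var 18) (σ.var 19) (σ.var 20) (σ.var 21)) :
    Runs w rightCmd σ fun σ' t => t ≤ n * 50 + 10 ∧
      Stored I v₀ c (tryRight G v₀ c A (I.expand .right c) p)
        (σ'.var 18) (σ'.var 19) (σ'.var 20) (σ'.var 21) := by
  have hlt : ∀ {σ' : Store}, HasBase I v₀ c σ' →
      (Expr.lt (.var 24) (.var 0)).eval w σ' = if σ'.var 24 < n then 1 else 0 := fun h' =>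
    eval_lt rfl (eval_var h'.size) (by omega)
  refine .seq (.assign (eval_var h.node) (.seq (.assign (eval_const (by omega)) ?_)))
  have h1 : HasBase I v₀ c ((σ.setVar 24 c).setVar 25 1) :=
    (h.setVar _ (by decide)).setVar _ (by decide)
  refine .whileLoop (fun σ' t => t + stepsFrom I .right (σ'.var 24) * 50 ≤ n * 50 ∧
    ∃ L q, Pending I .right c (σ'.var 24) (σ'.var 25) L ∧
      Stored I v₀ c q (σ'.var 18) (σ'.var 19) (σ'.var 20) (σ'.var 21) ∧
      tryRight G v₀ c A L q = tryRight G v₀ c A (I.expand .right c) p)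
    (fun σ' => stepsFrom I .right (σ'.var 24)) ?_ ?_ ?_
  · refine ⟨?_, I.expand .right c, p, by simpa using pending_expand I .right c, by simpa using hp,
      rfl⟩
    rw [zero_add]
    exact Nat.mul_le_mul_right _ (stepsFrom_le I _ _)
  · rintro σ' t ⟨ht, L, q, hL, hq, heq⟩ hs g
    have h' : HasBase I v₀ c σ' := h1.same hs (by decide) (by decide)
    rw [hlt h', ite_ne_zero] at g
    obtain ⟨b, Q, L', hb, hk, hQ, rfl, hL'⟩ := hL.eq_cons g
    refine .seq ((runs_tryCmd hw h' hA hQ ((hs.var 22 (by decide)).trans (by simpa using h22))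
      ((hs.var 23 (by decide)).trans (by simpa using h23)) hb hk hq).mono_same ?_)
    rintro σ'' s hs' ⟨hs1, hs2⟩
    have h'' : HasBase I v₀ c σ'' := h'.same hs' (by decide) (by decide)
    have hb' : σ''.var 24 = b := (hs'.var 24 (by decide)).trans hb
    have hk' : σ''.var 25 = Q.card := (hs'.var 25 (by decide)).trans hk
    have hn' : (Expr.get 15 (.var 24)).eval w σ'' = nextIndex I .right b := by
      rw [eval_get (eval_var hb'), h''.nextRight]
    have hQn := Finset.card_le_univ Q
    rw [Fintype.card_fin] at hQn
    refine .seq (.assign hn' (.assign (eval_add (eval_var (k := Q.card) (by simpa using hk'))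
      (eval_const (by omega)) (by omega)) ?_))
    have hstep := stepsFrom_next I .right b
    refine ⟨⟨?_, L', _, ?_, ?_, heq⟩, ?_⟩
    · simp only [Store.setVar_var, Expr.cost]
      rw [hb] at ht
      norm_num
      omega
    · simpa [hk] using hL'
    · simpa using hs2
    · simp only [Store.setVar_var, hb]
      norm_num
      omega
  · rintro σ' t ⟨ht, L, q, hL, hq, heq⟩ hs g
    have h' : HasBase I v₀ c σ' := h1.same hs (by decide) (by decide)
    rw [hlt h', ite_eq_zero] at g
    rw [hL.eq_nil g] at heq
    refine ⟨?_, ?_⟩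
    · simp only [Expr.cost]
      omega
    · rw [← heq]
      exact hq

/-- Tries all candidates for the base in the variable `4`. -/
def leftCmd : Cmd :=
  .seq (.assign 22 (.var 4)) <| .seq (.assign 23 (.const 1)) <|
  .while (.lt (.var 22) (.var 0)) <| .seq rightCmd <|
  .seq (.assign 22 (.get 14 (.var 22))) (.assign 23 (.add (.var 23) (.const 1)))

theorem runs_leftCmd (hw : 4 * (n * n) + 16 * n + 16 < 2 ^ w) (h : HasBase I v₀ c σ)
    {p : Finset (Fin n) × ℚ}
    (hp : Stored I v₀ c p (σ.var 18) (σ.var 19) (σ.var 20) (σ.var 21)) :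
    Runs w leftCmd σ fun σ' t => t ≤ n * (n * 50 + 30) + 10 ∧
      Stored I v₀ c (tryLeft I v₀ c (I.expand .left c) p)
        (σ'.var 18) (σ'.var 19) (σ'.var 20) (σ'.var 21) := by
  have hlt : ∀ {σ' : Store}, HasBase I v₀ c σ' →
      (Expr.lt (.var 22) (.var 0)).eval w σ' = if σ'.var 22 < n then 1 else 0 := fun h' =>
    eval_lt rfl (eval_var h'.size) (by omega)
  refine .seq (.assign (eval_var h.node) (.seq (.assign (eval_const (by omega)) ?_)))
  have h1 : HasBase I v₀ c ((σ.setVar 22 c).setVar 23 1) :=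
    (h.setVar _ (by decide)).setVar _ (by decide)
  refine .whileLoop (fun σ' t => t + stepsFrom I .left (σ'.var 22) * (n * 50 + 30) ≤
      n * (n * 50 + 30) ∧
    ∃ L q, Pending I .left c (σ'.var 22) (σ'.var 23) L ∧
      Stored I v₀ c q (σ'.var 18) (σ'.var 19) (σ'.var 20) (σ'.var 21) ∧
      tryLeft I v₀ c L q = tryLeft I v₀ c (I.expand .left c) p)
    (fun σ' => stepsFrom I .left (σ'.var 22)) ?_ ?_ ?_
  · refine ⟨?_, I.expand .left c, p, by simpa using pending_expand I .left c, by simpa using hp,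
      rfl⟩
    rw [zero_add]
    exact Nat.mul_le_mul_right _ (stepsFrom_le I _ _)
  · rintro σ' t ⟨ht, L, q, hL, hq, heq⟩ hs g
    have h' : HasBase I v₀ c σ' := h1.same hs (by decide) (by decide)
    rw [hlt h', ite_ne_zero] at g
    obtain ⟨a, Q, L', ha, hk, hQ, rfl, hL'⟩ := hL.eq_cons g
    refine .seq ((runs_rightCmd hw h' hQ ha hk hq).mono_same ?_)
    rintro σ'' s hs' ⟨hs1, hs2⟩
    have h'' : HasBase I v₀ c σ'' := h'.same hs' (by decide) (by decide)
    have ha' : σ''.var 22 = a := (hs'.var 22 (by decide)).trans ha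
    have hk' : σ''.var 23 = Q.card := (hs'.var 23 (by decide)).trans hk
    have hn' : (Expr.get 14 (.var 22)).eval w σ'' = nextIndex I .left a := by
      rw [eval_get (eval_var ha'), h''.nextLeft]
    have hQn := Finset.card_le_univ Q
    rw [Fintype.card_fin] at hQn
    refine .seq (.assign hn' (.assign (eval_add (eval_var (k := Q.card) (by simpa using hk'))
      (eval_const (by omega)) (by omega)) ?_))
    have hstep := stepsFrom_next I .left a
    refine ⟨⟨?_, L', _, ?_, ?_, heq⟩, ?_⟩
    · have hmul := Nat.mul_le_mul_right (n * 50 + 30) hstep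
      rw [add_mul, one_mul] at hmul
      simp only [Store.setVar_var, Expr.cost]
      rw [ha] at ht
      norm_num
      omega
    · simpa [hk] using hL'
    · simpa using hs2
    · simp only [Store.setVar_var, ha]
      norm_num
      omega
  · rintro σ' t ⟨ht, L, q, hL, hq, heq⟩ hs g
    have h' : HasBase I v₀ c σ' := h1.same hs (by decide) (by decide)
    rw [hlt h', ite_eq_zero] at g
    rw [hL.eq_nil g] at heq
    refine ⟨?_, ?_⟩
    · simp only [Expr.cost]
      omega
    · rw [← heq]
      exact hq

end Search

/-! ### The best base -/

section Best

variable {n w : ℕ} {σ : Store} {G : SimpleGraph (Fin n)} {I : Realization G} {v₀ c : Fin n}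

/-- Finds the best candidate for the base in the variable `4`, and stores it if its ratio is greater
than the quotient of the variables `2` and `3`. -/
def baseCmd : Cmd :=
  .seq (.assign 17 (.eq (.var 4) (.var 1))) <|
  .seq (.assign 18 (.sub (.sub (.var 0) (.get 12 (.var 4))) (.get 13 (.var 4)))) <|
  .seq (.assign 19 (.sub (.const 2) (.var 17))) <|
  .seq (.assign 20 (.var 4)) <| .seq (.assign 21 (.var 4)) <| .seq leftCmd <|
  .ite (.lt (.mul (.var 2) (.var 19)) (.mul (.var 18) (.var 3)))
    (.seq (.assign 2 (.var 18)) <| .seq (.assign 3 (.var 19)) <|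
      .seq (.assign 28 (.var 4)) <| .seq (.assign 29 (.var 20)) (.assign 30 (.var 21))) noop

/-- The variables `2`, `3`, `28`, `29`, `30` describe a pair of maximum ratio among the bases with
an index less than `j`. The ratio of the pair is represented by `0 / 1` if there is no such base. -/
def Found (I : Realization G) (v₀ : Fin n) (j : ℕ) (σ : Store) : Prop :=
  (σ.var 2 = 0 ∧ σ.var 3 = 1 ∧ ∀ c : Fin n, (c : ℕ) < j → c ∉ I.bases v₀) ∨
    ∃ c : Fin n, σ.var 28 = c ∧
      Stored I v₀ c (bestFor I v₀ c) (σ.var 2) (σ.var 3) (σ.var 29) (σ.var 30) ∧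
      ∀ c' : Fin n, (c' : ℕ) < j → c' ∈ I.bases v₀ → (bestFor I v₀ c').2 ≤ (bestFor I v₀ c).2

theorem runs_baseCmd (hw : 4 * (n * n) + 16 * n + 16 < 2 ^ w) (h : HasTables I v₀ σ)
    (hc : c ∈ I.bases v₀) (h4 : σ.var 4 = c) (hf : Found I v₀ c σ) :
    Runs w baseCmd σ fun σ' t => t ≤ n * (n * 50 + 30) + 60 ∧ Found I v₀ (c + 1) σ' := by
  obtain ⟨o, ho, ho'⟩ : ∃ o, (Expr.eq (.var 4) (.var 1)).eval w σ = o ∧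
      (c = v₀ → o = 1) ∧ (c ≠ v₀ → o = 0) := by
    refine ⟨_, eval_eq (eval_var h4) (eval_var h.root) (by omega), ?_⟩
    simp +contextual [Fin.ext_iff]
  have ho2 : o ≤ 1 := by
    by_cases hcv : c = v₀
    · exact (ho'.1 hcv).le
    · exact (ho'.2 hcv).le.trans (Nat.zero_le 1)
  refine .seq (.assign ho (.seq (.assign (k := n - leftCount I c - rightCount I c) ?_
    (.seq (.assign (k := 1 + 1 - o) ?_ (.seq (.assign (k := c) (by simp [Expr.eval, h4])
      (.seq (.assign (k := c) (by simp [Expr.eval, h4]) (.seq ?_))))))))))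
  · rw [eval_sub (eval_sub (eval_var (k := n) (by simpa using h.size))
      (eval_get (eval_var (k := c) (by simpa using h4))))
      (eval_get (eval_var (k := c) (by simpa using h4)))]
    simp [h.leftCount, h.rightCount]
  · exact eval_sub (eval_const (by omega)) (by simp [Expr.eval])
  set σ₁ := ((((σ.setVar 17 o).setVar 18 (n - leftCount I c - rightCount I c)).setVar 19
    (1 + 1 - o)).setVar 20 c).setVar 21 c with hσ₁
  have hs1 : Same baseCmd σ σ₁ := by
    refine ⟨fun x hx => ?_, fun _ _ => rfl⟩
    simp only [baseCmd, Cmd.vars, List.mem_append, List.mem_singleton, not_or] at hx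
    simp [hσ₁, hx]
  have hb : HasBase I v₀ c σ₁ :=
    ⟨h.same hs1 (by decide) (by decide), hc, by simpa [hσ₁] using h4, by simpa [hσ₁] using ho'⟩
  -- `Combine` starts with `{v₀, c}`, the candidate whose expansions have only the node `c`.
  have hr := (⟨hc, .base, .base⟩ : I.Candidate v₀ c c c {c} {c}).records ho'
  change Records I v₀ c c c _ _ _ (Fintype.card (Fin n) - leftCount I c - rightCount I c) _ at hr
  rw [Fintype.card_fin, Finset.card_singleton] at hr
  refine (runs_leftCmd hw hb ⟨c, c, {c}, {c}, by simpa [hσ₁] using hr, by simp [hσ₁],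
    by simp [hσ₁]⟩).mono_same ?_
  rintro σ₂ t₂ hs2 ⟨ht2, a, b, A, B, hr2, ha, hb2⟩
  change Records I v₀ c a b A B (bestFor I v₀ c) _ _ at hr2
  have v2 : σ₂.var 2 = σ.var 2 := (hs2.var 2 (by decide)).trans (by simp [hσ₁])
  have v3 : σ₂.var 3 = σ.var 3 := (hs2.var 3 (by decide)).trans (by simp [hσ₁])
  have v4 : σ₂.var 4 = c := (hs2.var 4 (by decide)).trans (by simpa [hσ₁] using h4)
  have v28 : σ₂.var 28 = σ.var 28 := (hs2.var 28 (by decide)).trans (by simp [hσ₁])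
  have v29 : σ₂.var 29 = σ.var 29 := (hs2.var 29 (by decide)).trans (by simp [hσ₁])
  have v30 : σ₂.var 30 = σ.var 30 := (hs2.var 30 (by decide)).trans (by simp [hσ₁])
  have l1 := hr2.nbhd_le
  have l2 := hr2.card_le
  rw [Fintype.card_fin] at l1 l2
  have hbound : σ.var 2 ≤ n ∧ σ.var 3 ≤ n := by
    rcases hf with ⟨e2, e3, -⟩ | ⟨c', -, ⟨a', b', A', B', hr', -, -⟩, -⟩
    · have := c.2
      omega
    · have l3 := hr'.nbhd_le
      have l4 := hr'.card_le
      rw [Fintype.card_fin] at l3 l4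
      exact ⟨l3, l4⟩
  have l3 := Nat.mul_le_mul hbound.1 l2
  have l4 := Nat.mul_le_mul l1 hbound.2
  have heval := eval_lt (w := w) (eval_mul (w := w) (σ := σ₂) (eval_var (x := 2) v2)
    (eval_var (x := 19) rfl) (by omega))
    (eval_mul (w := w) (eval_var (x := 18) rfl) (eval_var (x := 3) v3) (by omega)) (by omega)
  have hstep : ∀ c' : Fin n, (c' : ℕ) < c + 1 ↔ (c' : ℕ) < c ∨ c' = c := fun c' => by
    rw [Nat.lt_succ_iff_lt_or_eq, Fin.ext_iff]
  refine .ite (fun g => ?_) fun g => ?_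
  · rw [heval, ite_ne_zero] at g
    refine .seq (.assign rfl (.seq (.assign rfl (.seq (.assign rfl
      (.seq (.assign rfl (.assign rfl ⟨?_, .inr ⟨c, ?_, ⟨a, b, A, B, ?_, ?_, ?_⟩, ?_⟩⟩))))))))
    · simp only [Expr.cost]
      omega
    · simp [Expr.eval, v4]
    · simpa [Expr.eval] using hr2
    · simp [Expr.eval, ha]
    · simp [Expr.eval, hb2]
    · intro c' hc' hc''
      rcases (hstep c').1 hc' with hlt | rfl
      · rcases hf with ⟨-, -, hf⟩ | ⟨c₁, -, ⟨a', b', A', B', hr', -, -⟩, hf⟩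
        · exact absurd hc'' (hf c' hlt)
        · exact (hf c' hlt hc'').trans ((hr'.lt_iff hr2).2 g).le
      · exact le_rfl
  · rw [heval, ite_eq_zero] at g
    refine .assign rfl ⟨?_, ?_⟩
    · simp only [Expr.cost]
      omega
    rcases hf with ⟨e2, e3, -⟩ | ⟨c₁, hc₁, ⟨a', b', A', B', hr', ha', hb'⟩, hf⟩
    · -- The ratio of a candidate is positive and hence greater than `0 / 1`.
      rw [e2, e3] at g
      have := hr2.nbhd_pos
      omega
    · refine .inr ⟨c₁, by simpa [v28] using hc₁, ⟨a', b', A', B', by simpa [v2, v3] using hr',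
        by simpa [v29] using ha', by simpa [v30] using hb'⟩, fun c' hc' hc'' => ?_⟩
      rcases (hstep c').1 hc' with hlt | rfl
      · exact hf c' hlt hc''
      · exact not_lt.1 fun hlt => g ((hr'.lt_iff hr2).1 hlt)

/-- Searches the candidates of all bases. -/
def searchCmd : Cmd :=
  .seq (.assign 2 (.const 0)) <| .seq (.assign 3 (.const 1)) <|
  loop 4 (.ite (.get 16 (.var 4)) baseCmd noop)

theorem runs_searchCmd (hw : 4 * (n * n) + 16 * n + 16 < 2 ^ w) (h : HasTables I v₀ σ) :
    Runs w searchCmd σ fun σ' t => t ≤ n * (n * (n * 50 + 30) + 80) + 20 ∧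
      ∃ c a b A B, Records I v₀ c a b A B (bestFor I v₀ c) (σ'.var 2) (σ'.var 3) ∧
        IsIntervalOutput I v₀ (bestFor I v₀ c) ∧
        σ'.var 28 = c ∧ σ'.var 29 = a ∧ σ'.var 30 = b := by
  refine .seq (.assign (eval_const (by omega)) (.seq (.assign (eval_const (by omega)) ?_)))
  have h1 : HasTables I v₀ ((σ.setVar 2 0).setVar 3 1) := by
    refine h.same (d := searchCmd) ⟨fun x hx => ?_, fun _ _ => rfl⟩ (by decide) (by decide)
    simp only [searchCmd, Cmd.vars, List.mem_append, List.mem_singleton, not_or] at hx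
    simp [hx]
  refine .loop_const (n := n) (T := n * (n * 50 + 30) + 70) h1.size (by omega) (by decide)
    (by decide) (Found I v₀) (fun j σ' k h => by simpa [Found] using h)
    (.inl ⟨by simp, by simp, fun c hc => absurd hc (Nat.not_lt_zero _)⟩) ?_ ?_
  · intro c σ' hc hs hf
    have h' := h1.same hs (by decide) (by decide)
    have heval : (Expr.get 16 (.var 4)).eval w σ' = if c ∈ I.bases v₀ then 1 else 0 := by
      rw [eval_get (eval_var hc), h'.base]
    refine .ite (fun g => ?_) fun g => ?_
    · rw [heval, ite_ne_zero] at g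
      refine (runs_baseCmd hw h' g hc hf).mono fun σ'' t ht => ⟨?_, ht.2⟩
      have := ht.1
      simp only [Expr.cost]
      omega
    · rw [heval, ite_eq_zero] at g
      refine .assign rfl ⟨by simp only [Expr.cost]; omega, ?_⟩
      have hnew : ∀ c' : Fin n, (c' : ℕ) < c + 1 → c' ∈ I.bases v₀ → (c' : ℕ) < c := by
        intro c' hc' hmem
        rcases Nat.lt_succ_iff_lt_or_eq.1 hc' with hlt | heq
        · exact hlt
        · rw [Fin.ext heq] at hmem
          exact absurd hmem g
      have : Found I v₀ (c + 1) σ' := by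
        rcases hf with ⟨e2, e3, hf⟩ | ⟨c₁, hc₁, hst, hf⟩
        · exact .inl ⟨e2, e3, fun c' hc' hmem => hf c' (hnew c' hc' hmem) hmem⟩
        · exact .inr ⟨c₁, hc₁, hst, fun c' hc' hmem => hf c' (hnew c' hc' hmem) hmem⟩
      simpa [Found] using this
  · intro σ' t hs ht hf
    refine ⟨?_, ?_⟩
    · simp only [Expr.cost]
      have : n * (n * (n * 50 + 30) + 70 + 8) ≤ n * (n * (n * 50 + 30) + 80) :=
        Nat.mul_le_mul_left _ (by omega)
      omega
    rcases hf with ⟨-, -, hf⟩ | ⟨c, hc, ⟨a, b, A, B, hr, ha, hb⟩, hf⟩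
    · exact absurd (I.mem_bases.2 (.inl rfl)) (hf v₀ v₀.2)
    · refine ⟨c, a, b, A, B, hr, ⟨mem_sols_iff.2 ⟨c, hr.candidate.base, rfl⟩, ?_⟩, hc, ha, hb⟩
      intro q hq
      obtain ⟨c', hc', rfl⟩ := mem_sols_iff.1 hq
      exact hf c' c'.2 hc'

/-! ### The returned set -/

/-- Marks the nodes of an expansion of the node in the variable `28` to the side `D`, up to the node
in the variable `g`. -/
def markWalk (D : Side) (g : ℕ) : Cmd :=
  .seq (.assign 22 (.var 28)) <| .seq (.store 1 (.var 22) (.const 1)) <|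
  .while (.eq (.eq (.var 22) (.var g)) (.const 0)) <|
  .seq (.assign 22 (.get (nextArr D) (.var 22))) (.store 1 (.var 22) (.const 1))

open Classical in
theorem runs_markWalk (hw : 4 * (n * n) + 16 * n + 16 < 2 ^ w) (hI : I.DistinctEnds)
    (h : HasTables I v₀ σ) {D : Side} {g : ℕ} (hg : g ≠ 22) {b : Fin n} {A : Finset (Fin n)}
    (hA : I.Chain D c b A) (h28 : σ.var 28 = c) (hb : σ.var g = b) {P : Fin n → Prop}
    (hP : ∀ v : Fin n, σ.arr 1 v = if P v then 1 else 0) :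
    Runs w (markWalk D g) σ fun σ' t => t ≤ n * 20 + 20 ∧
      ∀ v : Fin n, σ'.arr 1 v = if P v ∨ v ∈ A then 1 else 0 := by
  have hw1 : 1 < 2 ^ w := by omega
  refine .seq (.assign (eval_var h28) (.seq (.store (j := c) (k := 1) (by simp [Expr.eval])
    (eval_const hw1) ?_)))
  have hs0 : Same (markWalk D g) σ ((σ.setVar 22 c).setArr 1 c 1) := by
    refine ⟨fun x hx => ?_, fun a ha => ?_⟩
    · simp only [markWalk, Cmd.vars, List.mem_append, List.mem_singleton, not_or] at hx
      simp [hx]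
    · simp only [markWalk, Cmd.arrs, List.mem_append, List.mem_singleton, not_or] at ha
      funext i
      simp [ha]
  have h1 := h.same hs0 (by cases D <;> simp [markWalk, Cmd.vars])
    (by cases D <;> simp [markWalk, Cmd.arrs])
  have heval : ∀ {σ' : Store} {a : Fin n}, σ'.var 22 = a → σ'.var g = b →
      (Expr.eq (.eq (.var 22) (.var g)) (.const 0)).eval w σ' = if a ≠ b then 1 else 0 := by
    intro σ' a h1 h2
    rw [eval_eq (eval_eq (eval_var h1) (eval_var h2) hw1) (eval_const (by omega)) hw1]
    simp [Fin.ext_iff]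
  refine .whileLoop (fun σ' t => t + stepsFrom I D (σ'.var 22) * 20 ≤ n * 20 ∧ HasTables I v₀ σ' ∧
    σ'.var g = b ∧ ∃ (a : Fin n) (Q : Finset (Fin n)), σ'.var 22 = a ∧ I.Chain D c a Q ∧
      A ∈ I.expandFrom D a Q ∧
      ∀ v : Fin n, σ'.arr 1 v = if P v ∨ v ∈ Q then 1 else 0)
    (fun σ' => stepsFrom I D (σ'.var 22)) ?_ ?_ ?_
  · refine ⟨?_, h1, by simpa [hg] using hb, c, {c}, by simp, .base, I.mem_expand_iff.2 ⟨b, hA⟩,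
      fun v => ?_⟩
    · rw [zero_add]
      exact Nat.mul_le_mul_right _ (stepsFrom_le I _ _)
    · simp only [Store.setArr_arr, Store.setVar_arr, hP, true_and, Finset.mem_singleton,
        Fin.ext_iff]
      by_cases hv : (v : ℕ) = c <;> simp [hv]
  · rintro σ' t ⟨ht, h', hg', a, Q, ha, hQ, hAQ, hm⟩ hs hne
    rw [heval ha hg', ite_ne_zero] at hne
    obtain ⟨heq, -⟩ | ⟨-, a', Q', hn, hQ', hmem, hAQ'⟩ := hQ.eq_or_next hI hA hAQ
    · exact absurd heq hne
    have hn' : (Expr.get (nextArr D) (.var 22)).eval w σ' = a' := by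
      rw [eval_get (eval_var ha), h'.next, nextIndex_some hn]
    refine .seq (.assign hn' (.store (j := a') (k := 1) (by simp [Expr.eval]) (eval_const hw1) ?_))
    have hs1 : Same (markWalk D g) σ' ((σ'.setVar 22 a').setArr 1 a' 1) := by
      refine ⟨fun x hx => ?_, fun a ha => ?_⟩
      · simp only [markWalk, Cmd.vars, List.mem_append, List.mem_singleton, not_or] at hx
        simp [hx]
      · simp only [markWalk, Cmd.arrs, List.mem_append, List.mem_singleton, not_or] at ha
        funext i
        simp [ha]
    have hstep := stepsFrom_next I D a
    rw [nextIndex_some hn] at hstep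
    refine ⟨⟨?_, h'.same hs1 (by cases D <;> simp [markWalk, Cmd.vars])
      (by cases D <;> simp [markWalk, Cmd.arrs]), by simpa [hg] using hg', a', Q', by simp, hQ',
      hAQ', fun v => ?_⟩, ?_⟩
    · rw [ha] at ht
      simp only [Store.setArr_var, Store.setVar_var, Expr.cost]
      norm_num
      omega
    · simp only [Store.setArr_arr, Store.setVar_arr, hm, true_and, hmem, Fin.ext_iff]
      by_cases hv : (v : ℕ) = a' <;> simp [hv]
    · simp only [Store.setArr_var, Store.setVar_var, ha]
      norm_num
      omega
  · rintro σ' t ⟨ht, h', hg', a, Q, ha, hQ, hAQ, hm⟩ hs hne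
    rw [heval ha hg', ite_eq_zero, not_not] at hne
    obtain ⟨-, rfl⟩ | ⟨hne', -⟩ := hQ.eq_or_next hI hA hAQ
    · refine ⟨?_, hm⟩
      simp only [Expr.cost]
      omega
    · exact absurd hne hne'

/-- Writes the indicator of the returned set to the array `1`. -/
def markCmd : Cmd :=
  .seq (.store 1 (.var 1) (.const 1)) (.seq (markWalk .left 29) (markWalk .right 30))

open Classical in
theorem runs_markCmd (hw : 4 * (n * n) + 16 * n + 16 < 2 ^ w) (hI : I.DistinctEnds)
    (h : HasTables I v₀ σ) {a b : Fin n} {A B : Finset (Fin n)} {p : Finset (Fin n) × ℚ} {N d : ℕ}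
    (hr : Records I v₀ c a b A B p N d) (h28 : σ.var 28 = c) (h29 : σ.var 29 = a)
    (h30 : σ.var 30 = b) (h0 : ∀ v : Fin n, σ.arr 1 v = 0) :
    Runs w markCmd σ fun σ' t => t ≤ n * 40 + 50 ∧
      ∀ v : Fin n, σ'.arr 1 v = if v ∈ p.1 then 1 else 0 := by
  have hw1 : 1 < 2 ^ w := by omega
  refine .seq (.store (eval_var h.root) (eval_const hw1) ?_)
  have h1 : HasTables I v₀ (σ.setArr 1 v₀ 1) := by
    refine h.same (d := markCmd) ⟨fun x hx => rfl, fun a ha => ?_⟩ (by decide) (by decide)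
    have : a ≠ 1 := by
      rintro rfl
      exact ha (by decide)
    funext i
    simp [this]
  refine .seq ((runs_markWalk (P := fun v => v = v₀) hw hI h1 (by decide) hr.candidate.left h28 h29
    fun v => ?_).mono_same ?_)
  · simp only [Store.setArr_arr, h0, true_and, Fin.ext_iff]
  rintro σ₁ t₁ hs1 ⟨ht1, hm1⟩
  refine (runs_markWalk hw hI (h1.same hs1 (by decide) (by decide)) (by decide)
    hr.candidate.right ((hs1.var 28 (by decide)).trans h28) ((hs1.var 30 (by decide)).trans h30)
    fun v => (hm1 v).trans (by congr)).mono ?_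
  rintro σ₂ t₂ ⟨ht2, hm2⟩
  refine ⟨?_, fun v => ?_⟩
  · simp only [Expr.cost]
    omega
  · rw [hm2]
    simp only [hr.mem_iff, or_assoc]

end Best

/-! ### The whole program -/

section Program

/-- The program for `Interval`, including the computation of a realization. The variables `0`, `1`
and the array `0` keep the input. The other parts of the memory are scratch space, apart from those
that hold the result. -/
def intervalProgram : Cmd :=
  .seq initState <| .seq orient <| .seq computeEnds <| .seq computeTables <|
  .seq searchCmd markCmd

/-- Words of logarithmic length are long enough for all numbers that occur. -/
theorem word_bound {n w : ℕ} (hn : 0 < n) (hw : 2000 * (Nat.log 2 n + 1) ≤ w) :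
    4 * (n * n) + 16 * n + 16 < 2 ^ w := by
  set m := 2 ^ (Nat.log 2 n + 1) with hm
  have h1 : n + 1 ≤ m := Nat.lt_pow_succ_log_self (by decide) n
  have h2 : m ^ 7 ≤ 2 ^ w := by
    rw [hm, ← pow_mul]
    exact Nat.pow_le_pow_right (by decide) (by omega)
  have h3 : 2 ^ 5 * ((n + 1) * (n + 1)) ≤ m ^ 5 * (m * m) :=
    Nat.mul_le_mul (Nat.pow_le_pow_left (by omega) 5) (Nat.mul_le_mul h1 h1)
  have h4 : m ^ 5 * (m * m) = m ^ 7 := by ring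
  have h5 : (n + 1) * (n + 1) = n * n + 2 * n + 1 := by ring
  omega

variable {n w : ℕ} {G : SimpleGraph (Fin n)}

theorem runs_intervalProgram (v₀ : Fin n) (J : Realization G)
    (hw : 4 * (n * n) + 16 * n + 16 < 2 ^ w) :
    Runs w intervalProgram (inputStore G v₀) fun σ t => t ≤ 2000 * n ^ 3 ∧
      ∃ (I : Realization G) (p : Finset (Fin n) × ℚ),
        I.DistinctEnds ∧ Holds σ I v₀ p ∧ IsIntervalOutput I v₀ p := by
  classical
  have i0 : (inputStore G v₀).var 0 = n := by simp [inputStore]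
  have i1 : (inputStore G v₀).var 1 = v₀ := by simp [inputStore]
  have a0 : ∀ k, (inputStore G v₀).arr 1 k = 0 := fun k => by simp [inputStore]
  refine .seq (runs_initState hw fun σ₁ t₁ ht1 hg hs1 => ?_)
  have n1 : σ₁.var 0 = n := (hs1.var 0 (by decide)).trans i0
  refine .seq (runs_orient hw n1 hg nonAdj_symm ⟨_, J.isTO⟩ fun σ₂ t₂ F ht2 hF h6 hs2 => ?_)
  have n2 : σ₂.var 0 = n := (hs2.var 0 (by decide)).trans n1
  refine .seq (runs_computeEnds hw n2 h6 fun σ₃ t₃ ht3 hl hr hs3 => ?_)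
  have n3 : σ₃.var 0 = n := (hs3.var 0 (by decide)).trans n2
  have r3 : σ₃.var 1 = v₀ := by
    rw [hs3.var 1 (by decide), hs2.var 1 (by decide), hs1.var 1 (by decide), i1]
  have hI := rankRealization_distinctEnds J hF
  have he : HasEnds (rankRealization J hF) σ₃ := fun v => by
    rw [hl, hr]
    exact ⟨rfl, rfl⟩
  refine .seq (runs_computeTables hw n3 r3 hI he fun σ₄ t₄ ht4 htab hpos hs4 => ?_)
  refine .seq ((runs_searchCmd hw htab).mono_same ?_)
  rintro σ₅ t₅ hs5 ⟨ht5, c, a, b, A, B, hrec, hout, h28, h29, h30⟩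
  refine (runs_markCmd hw hI (htab.same hs5 (by decide) (by decide)) hrec h28 h29 h30
    fun v => ?_).mono_same ?_
  · rw [hs5.arr 1 (by decide), hs4.arr 1 (by decide), hs3.arr 1 (by decide),
      hs2.arr 1 (by decide), hs1.arr 1 (by decide), a0]
  rintro σ₆ t₆ hs6 ⟨ht6, hmem⟩
  refine ⟨?_, rankRealization J hF, bestFor _ v₀ c, hI, ⟨fun v => ?_, fun v => ?_, fun v k => ?_,
    fun v => ?_, ?_, ?_⟩, hout⟩
  · have hn : 1 ≤ n := v₀.pos
    have h1 : n ≤ n * n := Nat.le_mul_of_pos_left n hn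
    have h2 : n * n ≤ n * n * n := Nat.le_mul_of_pos_right _ hn
    have e1 : (n * 128 + 70) * (n * n) = 128 * (n * n * n) + 70 * (n * n) := by ring
    have e2 : n * (n * (n * 50 + 30) + 80) = 50 * (n * n * n) + 30 * (n * n) + 80 * n := by ring
    have e3 : ∀ x y, n * (n * x + y) = x * (n * n) + y * n := fun x y => by ring
    have e4 : n ^ 3 = n * n * n := by ring
    rw [e3] at ht1 ht3 ht4
    rw [e1, e3] at ht2
    rw [e2] at ht5
    rw [e4]
    omega
  · rw [hs6.arr 2 (by decide), hs5.arr 2 (by decide), hs4.arr 2 (by decide)]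
    exact (he v).1
  · rw [hs6.arr 3 (by decide), hs5.arr 3 (by decide), hs4.arr 3 (by decide)]
    exact (he v).2
  · rw [hs6.arr 4 (by decide), hs5.arr 4 (by decide), hpos, Realization.mem_region_iff _ hI,
      Fin.ext_iff]
  · rw [hmem]
  · rw [hs6.var 3 (by decide)]
    exact hrec.card_pos.ne'
  · rw [hs6.var 2 (by decide), hs6.var 3 (by decide)]
    exact hrec.value

end Program

end MRCE
end

theorem mainTheorem4 :
    (∀ (V : Type*) [Fintype V] (G : SimpleGraph V) (v₀ : V) (I : MRCE.Realization G),
      G.Connected → I.DistinctEnds →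
        (∀ v, ∃! k, v ∈ I.region v₀ k) ∧
        (∃ p, MRCE.IsIntervalOutput I v₀ p) ∧
        ∀ p, MRCE.IsIntervalOutput I v₀ p → MRCE.IsOptimal G v₀ p) ∧
    ∃ (Interval : MRCE.Cmd) (c : ℕ), ∀ (n : ℕ) (G : SimpleGraph (Fin n)) (v₀ : Fin n) (w : ℕ),
      G.Connected → MRCE.IsIntervalGraph G → c * (Nat.log 2 n + 1) ≤ w →
        ∃ (t : ℕ) (σ : MRCE.Store), MRCE.Exec w Interval (MRCE.inputStore G v₀) σ t ∧
          t ≤ c * n ^ 3 ∧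
          ∃ (I : MRCE.Realization G) (p : Finset (Fin n) × ℚ),
            I.DistinctEnds ∧ MRCE.Holds σ I v₀ p ∧
            MRCE.IsIntervalOutput I v₀ p ∧ MRCE.IsOptimal G v₀ p := by
  refine ⟨fun V _ G v₀ I _ hI => ⟨I.existsUnique_region hI v₀, MRCE.exists_isIntervalOutput I v₀,
    fun p hp => hp.isOptimal hI⟩, MRCE.intervalProgram, 2000, ?_⟩
  rintro n G v₀ w - ⟨J⟩ hw
  obtain ⟨σ, t, hexec, ht, I, p, hI, hholds, hp⟩ :=
    MRCE.runs_intervalProgram v₀ J (MRCE.word_bound v₀.pos hw)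
  exact ⟨t, σ, hexec, ht, I, p, hI, hholds, hp, hp.isOptimal hI⟩
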